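/- Let $m_1,m_2,m_3>0$, $m=m_1+m_2+m_3$, $h\in\mathbb R$. The planar three-body problem has the Hamiltonian $H(q,p)=\sum_i\frac{|p_i|^2}{2m_i}-\frac{m_1m_2}{|q_1-q_2|}-\frac{m_3m_1}{|q_3-q_1|}-\frac{m_2m_3}{|q_2-q_3|}$ on $\{(q,p)\in\mathbb C^3\times\mathbb C^3: q_i\ne q_j\}$; it is invariant under the translations $q\mapsto q+(c,c,c)$, $c\in\mathbb C$. Index vectors of $\mathbb C^3$ by the pairs $12,31,23$, and put $\langle P,Q\rangle=\sum\bar P_{ij}Q_{ij}$, $|X|^2=\frac1m(m_1m_2|X_{12}|^2+m_3m_1|X_{31}|^2+m_2m_3|X_{23}|^2)$, $X^*=\frac1m(m_1m_2X_{12},m_3m_1X_{31},m_2m_3X_{23})$, $K(Y)=\frac{|Y_{12}-Y_{31}|^2}{2m_1}+\frac{|Y_{23}-Y_{12}|^2}{2m_2}+\frac{|Y_{31}-Y_{23}|^2}{2m_3}$, $V(X)=|X|\left(\frac{m_1m_2}{|X_{12}|}+\frac{m_3m_1}{|X_{31}|}+\frac{m_2m_3}{|X_{23}|}\right)$ and $$H_{sph}(r,p_r,X,Y)=\tfrac12p_r^2+\tfrac{|X|^2}{r^2}K(Y)-\tfrac1rV(X).$$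 On $M=\{(r,p_r,z,\eta)\in\mathbb R\times\mathbb R\times\mathbb C^3\times\mathbb C^3: r>0,\ z\neq0\}$, with the canonical symplectic form, put $\rho_{ij}=|z_{ij}|^2$, $\|z\|^2=\rho_{12}+\rho_{31}+\rho_{23}$, $\tau=\rho_{12}\rho_{31}\rho_{23}/\|z\|^6$, $X_{ij}(z)=z_{ij}^2$, $\pi_1=\eta_{12}\bar z_{31}-\eta_{31}\bar z_{12}$, $\pi_2=\eta_{23}\bar z_{12}-\eta_{12}\bar z_{23}$, $\pi_3=\eta_{31}\bar z_{23}-\eta_{23}\bar z_{31}$, and $$\tilde H_{sph}=\frac{\tau p_r^2}2+\frac{|X(z)|^2}{r^2\|z\|^6}\Big(\frac{|\pi_1|^2\rho_{23}}{8m_1}+\frac{|\pi_2|^2\rho_{31}}{8m_2}+\frac{|\pi_3|^2\rho_{12}}{8m_3}\Big)-\frac{|X(z)|}{r\|z\|^6}\big(m_1m_2\rho_{31}\rho_{23}+m_3m_1\rho_{12}\rho_{23}+m_2m_3\rho_{12}\rho_{31}\big)-h\tau .$$ Let $N=\{\operatorname{Re}\langle\eta,z\rangle=0,\ z_{12}^2+z_{31}^2+z_{23}^2=0\}\subset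 M$ and $N^\circ=\{x\in N:\text{all }z_{ij}\ne0\}$. Let $\sim$ be the orbit relation of the group generated by the scalings $(z,\eta)\mapsto(kz,\eta/k)$, $k>0$, and the translations $\eta\mapsto\eta+2c\bar z$, $c\in\mathbb C$. For $z_{ij}\ne0$ put $Y_{ij}=\eta_{ij}/(2\bar z_{ij})$, $X=X(z)$, $Q=rX/|X|$, $P=p_rX^*/|X|+|X|Y/r$ and $\Psi(r,p_r,z,\eta)=(q,p)$, where $q=\frac1m(m_2Q_{12}-m_3Q_{31},\,m_3Q_{23}-m_1Q_{12},\,m_1Q_{31}-m_2Q_{23})$ and $p=(P_{12}-P_{31},P_{23}-P_{12},P_{31}-P_{23})$; the component $q$ is defined on all of $M$. Then the following hold. 1. $\tilde H_{sph}$ is $C^\infty$ on $M$, also where some $z_{ij}=0$, and where all $z_{ij}\ne0$ it equals $\tau\,(H_{sph}(r,p_r,X,Y)-h)$. Its Hamiltonian flow on $M$ exists locally and is unique. 2. $N$ is a submanifold of $M$ (the two equations have independent differentials along $N$), and it is invariant under the flow. 3. The scalings and translations are symplectic, preserve $M$, $N$ and $\tilde H_{sph}$, and act freely; the flow descends to the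 quotient by $\sim$. 4. $\Psi$ induces an $8$-sheeted covering map from $N^\circ/\!\sim$ onto the collision-free three-body states with $p_1+p_2+p_3=0$ modulo translations (not rotations). $\Psi$ is smooth where all $z_{ij}\neq0$, preserves the restriction of the symplectic forms to the tangent spaces of $N^\circ$, and $\tilde H_{sph}=\tau\,(H\circ\Psi-h)$ on $N^\circ$. 5. The map $q$ is continuous on $M$; on $N$ the three bodies never all coincide, and $q_i=q_j$ if and only if $z_{ij}=0$. 6. Let $\gamma$ be a solution of $\tilde H_{sph}$ in $N\cap\{\tilde H_{sph}=0\}$ on an open interval $J$. If $z_{ij}(\gamma(s))=0$, then the other two components of $z$ are non-zero at $\gamma(s)$ and $\frac{d}{ds}z_{ij}(\gamma(s))\ne0$; such times $s$ are isolated. There is a strictly increasing time change $t=\theta(s)$, $\theta'=\tau\circ\gamma$, after which $\Psi\circ\gamma$ is a solution of the three-body problem with zero total momentum and energy $h$, except at these isolated binary collisions, and the positions are continuous across them. 7. Conversely, let $\zeta$ be a three-body solution on an open interval $I$, with zero total momentum and energy $h$, and let $x_0\in N^\circ$ be such that $\Psi(x_0)=\zeta(t_0)$ modulo translations, $t_0\in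 I$. Then there are an open interval $J$, a solution $\gamma$ of $\tilde H_{sph}$ on $J$ in $N^\circ\cap\{\tilde H_{sph}=0\}$ through $x_0$, and a time change $\theta$ of $J$ onto $I$ with $\theta'=\tau\circ\gamma$, such that $\Psi(\gamma(s))=\zeta(\theta(s))$ modulo translations. The time change takes the parameter of $x_0$ to $t_0$. 8. If in 7 $I=(a,b)$ is bounded and the positions of $\zeta(t)$ converge, as $t\to b^-$, to a configuration where exactly one pair $ij$ of bodies coincides, then there is such a solution $\gamma$ that extends, as a solution in $N\cap\{\tilde H_{sph}=0\}$, to an open interval containing a parameter $s_1$ with $\theta(s_1)=b$ and $z_{ij}(\gamma(s_1))=0$, and the part of $\gamma$ before $s_1$ corresponds to $\zeta$ on $(a,b)$. -/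

import Mathlib

open Set Filter Topology
open scoped ContDiff ComplexConjugate

noncomputable section

namespace ThreeBody

/-! ### Phase spaces, symplectic forms, Hamiltonian curves -/

/-- Complex 3-vectors. For position-like and momentum-like vectors of the bodies, the indices
`0, 1, 2` are the bodies `1, 2, 3`; for relative, homogeneous and Levi-Civita variables, the
indices `0, 1, 2` are the pairs `12, 31, 23`. -/
abbrev Vec3 : Type := Fin 3 → ℂ

/-- Pairs (position in `ℂ³`, momentum in `ℂ³`). -/
abbrev Phase : Type := Vec3 × Vec3

/-- Quadruples `((r, p_r), (z, η))` (or `((r, p_r), (X, Y))`). -/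
abbrev ExtPhase : Type := (ℝ × ℝ) × Phase

/-- The Hermitian evaluation pairing `⟨P, Q⟩ = ∑ conj P_i Q_i`. -/
def pairing (P Q : Vec3) : ℂ := ∑ i, conj (P i) * Q i

/-- The canonical symplectic form `Re (dQ ∧ d conj P)` on `T*ℂ³`. -/
def omegaPhase (v w : Phase) : ℝ := (pairing w.2 v.1).re - (pairing v.2 w.1).re

/-- The canonical symplectic form on `T*ℝ⁺ × T*ℂ³`. -/
def omegaExt (v w : ExtPhase) : ℝ :=
  v.1.1 * w.1.2 - v.1.2 * w.1.1 + omegaPhase v.2 w.2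

/-- `γ` stays in `U` and solves Hamilton's equations of `H` with respect to the (constant)
symplectic form `Ω` at all times of `I`: the velocity `v` satisfies `Ω(v, ·) = dH`. -/
def IsHamiltonianCurve {E : Type*} [NormedAddCommGroup E] [NormedSpace ℝ E]
    (Ω : E → E → ℝ) (H : E → ℝ) (U : Set E) (γ : ℝ → E) (I : Set ℝ) : Prop :=
  ∀ t ∈ I, γ t ∈ U ∧ ∃ v : E, HasDerivAt γ v t ∧ ∀ w : E, Ω v w = fderiv ℝ H (γ t) w

/-- Open (possibly unbounded) intervals of the real line. -/
def IsOpenInterval (J : Set ℝ) : Prop := IsOpen J ∧ J.OrdConnected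

/-- `S` is the subset of the open set `U` cut out by the smooth equations `g = 0`, which are
independent along `S`; hence `S` is a closed embedded submanifold of `U`, with tangent spaces
`ker dg` and of codimension `dim F`. -/
def IsSubmanifoldCutOutBy {E F : Type*} [NormedAddCommGroup E] [NormedSpace ℝ E]
    [NormedAddCommGroup F] [NormedSpace ℝ F] (U : Set E) (g : E → F) (S : Set E) : Prop :=
  IsOpen U ∧ S = {x ∈ U | g x = 0} ∧ ContDiffOn ℝ ∞ g U ∧
    ∀ x ∈ S, Function.Surjective (fderiv ℝ g x)

/-! ### The planar three-body problem -/

/-- Total mass. -/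
def totalMass (m : Fin 3 → ℝ) : ℝ := ∑ i, m i

/-- The products `m₁m₂, m₃m₁, m₂m₃`. -/
def pairMass (m : Fin 3 → ℝ) : Fin 3 → ℝ := ![m 0 * m 1, m 2 * m 0, m 1 * m 2]

/-- Relative positions `(q₁ - q₂, q₃ - q₁, q₂ - q₃)`. -/
def relPos (q : Vec3) : Vec3 := ![q 0 - q 1, q 2 - q 0, q 1 - q 2]

/-- The dual map `(P₁₂ - P₃₁, P₂₃ - P₁₂, P₃₁ - P₂₃)` from relative momenta to momenta. -/
def absMom (P : Vec3) : Vec3 := ![P 0 - P 1, P 2 - P 0, P 1 - P 2]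

/-- Positions with center of mass at the origin and given relative positions `Q` (when
`Q₁₂ + Q₃₁ + Q₂₃ = 0`). -/
def absPos (m : Fin 3 → ℝ) (Q : Vec3) : Vec3 :=
  ![(m 1 * Q 0 - m 2 * Q 1) / totalMass m,
    (m 2 * Q 2 - m 0 * Q 0) / totalMass m,
    (m 0 * Q 1 - m 1 * Q 2) / totalMass m]

/-- `K₀(p) = ∑ |p_i|² / (2 m_i)`. -/
def kineticAbs (m : Fin 3 → ℝ) (p : Vec3) : ℝ := ∑ i, ‖p i‖ ^ 2 / (2 * m i)

/-- `K(P) = K₀(L* P)`. -/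
def kineticRel (m : Fin 3 → ℝ) (P : Vec3) : ℝ := kineticAbs m (absMom P)

/-- `U(Q) = m₁m₂/|Q₁₂| + m₃m₁/|Q₃₁| + m₂m₃/|Q₂₃|`. -/
def newtonU (m : Fin 3 → ℝ) (Q : Vec3) : ℝ := ∑ i, pairMass m i / ‖Q i‖

/-- The Hamiltonian of the planar three-body problem. -/
def threeBodyHam (m : Fin 3 → ℝ) (x : Phase) : ℝ := kineticAbs m x.2 - newtonU m (relPos x.1)

/-- Collision-free states of the three bodies. -/
def threeBodyDomain : Set Phase := {x | ∀ i, relPos x.1 i ≠ 0}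

/-- Collision-free states with zero total momentum. -/
def zeroMomentum : Set Phase := {x | x ∈ threeBodyDomain ∧ ∑ i, x.2 i = 0}

/-- The three-body trajectories with zero total momentum and energy `h`. -/
def IsThreeBodyCurve (m : Fin 3 → ℝ) (h : ℝ) (ζ : ℝ → Phase) (I : Set ℝ) : Prop :=
  IsHamiltonianCurve omegaPhase (threeBodyHam m) threeBodyDomain ζ I ∧
    ∀ t ∈ I, ζ t ∈ zeroMomentum ∧ threeBodyHam m (ζ t) = h

/-- Orbits of the translations `(q, p) ↦ (q + (c, c, c), p)`. -/
def translationSetoid : Setoid Phase where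
  r x y := ∃ c : ℂ, y = (fun i => x.1 i + c, x.2)
  iseqv :=
    { refl := fun x => ⟨0, by simp⟩
      symm := by
        rintro x y ⟨c, rfl⟩
        exact ⟨-c, by simp⟩
      trans := by
        rintro x y z ⟨c, rfl⟩ ⟨d, rfl⟩
        exact ⟨c + d, by simp [add_assoc]⟩ }

/-- The zero total momentum phase space reduced by translations. -/
abbrev ReducedThreeBody : Type :=
  Quotient (translationSetoid.comap (Subtype.val : zeroMomentum → Phase))

/-! ### Spherical-homogeneous variables `(r, p_r, X, Y)` -/

/-- The mass norm `|X|`. -/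
def massNorm (m : Fin 3 → ℝ) (X : Vec3) : ℝ :=
  Real.sqrt ((∑ i, pairMass m i * ‖X i‖ ^ 2) / totalMass m)

/-- The covector `X*` dual to `X` for the mass metric. -/
def massDual (m : Fin 3 → ℝ) (X : Vec3) : Vec3 :=
  fun i => ((pairMass m i / totalMass m : ℝ) : ℂ) * X i

/-- `V(X) = |X| U(X)`. -/
def shapePotential (m : Fin 3 → ℝ) (X : Vec3) : ℝ := massNorm m X * newtonU m X

/-- `H_sph = p_r²/2 + |X|² K(Y) / r² - V(X) / r`. -/
def sphHam (m : Fin 3 → ℝ) (x : ExtPhase) : ℝ :=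
  x.1.2 ^ 2 / 2 + massNorm m x.2.1 ^ 2 / x.1.1 ^ 2 * kineticRel m x.2.2
    - shapePotential m x.2.1 / x.1.1

/-- `(r, p_r, X, Y) ↦ (Q, P)`, `Q = r X / |X|`, `P = p_r X* / |X| + |X| Y / r`. -/
def sphToRel (m : Fin 3 → ℝ) (x : ExtPhase) : Phase :=
  (fun i => ((x.1.1 / massNorm m x.2.1 : ℝ) : ℂ) * x.2.1 i,
   fun i => ((x.1.2 / massNorm m x.2.1 : ℝ) : ℂ) * massDual m x.2.1 i
      + ((massNorm m x.2.1 / x.1.1 : ℝ) : ℂ) * x.2.2 i)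

/-! ### Levi-Civita variables `(r, p_r, z, η)` and the regularized Hamiltonian -/

/-- `T*ℝ⁺ × T*ℂ³₀`: `r > 0` and `z ≠ 0`. -/
def extDomain : Set ExtPhase := {x | 0 < x.1.1 ∧ x.2.1 ≠ 0}

/-- `(r, p_r, z, η) ↦ (r, p_r, X, Y)`, `X_ij = z_ij²`, `Y_ij = η_ij / (2 conj z_ij)`. -/
def leviCivita (x : ExtPhase) : ExtPhase :=
  (x.1, (fun i => x.2.1 i ^ 2, fun i => x.2.2 i / (2 * conj (x.2.1 i))))

/-- `ρ_ij = |z_ij|²`. -/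
def rho (z : Vec3) (i : Fin 3) : ℝ := ‖z i‖ ^ 2

/-- `‖z‖² = ρ₁₂ + ρ₃₁ + ρ₂₃`. -/
def normSqZ (z : Vec3) : ℝ := ∑ i, rho z i

/-- The time rescaling factor `τ = ρ₁₂ ρ₃₁ ρ₂₃ / ‖z‖⁶`. -/
def tau (z : Vec3) : ℝ := rho z 0 * rho z 1 * rho z 2 / normSqZ z ^ 3

/-- `|X(z)|`, where `X(z) = (z₁₂², z₃₁², z₂₃²)`. -/
def massNormZ (m : Fin 3 → ℝ) (z : Vec3) : ℝ := massNorm m (fun i => z i ^ 2)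

/-- `(π₁, π₂, π₃)`. -/
def piVec (z η : Vec3) : Vec3 :=
  ![η 0 * conj (z 1) - η 1 * conj (z 0),
    η 2 * conj (z 0) - η 0 * conj (z 2),
    η 1 * conj (z 2) - η 2 * conj (z 1)]

/-- The regularized shape potential `W`. -/
def regPotential (m : Fin 3 → ℝ) (z : Vec3) : ℝ :=
  massNormZ m z / normSqZ z ^ 3 *
    (pairMass m 0 * rho z 1 * rho z 2 + pairMass m 1 * rho z 0 * rho z 2
      + pairMass m 2 * rho z 0 * rho z 1)

/-- The regularized spherical Hamiltonian at energy `h`. -/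
def regHam (m : Fin 3 → ℝ) (h : ℝ) (x : ExtPhase) : ℝ :=
  tau x.2.1 * x.1.2 ^ 2 / 2
    + massNormZ m x.2.1 ^ 2 / (x.1.1 ^ 2 * normSqZ x.2.1 ^ 3) *
      (‖piVec x.2.1 x.2.2 0‖ ^ 2 * rho x.2.1 2 / (8 * m 0)
        + ‖piVec x.2.1 x.2.2 1‖ ^ 2 * rho x.2.1 1 / (8 * m 1)
        + ‖piVec x.2.1 x.2.2 2‖ ^ 2 * rho x.2.1 0 / (8 * m 2))
    - regPotential m x.2.1 / x.1.1 - h * tau x.2.1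

/-- The Hamiltonian curves of the regularized Hamiltonian on `T*ℝ⁺ × T*ℂ³₀`. -/
def IsRegCurve (m : Fin 3 → ℝ) (h : ℝ) (γ : ℝ → ExtPhase) (J : Set ℝ) : Prop :=
  IsHamiltonianCurve omegaExt (regHam m h) extDomain γ J

/-- The constraints `Re ⟨η, z⟩` and `z₁₂² + z₃₁² + z₂₃²`. -/
def constraint (x : ExtPhase) : ℝ × ℂ := ((pairing x.2.2 x.2.1).re, ∑ i, x.2.1 i ^ 2)

/-- `T*ℝ⁺ × T*_{sph, 𝒞} ℂ³₀`. -/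
def constraintSet : Set ExtPhase :=
  {x ∈ extDomain | (pairing x.2.2 x.2.1).re = 0 ∧ ∑ i, x.2.1 i ^ 2 = 0}

/-- The part of the constraint submanifold without binary collisions. -/
def collisionFree : Set ExtPhase := {x ∈ constraintSet | ∀ i, x.2.1 i ≠ 0}

/-- The Hamiltonian curves on the constraint submanifold on which the regularized Hamiltonian
vanishes, which is the level that belongs to the energy `h`. -/
def IsZeroLevelCurve (m : Fin 3 → ℝ) (h : ℝ) (γ : ℝ → ExtPhase) (J : Set ℝ) : Prop :=
  IsRegCurve m h γ J ∧ ∀ s ∈ J, γ s ∈ constraintSet ∧ regHam m h (γ s) = 0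

/-- Scaling `(z, η) ↦ (k z, η / k)`. -/
def scaleAct (k : ℝ) (x : ExtPhase) : ExtPhase :=
  (x.1, (fun i => (k : ℂ) * x.2.1 i, fun i => x.2.2 i / (k : ℂ)))

/-- Translation of `η` by `conj z`: `(z, η) ↦ (z, η + 2 c conj z)`. -/
def shiftAct (c : ℂ) (x : ExtPhase) : ExtPhase :=
  (x.1, (x.2.1, fun i => x.2.2 i + 2 * c * conj (x.2.1 i)))

/-- Orbits of the group generated by positive scalings and by `conj z`-translations. -/
def symmetrySetoid : Setoid ExtPhase where
  r x y := ∃ k : ℝ, 0 < k ∧ ∃ c : ℂ, y = shiftAct c (scaleAct k x)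
  iseqv :=
    { refl := fun x => ⟨1, one_pos, 0, by simp [shiftAct, scaleAct]⟩
      symm := by
        rintro x y ⟨k, hk, c, rfl⟩
        have hk' : (k : ℂ) ≠ 0 := by exact_mod_cast hk.ne'
        refine ⟨k⁻¹, inv_pos.2 hk, -(c * (k : ℂ) ^ 2), ?_⟩
        refine Prod.ext rfl (Prod.ext ?_ ?_) <;> funext i
        · simp [shiftAct, scaleAct, hk']
        · simp only [shiftAct, scaleAct, map_mul, Complex.conj_ofReal, Complex.ofReal_inv,
            map_inv₀, div_inv_eq_mul]
          field_simp
          ring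
      trans := by
        rintro x y z ⟨k, hk, c, rfl⟩ ⟨l, hl, d, rfl⟩
        have hk' : (k : ℂ) ≠ 0 := by exact_mod_cast hk.ne'
        have hl' : (l : ℂ) ≠ 0 := by exact_mod_cast hl.ne'
        refine ⟨l * k, mul_pos hl hk, d + c / (l : ℂ) ^ 2, ?_⟩
        refine Prod.ext rfl (Prod.ext ?_ ?_) <;> funext i
        · simp [shiftAct, scaleAct, mul_assoc]
        · simp only [shiftAct, scaleAct, map_mul, Complex.conj_ofReal, Complex.ofReal_mul]
          field_simp
          ring }

/-- The quotient of the collision-free part of the constraint submanifold by the symmetries. -/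
abbrev ReducedCollisionFree : Type :=
  Quotient (symmetrySetoid.comap (Subtype.val : collisionFree → ExtPhase))

/-- The positions `q` (with center of mass at the origin) of the three bodies; defined at binary
collisions as well. -/
def bodyPositions (m : Fin 3 → ℝ) (x : ExtPhase) : Vec3 :=
  absPos m (sphToRel m (leviCivita x)).1

/-- The state `(q, p)` of the three bodies (meaningful when no `z_ij` vanishes). -/
def bodyState (m : Fin 3 → ℝ) (x : ExtPhase) : Phase :=
  (bodyPositions m x, absMom (sphToRel m (leviCivita x)).2)

end ThreeBody

end

/-! Writing every relative position as a square, Q_ij proportional to z_ij², regularizes the three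
binary collisions simultaneously. A difference of two components of Y has one of the π_k as
numerator and twice a product of two conjugate z components as denominator, and the potential has
the denominators ρ_ij. The factor τ cancels all of them (`regHam_eq_sphHam`), so that only r, ‖z‖²
and |X(z)| remain, which do not vanish for r > 0 and z ≠ 0.

The variables (r, p_r, z, η) are redundant. Scalings and η-translations leave the Hamiltonian
invariant and their momentum maps are the two constraints, so Noether's theorem makes the constraint
set invariant (`fderiv_constraint_regField`). On this set Ψ is composed of the cotangent lift of
squaring, the splitting of momentum into radial and tangential parts, and the linear passage from
pairs to bodies; on tangent vectors it preserves the symplectic form (`omegaPhase_dBodyState`).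
There the regularized Hamiltonian is τ(H ∘ Ψ - h). Where this vanishes its differential is τ d(H ∘
Ψ) on tangent vectors, and nondegeneracy sends the regularized field to τ times the three-body field
(`dBodyState_regField`). Modulo symmetries, Ψ becomes (z, p) ↦ (z², p), a restriction of a
homomorphism with kernel {±1}³: hence the eight sheets (`isCoveringMap_squareHom`).

If z_ij = 0, the other two components are non-zero and τ vanishes, so on the zero level the kinetic
term equals the positive number W/r, W the regularized potential. This term is then quadratic in
η_ij, so by Euler's identity the η_ij-derivative, which is the velocity of z_ij, is not zero
(`regField_z_ne_zero`). Collisions are therefore isolated and the integral of τ is strictly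
increasing.

Conversely, all lifts of a state differ by symmetries and signs, so a local lift through one of them
serves for all, and lifts continue along the whole trajectory (`IsThreeBodyCurve.exists_lift`). At
the end of a trajectory in a binary collision two facts are needed. The momentum of the third body
stays bounded and energy controls the colliding pair, so lifts stay in a compact set modulo
symmetries (`IsThreeBodyCurve.exists_isCompact_lift`). The Lagrange-Jacobi identity makes a bounded
quantity grow at a positive rate in the parameter s, so the collision happens at a finite s. A
uniform existence time on the compact set then carries the solution across. -/

noncomputable section

namespace ThreeBody

/-! ### Uniqueness, uniform existence and continuation for autonomous equations -/

section ODE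

variable {E : Type*} [NormedAddCommGroup E] [NormedSpace ℝ E]

/-- `γ` stays in `U` and solves `γ' = F γ` at all times of `J`. -/
def IsSol (F : E → E) (U : Set E) (γ : ℝ → E) (J : Set ℝ) : Prop :=
  ∀ t ∈ J, γ t ∈ U ∧ HasDerivAt γ (F (γ t)) t

theorem IsOpenInterval.isPreconnected {J : Set ℝ} (hJ : IsOpenInterval J) : IsPreconnected J :=
  hJ.2.isPreconnected

theorem isOpenInterval_Ioo (a b : ℝ) : IsOpenInterval (Ioo a b) := ⟨isOpen_Ioo, ordConnected_Ioo⟩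

theorem IsOpenInterval.inter {J K : Set ℝ} (hJ : IsOpenInterval J) (hK : IsOpenInterval K) :
    IsOpenInterval (J ∩ K) := ⟨hJ.1.inter hK.1, hJ.2.inter hK.2⟩

theorem IsOpenInterval.union {J K : Set ℝ} (hJ : IsOpenInterval J) (hK : IsOpenInterval K) {t : ℝ}
    (htJ : t ∈ J) (htK : t ∈ K) : IsOpenInterval (J ∪ K) :=
  ⟨hJ.1.union hK.1,
    (IsPreconnected.union t htJ htK hJ.isPreconnected hK.isPreconnected).ordConnected⟩

theorem IsSol.mono {F : E → E} {U : Set E} {γ : ℝ → E} {J K : Set ℝ} (h : IsSol F U γ J)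
    (hK : K ⊆ J) : IsSol F U γ K := fun t ht => h t (hK ht)

theorem IsSol.congr {F : E → E} {U : Set E} {γ γ' : ℝ → E} {J : Set ℝ} (h : IsSol F U γ J)
    (hJ : IsOpen J) (he : EqOn γ' γ J) : IsSol F U γ' J := fun t ht => by
  have h1 := h t ht
  have h2 : γ' =ᶠ[𝓝 t] γ := he.eventuallyEq_of_mem (hJ.mem_nhds ht)
  rw [he ht]
  exact ⟨h1.1, h1.2.congr_of_eventuallyEq h2⟩

theorem IsSol.continuousOn {F : E → E} {U : Set E} {γ : ℝ → E} {J : Set ℝ} (h : IsSol F U γ J) :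
    ContinuousOn γ J := fun t ht => (h t ht).2.continuousAt.continuousWithinAt

/-- Two solutions of a `C¹` autonomous equation on an open interval that agree once are equal. -/
theorem IsSol.eqOn {F : E → E} {U : Set E} (hU : IsOpen U) (hF : ContDiffOn ℝ 1 F U) {J : Set ℝ}
    (hJ : IsOpenInterval J) {γ₁ γ₂ : ℝ → E} (h₁ : IsSol F U γ₁ J) (h₂ : IsSol F U γ₂ J) {s : ℝ}
    (hs : s ∈ J) (h : γ₁ s = γ₂ s) : EqOn γ₁ γ₂ J := by
  have key : ∀ t ∈ J, γ₁ t = γ₂ t → γ₁ =ᶠ[𝓝 t] γ₂ := by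
    intro t ht he
    obtain ⟨K, S, hS, hL⟩ :=
      (hF.contDiffAt (hU.mem_nhds (h₁ t ht).1)).exists_lipschitzOnWith
    have ev : ∀ γ : ℝ → E, IsSol F U γ J → γ t = γ₁ t →
        ∀ᶠ t' in 𝓝 t, HasDerivAt γ (F (γ t')) t' ∧ γ t' ∈ S := by
      intro γ hγ hγt
      filter_upwards [hJ.1.mem_nhds ht,
        (hγ t ht).2.continuousAt.preimage_mem_nhds (by rw [hγt]; exact hS)] with t' h1 h2
      exact ⟨(hγ t' h1).2, h2⟩
    exact ODE_solution_unique_of_eventually (v := fun _ => F) (s := fun _ => S)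
      (Eventually.of_forall fun _ => hL) (ev γ₁ h₁ rfl) (ev γ₂ h₂ he.symm) he
  -- The times at which the germs agree form an open set, closed in `J` because values that differ
  -- at a time differ nearby; `J` is preconnected.
  have hsub : J ⊆ {t | γ₁ =ᶠ[𝓝 t] γ₂} := by
    refine hJ.isPreconnected.subset_of_closure_inter_subset ?_ ⟨s, hs, key s hs h⟩ ?_
    · exact isOpen_iff_mem_nhds.2 fun t ht => ht.eventuallyEq_nhds
    · rintro t ⟨htc, ht⟩
      refine key t ht ?_
      by_contra hne
      have hev : ∀ᶠ t' in 𝓝 t, γ₁ t' ≠ γ₂ t' :=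
        ((h₁ t ht).2.continuousAt.ne_iff_eventually_ne (h₂ t ht).2.continuousAt).1 hne
      obtain ⟨t', h1, h2⟩ := mem_closure_iff_nhds.1 htc _ hev
      exact h1 h2.self_of_nhds
  exact fun t ht => (hsub ht).self_of_nhds

/-- Two functions that agree on the overlap have a common extension. -/
theorem exists_eqOn_eqOn {α β : Type*} {f g : α → β} {W B : Set α} (h : EqOn f g (W ∩ B)) :
    ∃ z, EqOn z f W ∧ EqOn z g B := by
  classical
  refine ⟨W.piecewise f g, fun t ht => by simp [ht], fun t ht => ?_⟩
  by_cases hW : t ∈ W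
  · simp [hW, h ⟨hW, ht⟩]
  · simp [hW]

/-- Solutions of a `C¹` equation starting in a compact set exist for a uniform time. -/
theorem exists_uniform_isSol [CompleteSpace E] {F : E → E} {U : Set E} (hU : IsOpen U)
    (hF : ContDiffOn ℝ 1 F U) {K : Set E} (hK : IsCompact K) (hKU : K ⊆ U) :
    ∃ ε > 0, ∀ x ∈ K, ∀ t₀ : ℝ, ∃ α : ℝ → E, α t₀ = x ∧
      IsSol F U α (Ioo (t₀ - ε) (t₀ + ε)) := by
  -- The equation is autonomous, so the initial time may be moved to 0.
  suffices H : ∃ ε > 0, ∀ x ∈ K, ∃ α : ℝ → E, α 0 = x ∧ IsSol F U α (Ioo (-ε) ε) by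
    obtain ⟨ε, hε, H⟩ := H
    refine ⟨ε, hε, fun x hx t₀ => ?_⟩
    obtain ⟨α, h0, hα⟩ := H x hx
    refine ⟨fun t => α (t - t₀), by simp [h0], fun t ht => ?_⟩
    obtain ⟨h1, h2⟩ := hα (t - t₀) ⟨by linarith [ht.1], by linarith [ht.2]⟩
    exact ⟨h1, h2.comp_sub_const t t₀⟩
  -- Having a uniform existence time passes to subsets and to unions of two sets (take the minimum),
  -- so by compactness it need only be checked near each point.
  refine hK.induction_on (p := fun K => ∃ ε > 0, ∀ x ∈ K, ∃ α : ℝ → E, α 0 = x ∧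
    IsSol F U α (Ioo (-ε) ε)) ⟨1, one_pos, by simp⟩ ?_ ?_ ?_
  · rintro s t hst ⟨ε, hε, h⟩
    exact ⟨ε, hε, fun x hx => h x (hst hx)⟩
  · rintro s t ⟨ε, hε, h⟩ ⟨δ, hδ, h'⟩
    refine ⟨min ε δ, lt_min hε hδ, ?_⟩
    rintro x (hx | hx)
    · obtain ⟨α, h0, hα⟩ := h x hx
      exact ⟨α, h0, hα.mono (Ioo_subset_Ioo (neg_le_neg (min_le_left _ _)) (min_le_left _ _))⟩
    · obtain ⟨α, h0, hα⟩ := h' x hx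
      exact ⟨α, h0, hα.mono (Ioo_subset_Ioo (neg_le_neg (min_le_right _ _)) (min_le_right _ _))⟩
  · intro x hx
    obtain ⟨ε, hε, a, r, L, K', hr, hPL⟩ :=
      IsPicardLindelof.of_contDiffAt_one (hF.contDiffAt (hU.mem_nhds (hKU hx)))
    obtain ⟨α, h1, h2⟩ :=
      (hPL 0).exists_forall_mem_closedBall_eq_hasDerivWithinAt_continuousOn
    have hnhd : Metric.closedBall x (r : ℝ) ×ˢ Icc (0 - ε) (0 + ε) ∈ 𝓝 ((x, (0 : ℝ)) : E × ℝ) :=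
      prod_mem_nhds (Metric.closedBall_mem_nhds x hr) (Icc_mem_nhds (by linarith) (by linarith))
    have hα0 : α (x, 0) = x := (h1 x (Metric.mem_closedBall_self hr.le)).1
    -- Joint continuity of the local flow in point and time keeps all nearby solutions in `U` for a
    -- common time.
    have hpre : ∀ᶠ y in 𝓝 ((x, (0 : ℝ)) : E × ℝ), α y ∈ U :=
      (h2.continuousAt hnhd).preimage_mem_nhds (by rw [hα0]; exact hU.mem_nhds (hKU hx))
    obtain ⟨S, hS, T, hT, hST⟩ := mem_nhds_prod_iff.1 (inter_mem hpre hnhd)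
    obtain ⟨δ, hδ, hδT⟩ := Metric.mem_nhds_iff.1 hT
    refine ⟨S, mem_nhdsWithin_of_mem_nhds hS, min δ ε, lt_min hδ hε, fun y hy => ?_⟩
    have hy' : y ∈ Metric.closedBall x (r : ℝ) :=
      (hST (mk_mem_prod hy (mem_of_mem_nhds hT))).2.1
    refine ⟨fun t => α (y, t), (h1 y hy').1, fun t ht => ?_⟩
    have htδ : |t| < min δ ε := abs_lt.2 ht
    have htT : t ∈ T := hδT (by simpa using htδ.trans_le (min_le_left _ _))
    have hte : |t| < ε := htδ.trans_le (min_le_right _ _)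
    rw [abs_lt] at hte
    refine ⟨(hST (mk_mem_prod hy htT)).1, ?_⟩
    exact ((h1 y hy').2 t ⟨by linarith, by linarith⟩).hasDerivAt
      (Icc_mem_nhds (by linarith) (by linarith))

/-- If, near every time of an interval, solutions inside the moving set `A` through all of its
points exist for a uniform time, then they exist on the whole interval. -/
theorem exists_isSol_of_uniform_local {F : E → E} {U : Set E} (hU : IsOpen U)
    (hF : ContDiffOn ℝ 1 F U) {I : Set ℝ} (hI : IsOpenInterval I) (A : ℝ → Set E)
    (hA : ∀ t, A t ⊆ U)
    (loc : ∀ t₁ ∈ I, ∃ B, IsOpenInterval B ∧ t₁ ∈ B ∧ B ⊆ I ∧ ∀ t₂ ∈ B, ∀ y ∈ A t₂, ∃ x : ℝ → E,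
      x t₂ = y ∧ ∀ t ∈ B, x t ∈ A t ∧ HasDerivAt x (F (x t)) t)
    {t₀ : ℝ} (ht₀ : t₀ ∈ I) {x₀ : E} (hx₀ : x₀ ∈ A t₀) :
    ∃ x : ℝ → E, x t₀ = x₀ ∧ ∀ t ∈ I, x t ∈ A t ∧ HasDerivAt x (F (x t)) t := by
  -- Partial solutions through `x₀`. The times they reach are shown to be open and closed in `I`.
  let S : Set ℝ → (ℝ → E) → Prop := fun W x => IsOpenInterval W ∧ W ⊆ I ∧ t₀ ∈ W ∧ x t₀ = x₀ ∧
    ∀ t ∈ W, x t ∈ A t ∧ HasDerivAt x (F (x t)) t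
  have hsol : ∀ {W x}, (∀ t ∈ W, x t ∈ A t ∧ HasDerivAt x (F (x t)) t) → IsSol F U x W :=
    fun h t ht => ⟨hA t (h t ht).1, (h t ht).2⟩
  have hall : I ⊆ {t | ∃ W x, S W x ∧ t ∈ W} := by
    refine hI.isPreconnected.subset_of_closure_inter_subset ?_ ?_ ?_
    · refine isOpen_iff_mem_nhds.2 ?_
      rintro t ⟨W, x, hS, ht⟩
      exact mem_of_superset (hS.1.1.mem_nhds ht) fun t' ht' => ⟨W, x, hS, ht'⟩
    · obtain ⟨B, hB, htB, hBI, h⟩ := loc t₀ ht₀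
      obtain ⟨x, hx, hx'⟩ := h t₀ htB x₀ hx₀
      exact ⟨t₀, ht₀, B, x, ⟨hB, hBI, htB, hx, hx'⟩, htB⟩
    · rintro t₁ ⟨htc, ht₁⟩
      -- The interval `B` does not depend on the starting point: a partial solution that reaches
      -- some `t₂` in `B` can be restarted there and continued past `t₁`.
      obtain ⟨B, hB, htB, hBI, h⟩ := loc t₁ ht₁
      obtain ⟨t₂, ht₂B, W, x, ⟨hW, hWI, h0W, hx0, hx⟩, ht₂W⟩ :=
        mem_closure_iff_nhds.1 htc _ (hB.1.mem_nhds htB)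
      obtain ⟨x', hx'₂, hx'⟩ := h t₂ ht₂B (x t₂) (hx t₂ ht₂W).1
      have hov : EqOn x x' (W ∩ B) :=
        IsSol.eqOn hU hF (hW.inter hB) ((hsol hx).mono inter_subset_left)
          ((hsol hx').mono inter_subset_right) ⟨ht₂W, ht₂B⟩ hx'₂.symm
      obtain ⟨z, hz1, hz2⟩ := exists_eqOn_eqOn hov
      refine ⟨W ∪ B, z, ⟨hW.union hB ht₂W ht₂B, union_subset hWI hBI, Or.inl h0W,
        (hz1 h0W).trans hx0, ?_⟩, Or.inr htB⟩
      rintro t (ht | ht)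
      · exact ⟨hz1 ht ▸ (hx t ht).1, ((hsol hx).congr hW.1 hz1 t ht).2⟩
      · exact ⟨hz2 ht ▸ (hx' t ht).1, ((hsol hx').congr hB.1 hz2 t ht).2⟩
  replace hall : ∀ t ∈ I, ∃ W x, S W x ∧ t ∈ W := fun t ht => hall ht
  choose! W x hS hmem using hall
  -- By uniqueness the chosen partial solutions agree on overlaps, so their diagonal is locally one
  -- of them.
  have hloc : ∀ t ∈ I, EqOn (fun t' => x t' t') (x t) (W t) := by
    intro t ht t' ht'
    have ht'I := (hS t ht).2.1 ht'
    exact IsSol.eqOn hU hF ((hS t' ht'I).1.inter (hS t ht).1)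
      ((hsol (hS t' ht'I).2.2.2.2).mono inter_subset_left)
      ((hsol (hS t ht).2.2.2.2).mono inter_subset_right) ⟨(hS t' ht'I).2.2.1, (hS t ht).2.2.1⟩
      ((hS t' ht'I).2.2.2.1.trans (hS t ht).2.2.2.1.symm) ⟨hmem t' ht'I, ht'⟩
  refine ⟨fun t => x t t, (hS t₀ ht₀).2.2.2.1, fun t ht => ⟨((hS t ht).2.2.2.2 t (hmem t ht)).1, ?_⟩⟩
  exact ((hsol (hS t ht).2.2.2.2).congr (hS t ht).1.1 (hloc t ht) t (hmem t ht)).2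

end ODE

/-! ### Time changes and their inverses -/

section TimeChange

/-- A strictly increasing differentiable function on an open interval has an inverse on its image,
which is an open interval. -/
theorem exists_inverse_of_strictMonoOn {θ θ' : ℝ → ℝ} {J : Set ℝ} (hJ : IsOpenInterval J)
    (hθ : ∀ s ∈ J, HasDerivAt θ (θ' s) s) (hm : StrictMonoOn θ J) :
    IsOpenInterval (θ '' J) ∧ ∃ φ : ℝ → ℝ, (∀ s ∈ J, φ (θ s) = s) ∧ ContinuousOn φ (θ '' J) ∧
      ∀ s ∈ J, θ' s ≠ 0 → HasDerivAt φ (θ' s)⁻¹ (θ s) := by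
  have hc : ContinuousOn θ J := fun s hs => (hθ s hs).continuousAt.continuousWithinAt
  have hopen : IsOpen (θ '' J) := by
    refine isOpen_iff_mem_nhds.2 ?_
    rintro _ ⟨s, hs, rfl⟩
    obtain ⟨δ, hδ, hball⟩ := Metric.isOpen_iff.1 hJ.1 s hs
    have h1 : s - δ / 2 ∈ J := hball (by simp [abs_of_pos hδ, hδ])
    have h2 : s + δ / 2 ∈ J := hball (by simp [abs_of_pos hδ, hδ])
    have hsub : Icc (s - δ / 2) (s + δ / 2) ⊆ J := hJ.2.out h1 h2
    refine mem_of_superset (Icc_mem_nhds (hm h1 hs (by linarith)) (hm hs h2 (by linarith))) ?_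
    exact (intermediate_value_Icc (by linarith) (hc.mono hsub)).trans (image_mono hsub)
  have hint : IsOpenInterval (θ '' J) := ⟨hopen, (hJ.isPreconnected.image θ hc).ordConnected⟩
  have hinv : ∀ s ∈ J, Function.invFunOn θ J (θ s) = s := fun s hs =>
    hm.injOn.leftInvOn_invFunOn hs
  have himg : Function.invFunOn θ J '' (θ '' J) = J := by
    rw [image_image]
    exact (image_congr hinv).trans (image_id J)
  -- The derivative of the time change vanishes at collisions, so continuity of the inverse has to
  -- come from monotonicity alone.
  have hcont : ∀ s ∈ J, ContinuousAt (Function.invFunOn θ J) (θ s) := by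
    intro s hs
    refine StrictMonoOn.continuousAt_of_image_mem_nhds (s := θ '' J) ?_
      (hopen.mem_nhds (mem_image_of_mem _ hs)) ?_
    · rintro _ ⟨a, ha, rfl⟩ _ ⟨b, hb, rfl⟩ hab
      rw [hinv a ha, hinv b hb]
      exact (hm.lt_iff_lt ha hb).1 hab
    · rw [himg, hinv s hs]
      exact hJ.1.mem_nhds hs
  refine ⟨hint, Function.invFunOn θ J, hinv, ?_, fun s hs h0 => ?_⟩
  · rintro _ ⟨s, hs, rfl⟩
    exact (hcont s hs).continuousWithinAt
  · refine HasDerivAt.of_local_left_inverse (f := θ) (hcont s hs) ?_ h0 ?_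
    · rw [hinv s hs]
      exact hθ s hs
    · filter_upwards [hopen.mem_nhds (mem_image_of_mem θ hs)]
      rintro _ ⟨a, ha, rfl⟩
      rw [hinv a ha]

theorem exists_primitive {f : ℝ → ℝ} {J : Set ℝ} (hJ : IsOpenInterval J) (hf : ContinuousOn f J)
    {s₀ : ℝ} (hs₀ : s₀ ∈ J) (t₀ : ℝ) :
    ∃ θ : ℝ → ℝ, θ s₀ = t₀ ∧ ∀ s ∈ J, HasDerivAt θ (f s) s := by
  refine ⟨fun s => t₀ + ∫ u in s₀..s, f u, by simp, fun s hs => ?_⟩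
  have hsub : uIcc s₀ s ⊆ J := hJ.2.uIcc_subset hs₀ hs
  refine HasDerivAt.const_add _ (intervalIntegral.integral_hasDerivAt_right
    (hf.mono hsub).intervalIntegrable ?_ (hf.continuousAt (hJ.1.mem_nhds hs)))
  exact ContinuousOn.stronglyMeasurableAtFilter hJ.1 hf s hs

theorem eq_of_hasDerivAt_zero {F : Type*} [NormedAddCommGroup F] [NormedSpace ℝ F] {f : ℝ → F}
    {J : Set ℝ} (hJ : IsOpenInterval J) (hf : ∀ s ∈ J, HasDerivAt f 0 s) {s t : ℝ} (hs : s ∈ J)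
    (ht : t ∈ J) : f s = f t :=
  hJ.1.is_const_of_deriv_eq_zero hJ.isPreconnected
    (fun u hu => (hf u hu).differentiableAt.differentiableWithinAt)
    (fun u hu => (hf u hu).deriv) hs ht

end TimeChange

/-! ### Hamilton's equations as differential equations -/

section Hamiltonian

variable {E : Type*} [NormedAddCommGroup E] [NormedSpace ℝ E]

/-- Nondegeneracy of Ω, given as a linear inverse `S` of v ↦ Ω(v, ·), turns the implicit equation
for the velocity into an explicit one. -/
theorem isHamiltonianCurve_iff_isSol {Ω : E → E → ℝ} {S : (E →L[ℝ] ℝ) →L[ℝ] E}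
    (hS : ∀ v L, (∀ w, Ω v w = L w) ↔ v = S L) {H : E → ℝ} {U : Set E} {γ : ℝ → E} {J : Set ℝ} :
    IsHamiltonianCurve Ω H U γ J ↔ IsSol (fun x => S (fderiv ℝ H x)) U γ J := by
  refine forall₂_congr fun t _ => and_congr_right fun _ => ?_
  constructor
  · rintro ⟨v, hv, h⟩
    rw [(hS _ _).1 h] at hv
    exact hv
  · exact fun h => ⟨_, h, (hS _ _).2 rfl⟩

theorem contDiffOn_hamiltonianField (S : (E →L[ℝ] ℝ) →L[ℝ] E) {H : E → ℝ} {U : Set E}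
    (hU : IsOpen U) (hH : ContDiffOn ℝ ∞ H U) :
    ContDiffOn ℝ 1 (fun x => S (fderiv ℝ H x)) U :=
  S.contDiff.comp_contDiffOn (hH.fderiv_of_isOpen hU (by norm_cast))

/-- A linear symplectic symmetry of the Hamiltonian maps Hamiltonian curves to such curves. -/
theorem IsHamiltonianCurve.map {Ω : E → E → ℝ} {H : E → ℝ} {U : Set E} (hU : IsOpen U)
    (hH : ContDiffOn ℝ ∞ H U) (g : E ≃L[ℝ] E) (hg : ∀ v w, Ω (g v) (g w) = Ω v w)
    (hgU : ∀ x ∈ U, g x ∈ U) (hgH : ∀ x ∈ U, H (g x) = H x) {γ : ℝ → E} {J : Set ℝ}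
    (h : IsHamiltonianCurve Ω H U γ J) : IsHamiltonianCurve Ω H U (fun t => g (γ t)) J := by
  intro t ht
  obtain ⟨hU', v, hv, hvw⟩ := h t ht
  refine ⟨hgU _ hU', g v, g.hasFDerivAt.comp_hasDerivAt t hv, fun w => ?_⟩
  have hd : HasFDerivAt H (fderiv ℝ H (g (γ t))) (g (γ t)) :=
    ((hH.contDiffAt (hU.mem_nhds (hgU _ hU'))).differentiableAt (by simp)).hasFDerivAt
  have hd' : HasFDerivAt H (fderiv ℝ H (γ t)) (γ t) :=
    ((hH.contDiffAt (hU.mem_nhds hU')).differentiableAt (by simp)).hasFDerivAt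
  have hcomp : HasFDerivAt H ((fderiv ℝ H (g (γ t))).comp (g : E →L[ℝ] E)) (γ t) :=
    (hd.comp (γ t) g.hasFDerivAt).congr_of_eventuallyEq <| by
      filter_upwards [hU.mem_nhds hU'] with x hx using (hgH x hx).symm
  have := hvw (g.symm w)
  rw [hd'.unique hcomp] at this
  rw [← g.apply_symm_apply w, hg]
  simpa using this

end Hamiltonian

/-! ### Nondegeneracy of the canonical forms -/

section Symplectic

theorem pairing_re_comm (v w : Vec3) : (pairing v w).re = (pairing w v).re := by
  simp [pairing, Fin.sum_univ_three]
  ring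

/-- The vector representing a real linear form on `ℂ³` by the real part of the pairing. -/
def vecDual : (Vec3 →L[ℝ] ℝ) →L[ℝ] Vec3 :=
  ContinuousLinearMap.pi fun i =>
    (ContinuousLinearMap.apply ℝ ℝ (Pi.single i 1 : Vec3)).smulRight (1 : ℂ)
      + (ContinuousLinearMap.apply ℝ ℝ (Pi.single i Complex.I : Vec3)).smulRight Complex.I

/-- The unit vectors and their multiples by i form a real basis of ℂ³; pairing with them reads off
the real and imaginary parts of `v`. -/
theorem pairing_re_eq_iff (v : Vec3) (L : Vec3 →L[ℝ] ℝ) :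
    (∀ w, (pairing v w).re = L w) ↔ v = vecDual L := by
  constructor
  · intro h
    funext i
    have h1 := h (Pi.single i 1)
    have h2 := h (Pi.single i Complex.I)
    refine Complex.ext ?_ ?_
    · rw [show (vecDual L i).re = L (Pi.single i 1) by simp [vecDual], ← h1]
      simp [pairing, Pi.single_apply]
    · rw [show (vecDual L i).im = L (Pi.single i Complex.I) by simp [vecDual], ← h2]
      simp [pairing, Pi.single_apply]
  · rintro rfl w
    have hw : w = ∑ i, ((w i).re • (Pi.single i 1 : Vec3)
        + (w i).im • (Pi.single i Complex.I : Vec3)) := by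
      funext j
      fin_cases j <;> simp [Fin.sum_univ_three, Complex.re_add_im]
    conv_rhs => rw [hw]
    simp [pairing, vecDual, Fin.sum_univ_three]
    ring

/-- The Hamiltonian vector of a linear form for the canonical form of `T*ℂ³`. -/
def sharpPhase : (Phase →L[ℝ] ℝ) →L[ℝ] Phase :=
  (vecDual ∘L (ContinuousLinearMap.compL ℝ Vec3 Phase ℝ).flip (.inr ℝ Vec3 Vec3)).prod
    (-(vecDual ∘L (ContinuousLinearMap.compL ℝ Vec3 Phase ℝ).flip (.inl ℝ Vec3 Vec3)))

theorem omegaPhase_eq_iff (v : Phase) (L : Phase →L[ℝ] ℝ) :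
    (∀ w, omegaPhase v w = L w) ↔ v = sharpPhase L := by
  have h1 := pairing_re_eq_iff v.1 (L ∘L .inr ℝ Vec3 Vec3)
  have h2 := pairing_re_eq_iff (-v.2) (L ∘L .inl ℝ Vec3 Vec3)
  have hneg : ∀ a b : Vec3, (pairing (-a) b).re = -(pairing a b).re := fun a b => by
    simp [pairing, Fin.sum_univ_three]
  have hz : ∀ a : Vec3, (pairing a 0).re = 0 := fun a => by simp [pairing]
  rw [Prod.ext_iff, show (sharpPhase L).1 = vecDual (L ∘L .inr ℝ Vec3 Vec3) from rfl,
    show (sharpPhase L).2 = -vecDual (L ∘L .inl ℝ Vec3 Vec3) from rfl, ← neg_eq_iff_eq_neg,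
    ← h1, ← h2]
  constructor
  · intro h
    refine ⟨fun w => ?_, fun w => ?_⟩
    · have := h (0, w)
      simpa [omegaPhase, hz, pairing_re_comm w] using this
    · have := h (w, 0)
      rw [hneg]
      simpa [omegaPhase, hz, pairing_re_comm 0 v.1] using this
  · rintro ⟨h1, h2⟩ w
    have e : L w = L (w.1, 0) + L (0, w.2) := by rw [← map_add]; simp
    rw [e, ← ContinuousLinearMap.inl_apply (R := ℝ), ← ContinuousLinearMap.inr_apply (R := ℝ)]
    have h1' := h1 w.2
    have h2' := h2 w.1
    simp only [ContinuousLinearMap.comp_apply] at h1' h2'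
    rw [← h1', ← h2', hneg, omegaPhase, pairing_re_comm w.2]
    ring

/-- The Hamiltonian vector of a linear form for the canonical form of `T*ℝ⁺ × T*ℂ³`. -/
def sharpExt : (ExtPhase →L[ℝ] ℝ) →L[ℝ] ExtPhase :=
  ((ContinuousLinearMap.apply ℝ ℝ (((0, 1), 0) : ExtPhase)).prod
    (-(ContinuousLinearMap.apply ℝ ℝ (((1, 0), 0) : ExtPhase)))).prod
    (sharpPhase ∘L (ContinuousLinearMap.compL ℝ Phase ExtPhase ℝ).flip (.inr ℝ (ℝ × ℝ) Phase))

theorem omegaExt_eq_iff (v : ExtPhase) (L : ExtPhase →L[ℝ] ℝ) :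
    (∀ w, omegaExt v w = L w) ↔ v = sharpExt L := by
  have h1 := omegaPhase_eq_iff v.2 (L ∘L .inr ℝ (ℝ × ℝ) Phase)
  have hz : ∀ a : Phase, omegaPhase a 0 = 0 := fun a => by simp [omegaPhase, pairing]
  rw [Prod.ext_iff, Prod.ext_iff,
    show (sharpExt L).2 = sharpPhase (L ∘L .inr ℝ (ℝ × ℝ) Phase) from rfl,
    show (sharpExt L).1.1 = L ((0, 1), 0) from rfl,
    show (sharpExt L).1.2 = -L ((1, 0), 0) from rfl, ← h1]
  constructor
  · intro h
    refine ⟨⟨?_, ?_⟩, fun w => ?_⟩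
    · simpa [omegaExt, hz] using h ((0, 1), 0)
    · rw [← h ((1, 0), 0)]
      simp [omegaExt, hz]
    · simpa [omegaExt] using h (0, w)
  · rintro ⟨⟨h1, h2⟩, h3⟩ w
    have e : L w = w.1.1 * L ((1, 0), 0) + w.1.2 * L ((0, 1), 0) + L (0, w.2) := by
      rw [← smul_eq_mul, ← smul_eq_mul, ← map_smul, ← map_smul, ← map_add, ← map_add]
      congr 1
      simp
    have h3' := h3 w.2
    simp only [ContinuousLinearMap.comp_apply, ContinuousLinearMap.inr_apply] at h3'
    rw [e, ← h3', ← h1, ← neg_eq_iff_eq_neg.2 h2, omegaExt]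
    ring

end Symplectic

/-! ### Scalings, η-translations and sign changes as one linear action -/

section Gauge

/-- The action `(z, η) ↦ (a z, η / a + 2 c conj (a z))`. -/
def gaugeAct (a : Fin 3 → ℝ) (c : ℂ) (x : ExtPhase) : ExtPhase :=
  (x.1, (fun i => (a i : ℂ) * x.2.1 i,
    fun i => x.2.2 i / (a i : ℂ) + 2 * c * conj ((a i : ℂ) * x.2.1 i)))

theorem scaleAct_eq_gaugeAct (k : ℝ) : scaleAct k = gaugeAct (fun _ => k) 0 := by
  funext x
  simp [scaleAct, gaugeAct]

theorem shiftAct_eq_gaugeAct (c : ℂ) : shiftAct c = gaugeAct 1 c := by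
  funext x
  simp [shiftAct, gaugeAct]

theorem shiftAct_scaleAct (k : ℝ) (c : ℂ) (x : ExtPhase) :
    shiftAct c (scaleAct k x) = gaugeAct (fun _ => k) c x := by
  simp [shiftAct, scaleAct, gaugeAct]

/-- `gaugeAct` as a continuous linear equivalence. -/
def gaugeEquiv (a : Fin 3 → ℝ) (ha : ∀ i, a i ≠ 0) (c : ℂ) : ExtPhase ≃L[ℝ] ExtPhase :=
  LinearEquiv.toContinuousLinearEquiv
    { toFun := gaugeAct a c
      map_add' := fun x y => by
        refine Prod.ext rfl (Prod.ext ?_ ?_) <;> funext i <;> simp [gaugeAct] <;> ring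
      map_smul' := fun t x => by
        refine Prod.ext rfl (Prod.ext ?_ ?_) <;> funext i <;> simp [gaugeAct] <;> ring
      invFun := fun x => (x.1, (fun i => x.2.1 i / (a i : ℂ),
        fun i => (a i : ℂ) * (x.2.2 i - 2 * c * conj (x.2.1 i))))
      left_inv := fun x => by
        have h : ∀ i, (a i : ℂ) ≠ 0 := fun i => by exact_mod_cast ha i
        refine Prod.ext rfl (Prod.ext ?_ ?_) <;> funext i <;> have := h i
        · simp [gaugeAct]
          field_simp
        · simp [gaugeAct]
          field_simp
      right_inv := fun x => by
        have h : ∀ i, (a i : ℂ) ≠ 0 := fun i => by exact_mod_cast ha i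
        refine Prod.ext rfl (Prod.ext ?_ ?_) <;> funext i <;> have := h i
        · simp [gaugeAct]
          field_simp
        · simp [gaugeAct]
          field_simp
          ring }

theorem gaugeEquiv_apply (a : Fin 3 → ℝ) (ha : ∀ i, a i ≠ 0) (c : ℂ) (x : ExtPhase) :
    gaugeEquiv a ha c x = gaugeAct a c x := rfl

/-- The multiplications by `a` and its inverse are dual to each other, and the shift adds to the
pairing a bilinear term symmetric in the two vectors, which the antisymmetric form does not see. -/
theorem omegaExt_gaugeAct {a : Fin 3 → ℝ} (ha : ∀ i, a i ≠ 0) (c : ℂ) (v w : ExtPhase) :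
    omegaExt (gaugeAct a c v) (gaugeAct a c w) = omegaExt v w := by
  have h : ∀ i, (a i : ℂ) ≠ 0 := fun i => by exact_mod_cast ha i
  have key : ∀ v w : ExtPhase, pairing (gaugeAct a c w).2.2 (gaugeAct a c v).2.1
      = pairing w.2.2 v.2.1 + ∑ i, 2 * conj c * (a i : ℂ) ^ 2 * w.2.1 i * v.2.1 i := by
    intro v w
    rw [pairing, pairing, ← Finset.sum_add_distrib]
    refine Finset.sum_congr rfl fun i _ => ?_
    have := h i
    have h2 : conj (2 : ℂ) = 2 := map_ofNat _ 2
    simp [gaugeAct, h2]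
    field_simp
  have hs : ∑ i, 2 * conj c * (a i : ℂ) ^ 2 * w.2.1 i * v.2.1 i
      = ∑ i, 2 * conj c * (a i : ℂ) ^ 2 * v.2.1 i * w.2.1 i :=
    Finset.sum_congr rfl fun i _ => by ring
  simp only [omegaExt, omegaPhase, key, hs, Complex.add_re]
  simp only [gaugeAct]
  ring

end Gauge

/-! ### Positivity of masses, norms and τ -/

section Basic

theorem totalMass_pos {m : Fin 3 → ℝ} (hm : ∀ i, 0 < m i) : 0 < totalMass m :=
  Finset.sum_pos (fun i _ => hm i) Finset.univ_nonempty

theorem pairMass_pos {m : Fin 3 → ℝ} (hm : ∀ i, 0 < m i) (i : Fin 3) : 0 < pairMass m i := by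
  fin_cases i
  · exact mul_pos (hm 0) (hm 1)
  · exact mul_pos (hm 2) (hm 0)
  · exact mul_pos (hm 1) (hm 2)

theorem massForm_pos {m : Fin 3 → ℝ} (hm : ∀ i, 0 < m i) {X : Vec3} (hX : X ≠ 0) :
    0 < (∑ i, pairMass m i * ‖X i‖ ^ 2) / totalMass m := by
  obtain ⟨i, hi⟩ := Function.ne_iff.1 hX
  refine div_pos (Finset.sum_pos' (fun j _ => ?_) ⟨i, Finset.mem_univ i, ?_⟩) (totalMass_pos hm)
  · exact mul_nonneg (pairMass_pos hm j).le (sq_nonneg _)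
  · have : 0 < ‖X i‖ := norm_pos_iff.2 hi
    have := pairMass_pos hm i
    positivity

theorem massNorm_pos {m : Fin 3 → ℝ} (hm : ∀ i, 0 < m i) {X : Vec3} (hX : X ≠ 0) :
    0 < massNorm m X := Real.sqrt_pos.2 (massForm_pos hm hX)

theorem massNorm_sq {m : Fin 3 → ℝ} (hm : ∀ i, 0 < m i) (X : Vec3) :
    massNorm m X ^ 2 = (∑ i, pairMass m i * ‖X i‖ ^ 2) / totalMass m := by
  refine Real.sq_sqrt (div_nonneg (Finset.sum_nonneg fun j _ => ?_) (totalMass_pos hm).le)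
  exact mul_nonneg (pairMass_pos hm j).le (sq_nonneg _)

theorem sq_ne_zero_vec {z : Vec3} (hz : z ≠ 0) : (fun i => z i ^ 2) ≠ 0 := by
  obtain ⟨i, hi⟩ := Function.ne_iff.1 hz
  exact Function.ne_iff.2 ⟨i, pow_ne_zero 2 hi⟩

theorem massNormZ_pos {m : Fin 3 → ℝ} (hm : ∀ i, 0 < m i) {z : Vec3} (hz : z ≠ 0) :
    0 < massNormZ m z := massNorm_pos hm (sq_ne_zero_vec hz)

theorem rho_nonneg (z : Vec3) (i : Fin 3) : 0 ≤ rho z i := sq_nonneg _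

theorem rho_pos {z : Vec3} {i : Fin 3} (hz : z i ≠ 0) : 0 < rho z i :=
  pow_pos (norm_pos_iff.2 hz) 2

theorem normSqZ_pos {z : Vec3} (hz : z ≠ 0) : 0 < normSqZ z := by
  obtain ⟨i, hi⟩ := Function.ne_iff.1 hz
  exact Finset.sum_pos' (fun j _ => rho_nonneg z j) ⟨i, Finset.mem_univ i, rho_pos hi⟩

theorem tau_nonneg (z : Vec3) : 0 ≤ tau z := by
  have := rho_nonneg z
  have h : 0 ≤ normSqZ z := Finset.sum_nonneg fun j _ => rho_nonneg z j
  unfold tau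
  have h0 := this 0; have h1 := this 1; have h2 := this 2
  positivity

theorem tau_pos {z : Vec3} (hz : ∀ i, z i ≠ 0) : 0 < tau z := by
  have h := normSqZ_pos (z := z) (Function.ne_iff.2 ⟨0, hz 0⟩)
  have h0 := rho_pos (hz 0); have h1 := rho_pos (hz 1); have h2 := rho_pos (hz 2)
  unfold tau
  positivity

theorem isOpen_extDomain : IsOpen extDomain := by
  refine (isOpen_lt continuous_const (continuous_fst.comp continuous_fst)).inter ?_
  exact isOpen_ne_fun (by fun_prop) continuous_const

end Basic

/-! ### Smoothness of the regularized Hamiltonian and cancellation of its poles -/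

section Smooth

theorem contDiff_fst_r : ContDiff ℝ ∞ fun x : ExtPhase => x.1.1 := by fun_prop

theorem contDiff_z (i : Fin 3) : ContDiff ℝ ∞ fun x : ExtPhase => x.2.1 i := by fun_prop

theorem contDiff_eta (i : Fin 3) : ContDiff ℝ ∞ fun x : ExtPhase => x.2.2 i := by fun_prop

theorem contDiff_conj_z (i : Fin 3) : ContDiff ℝ ∞ fun x : ExtPhase => conj (x.2.1 i) :=
  Complex.conjCLE.contDiff.comp (contDiff_z i)

theorem contDiff_rho (i : Fin 3) : ContDiff ℝ ∞ fun x : ExtPhase => rho x.2.1 i :=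
  (contDiff_z i).norm_sq ℝ

theorem contDiff_normSqZ : ContDiff ℝ ∞ fun x : ExtPhase => normSqZ x.2.1 :=
  ContDiff.sum fun i _ => contDiff_rho i

theorem contDiffOn_massNorm {m : Fin 3 → ℝ} (hm : ∀ i, 0 < m i) :
    ContDiffOn ℝ ∞ (massNorm m) {X | X ≠ 0} := by
  refine ContDiffOn.sqrt (ContDiff.contDiffOn ?_) fun X hX => (massForm_pos hm hX).ne'
  refine ContDiff.div_const (ContDiff.sum fun i _ => contDiff_const.mul ?_) _
  exact ContDiff.norm_sq ℝ (contDiff_apply ℝ ℂ i)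

theorem contDiffOn_massNormZ {m : Fin 3 → ℝ} (hm : ∀ i, 0 < m i) :
    ContDiffOn ℝ ∞ (fun x : ExtPhase => massNormZ m x.2.1) extDomain := by
  refine (contDiffOn_massNorm hm).comp (t := {X | X ≠ 0})
    (f := fun x : ExtPhase => fun i => x.2.1 i ^ 2) (ContDiff.contDiffOn ?_)
    fun x hx => sq_ne_zero_vec hx.2
  exact contDiff_pi.2 fun i => (contDiff_z i).pow 2

theorem contDiffOn_tau : ContDiffOn ℝ ∞ (fun x : ExtPhase => tau x.2.1) extDomain :=
  (((contDiff_rho 0).mul (contDiff_rho 1)).mul (contDiff_rho 2)).contDiffOn.div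
    (contDiff_normSqZ.pow 3).contDiffOn fun _ hx => (pow_pos (normSqZ_pos hx.2) 3).ne'

theorem contDiff_piVec_sq (i : Fin 3) :
    ContDiff ℝ ∞ fun x : ExtPhase => ‖piVec x.2.1 x.2.2 i‖ ^ 2 := by
  refine ContDiff.norm_sq ℝ ?_
  fin_cases i
  · exact ((contDiff_eta 0).mul (contDiff_conj_z 1)).sub ((contDiff_eta 1).mul (contDiff_conj_z 0))
  · exact ((contDiff_eta 2).mul (contDiff_conj_z 0)).sub ((contDiff_eta 0).mul (contDiff_conj_z 2))
  · exact ((contDiff_eta 1).mul (contDiff_conj_z 2)).sub ((contDiff_eta 2).mul (contDiff_conj_z 1))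

theorem contDiffOn_regPotential {m : Fin 3 → ℝ} (hm : ∀ i, 0 < m i) :
    ContDiffOn ℝ ∞ (fun x : ExtPhase => regPotential m x.2.1) extDomain := by
  refine ((contDiffOn_massNormZ hm).div (contDiff_normSqZ.pow 3).contDiffOn fun _ hx =>
    (pow_pos (normSqZ_pos hx.2) 3).ne').mul (ContDiff.contDiffOn ?_)
  have h := contDiff_rho
  exact (((contDiff_const.mul (h 1)).mul (h 2)).add ((contDiff_const.mul (h 0)).mul (h 2))).add
    ((contDiff_const.mul (h 0)).mul (h 1))

/-- The only denominators are powers of r and ‖z‖², and the square root in |X(z)| is taken of a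
positive quantity; vanishing of a single component of z causes no singularity. -/
theorem contDiffOn_regHam {m : Fin 3 → ℝ} (hm : ∀ i, 0 < m i) (h : ℝ) :
    ContDiffOn ℝ ∞ (regHam m h) extDomain := by
  have hp : ContDiff ℝ ∞ fun x : ExtPhase => x.1.2 := by fun_prop
  have hr := contDiff_fst_r
  refine ((((contDiffOn_tau.mul (hp.pow 2).contDiffOn).div_const 2).add (ContDiffOn.mul ?_ ?_)).sub
    ((contDiffOn_regPotential hm).div hr.contDiffOn fun x hx => hx.1.ne')).sub
    (contDiffOn_const.mul contDiffOn_tau)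
  · exact ((contDiffOn_massNormZ hm).pow 2).div
      ((hr.pow 2).mul (contDiff_normSqZ.pow 3)).contDiffOn fun x hx =>
        (mul_pos (pow_pos hx.1 2) (pow_pos (normSqZ_pos hx.2) 3)).ne'
  · have hpi := contDiff_piVec_sq
    have hrho := contDiff_rho
    exact (((((hpi 0).mul (hrho 2)).div_const _).add (((hpi 1).mul (hrho 1)).div_const _)).add
      (((hpi 2).mul (hrho 0)).div_const _)).contDiffOn

/-- The squared difference of two components of Y is |π_k|² over four times the product of their
ρ's; multiplication by τ leaves the third ρ in the numerator. In the potential, τ/ρ_ij leaves the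
product of the other two. -/
theorem regHam_eq_sphHam {m : Fin 3 → ℝ} (hm : ∀ i, 0 < m i) (h : ℝ) {x : ExtPhase}
    (hx : x ∈ extDomain) (hz : ∀ i, x.2.1 i ≠ 0) :
    regHam m h x = tau x.2.1 * (sphHam m (leviCivita x) - h) := by
  have hn := normSqZ_pos hx.2
  have hM := massNormZ_pos hm hx.2
  have hr := hx.1
  have hρ : ∀ i, 0 < rho x.2.1 i := fun i => rho_pos (hz i)
  have hc : ∀ i, conj (x.2.1 i) ≠ 0 := fun i => by simpa using hz i
  have key : ∀ i j : Fin 3, ‖x.2.2 i / (2 * conj (x.2.1 i)) - x.2.2 j / (2 * conj (x.2.1 j))‖ ^ 2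
      = ‖x.2.2 i * conj (x.2.1 j) - x.2.2 j * conj (x.2.1 i)‖ ^ 2
        / (4 * rho x.2.1 i * rho x.2.1 j) := by
    intro i j
    have hi := hc i
    have hj := hc j
    rw [show x.2.2 i / (2 * conj (x.2.1 i)) - x.2.2 j / (2 * conj (x.2.1 j))
      = (x.2.2 i * conj (x.2.1 j) - x.2.2 j * conj (x.2.1 i))
        / (2 * conj (x.2.1 i) * conj (x.2.1 j)) by field_simp]
    simp only [norm_div, norm_mul, Complex.norm_conj, Complex.norm_ofNat, div_pow, mul_pow, rho]
    norm_num
  have e1 : kineticRel m (leviCivita x).2.2 =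
      ‖piVec x.2.1 x.2.2 0‖ ^ 2 / (4 * rho x.2.1 0 * rho x.2.1 1) / (2 * m 0)
      + ‖piVec x.2.1 x.2.2 1‖ ^ 2 / (4 * rho x.2.1 2 * rho x.2.1 0) / (2 * m 1)
      + ‖piVec x.2.1 x.2.2 2‖ ^ 2 / (4 * rho x.2.1 1 * rho x.2.1 2) / (2 * m 2) := by
    simp only [kineticRel, kineticAbs, Fin.sum_univ_three, absMom, leviCivita, piVec]
    simp [key]
  have e2 : shapePotential m (leviCivita x).2.1 = massNormZ m x.2.1 *
      (pairMass m 0 / rho x.2.1 0 + pairMass m 1 / rho x.2.1 1 + pairMass m 2 / rho x.2.1 2) := by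
    simp [shapePotential, newtonU, Fin.sum_univ_three, leviCivita, massNormZ, rho]
  have e3 : massNorm m (leviCivita x).2.1 = massNormZ m x.2.1 := rfl
  have h0 := hρ 0
  have h1 := hρ 1
  have h2 := hρ 2
  have m0 := hm 0
  have m1 := hm 1
  have m2 := hm 2
  rw [sphHam, e1, e2, e3, show (leviCivita x).1 = x.1 from rfl, regHam, regPotential, tau]
  field_simp
  ring

end Smooth

/-! ### Invariance of the regularized Hamiltonian and equivariance of its flow -/

section Symmetry

theorem gaugeAct_mem_extDomain {a : Fin 3 → ℝ} {k : ℝ} (hk : 0 < k) (ha : ∀ i, |a i| = k) (c : ℂ)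
    {x : ExtPhase} (hx : x ∈ extDomain) : gaugeAct a c x ∈ extDomain := by
  refine ⟨hx.1, ?_⟩
  obtain ⟨i, hi⟩ := Function.ne_iff.1 hx.2
  have : (a i : ℂ) ≠ 0 := Complex.ofReal_ne_zero.2 (abs_pos.1 ((ha i).symm ▸ hk))
  exact Function.ne_iff.2 ⟨i, mul_ne_zero this hi⟩

theorem rho_gaugeAct {a : Fin 3 → ℝ} {k : ℝ} (ha : ∀ i, |a i| = k) (c : ℂ) (x : ExtPhase)
    (i : Fin 3) : rho (gaugeAct a c x).2.1 i = k ^ 2 * rho x.2.1 i := by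
  simp [rho, gaugeAct, mul_pow, ha i]

theorem normSqZ_gaugeAct {a : Fin 3 → ℝ} {k : ℝ} (ha : ∀ i, |a i| = k) (c : ℂ) (x : ExtPhase) :
    normSqZ (gaugeAct a c x).2.1 = k ^ 2 * normSqZ x.2.1 := by
  simp [normSqZ, rho_gaugeAct ha, Finset.mul_sum]

theorem tau_gaugeAct {a : Fin 3 → ℝ} {k : ℝ} (hk : 0 < k) (ha : ∀ i, |a i| = k) (c : ℂ)
    (x : ExtPhase) : tau (gaugeAct a c x).2.1 = tau x.2.1 := by
  rw [tau, tau, normSqZ_gaugeAct ha]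
  simp only [rho_gaugeAct ha]
  rw [show k ^ 2 * rho x.2.1 0 * (k ^ 2 * rho x.2.1 1) * (k ^ 2 * rho x.2.1 2)
    = k ^ 6 * (rho x.2.1 0 * rho x.2.1 1 * rho x.2.1 2) by ring, mul_pow,
    show (k ^ 2) ^ 3 = k ^ 6 by ring, mul_div_mul_left _ _ (by positivity)]

theorem massNormZ_gaugeAct {a : Fin 3 → ℝ} {k : ℝ} (ha : ∀ i, |a i| = k) (m : Fin 3 → ℝ)
    (c : ℂ) (x : ExtPhase) :
    massNormZ m (gaugeAct a c x).2.1 = k ^ 2 * massNormZ m x.2.1 := by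
  have : ∀ i, ‖(gaugeAct a c x).2.1 i ^ 2‖ ^ 2 = (k ^ 2) ^ 2 * ‖x.2.1 i ^ 2‖ ^ 2 := fun i => by
    simp [gaugeAct, mul_pow, ha i]
  simp only [massNormZ, massNorm, this]
  rw [← Real.sqrt_sq (sq_nonneg k), ← Real.sqrt_mul (sq_nonneg _), Real.sqrt_sq (sq_nonneg k)]
  congr 1
  rw [← mul_div_assoc, Finset.mul_sum]
  congr 1
  exact Finset.sum_congr rfl fun i _ => by ring

/-- The shift contributes a product of two conjugate components that is symmetric and cancels. Since
all a_i² equal k², both remaining terms acquire the same factor a_i a_j / k², which has modulus one.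
-/
theorem norm_piVec_gaugeAct {a : Fin 3 → ℝ} {k : ℝ} (hk : 0 < k) (ha : ∀ i, |a i| = k) (c : ℂ)
    (x : ExtPhase) (i : Fin 3) :
    ‖piVec (gaugeAct a c x).2.1 (gaugeAct a c x).2.2 i‖ = ‖piVec x.2.1 x.2.2 i‖ := by
  have h0 : ∀ i, (a i : ℂ) ≠ 0 := fun i =>
    Complex.ofReal_ne_zero.2 (abs_pos.1 ((ha i).symm ▸ hk))
  have hsq : ∀ i, (a i : ℂ) ^ 2 = (k : ℂ) ^ 2 := fun i => by
    rw [← Complex.ofReal_pow, ← Complex.ofReal_pow, ← sq_abs, ha i]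
  have hk' : (k : ℂ) ≠ 0 := by exact_mod_cast hk.ne'
  have key : ∀ i j : Fin 3, ‖(gaugeAct a c x).2.2 i * conj ((gaugeAct a c x).2.1 j)
      - (gaugeAct a c x).2.2 j * conj ((gaugeAct a c x).2.1 i)‖
      = ‖x.2.2 i * conj (x.2.1 j) - x.2.2 j * conj (x.2.1 i)‖ := by
    intro i j
    have hi := h0 i
    have hj := h0 j
    have : (gaugeAct a c x).2.2 i * conj ((gaugeAct a c x).2.1 j)
      - (gaugeAct a c x).2.2 j * conj ((gaugeAct a c x).2.1 i) = ((a i * a j : ℝ) : ℂ) / k ^ 2 *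
        (x.2.2 i * conj (x.2.1 j) - x.2.2 j * conj (x.2.1 i)) := by
      simp only [gaugeAct, map_mul, Complex.conj_ofReal, Complex.ofReal_mul]
      field_simp
      linear_combination (x.2.2 i * conj (x.2.1 j) * (a j : ℂ) ^ 2) * (-hsq i)
        + (x.2.2 j * conj (x.2.1 i) * (a i : ℂ) ^ 2) * (hsq j)
    rw [this, norm_mul, norm_div, Complex.norm_real, norm_pow, Complex.norm_real, Real.norm_eq_abs,
      Real.norm_eq_abs, abs_mul, ha, ha, abs_of_pos hk, ← sq, div_self (by positivity), one_mul]
  fin_cases i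
  · exact key 0 1
  · exact key 2 0
  · exact key 1 2

theorem regHam_gaugeAct {a : Fin 3 → ℝ} {k : ℝ} (hk : 0 < k) (ha : ∀ i, |a i| = k) (c : ℂ)
    (m : Fin 3 → ℝ) (h : ℝ) {x : ExtPhase} (hx : x ∈ extDomain) :
    regHam m h (gaugeAct a c x) = regHam m h x := by
  have hn := normSqZ_pos hx.2
  have hr := hx.1
  simp only [regHam, regPotential, tau_gaugeAct hk ha, massNormZ_gaugeAct ha, normSqZ_gaugeAct ha,
    norm_piVec_gaugeAct hk ha, rho_gaugeAct ha, show (gaugeAct a c x).1 = x.1 from rfl]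
  congr 2
  · congr 1
    field_simp
  · congr 1
    field_simp

/-- The shift changes ⟨η, z⟩ by a multiple of the sum of the z_ij², so the first constraint is
invariant only in the presence of the second. -/
theorem gaugeAct_mem_constraintSet {a : Fin 3 → ℝ} {k : ℝ} (hk : 0 < k) (ha : ∀ i, |a i| = k)
    (c : ℂ) {x : ExtPhase} (hx : x ∈ constraintSet) : gaugeAct a c x ∈ constraintSet := by
  obtain ⟨hx, h1, h2⟩ := hx
  have h0 : ∀ i, (a i : ℂ) ≠ 0 := fun i =>
    Complex.ofReal_ne_zero.2 (abs_pos.1 ((ha i).symm ▸ hk))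
  have hsq : ∀ i, (a i : ℂ) ^ 2 = (k : ℂ) ^ 2 := fun i => by
    rw [← Complex.ofReal_pow, ← Complex.ofReal_pow, ← sq_abs, ha i]
  refine ⟨gaugeAct_mem_extDomain hk ha c hx, ?_, ?_⟩
  · have : pairing (gaugeAct a c x).2.2 (gaugeAct a c x).2.1
        = pairing x.2.2 x.2.1 + 2 * conj c * k ^ 2 * ∑ i, x.2.1 i ^ 2 := by
      rw [pairing, pairing, Finset.mul_sum, ← Finset.sum_add_distrib]
      refine Finset.sum_congr rfl fun i _ => ?_
      have := h0 i
      have h2 : conj (2 : ℂ) = 2 := map_ofNat _ 2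
      rw [← hsq i]
      simp [gaugeAct, h2]
      field_simp
    rw [this, h2, mul_zero, add_zero, h1]
  · have : ∀ i, (gaugeAct a c x).2.1 i ^ 2 = (k : ℂ) ^ 2 * x.2.1 i ^ 2 := fun i => by
      rw [← hsq i]
      simp [gaugeAct, mul_pow]
    simp only [this, ← Finset.mul_sum, h2, mul_zero]

theorem IsRegCurve.gaugeAct {a : Fin 3 → ℝ} {k : ℝ} (hk : 0 < k) (ha : ∀ i, |a i| = k) (c : ℂ)
    {m : Fin 3 → ℝ} (hm : ∀ i, 0 < m i) {h : ℝ} {γ : ℝ → ExtPhase} {J : Set ℝ}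
    (hγ : IsRegCurve m h γ J) : IsRegCurve m h (fun s => gaugeAct a c (γ s)) J := by
  have h0 : ∀ i, a i ≠ 0 := fun i => abs_pos.1 ((ha i).symm ▸ hk)
  exact IsHamiltonianCurve.map isOpen_extDomain (contDiffOn_regHam hm h) (gaugeEquiv a h0 c)
    (omegaExt_gaugeAct h0 c) (fun x hx => gaugeAct_mem_extDomain hk ha c hx)
    (fun x hx => regHam_gaugeAct hk ha c m h hx) hγ

/-- The Hamiltonian vector field of the regularized Hamiltonian. -/
def regField (m : Fin 3 → ℝ) (h : ℝ) (x : ExtPhase) : ExtPhase :=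
  sharpExt (fderiv ℝ (regHam m h) x)

theorem isRegCurve_iff {m : Fin 3 → ℝ} {h : ℝ} {γ : ℝ → ExtPhase} {J : Set ℝ} :
    IsRegCurve m h γ J ↔ IsSol (regField m h) extDomain γ J :=
  isHamiltonianCurve_iff_isSol omegaExt_eq_iff

theorem contDiffOn_regField {m : Fin 3 → ℝ} (hm : ∀ i, 0 < m i) (h : ℝ) :
    ContDiffOn ℝ 1 (regField m h) extDomain :=
  contDiffOn_hamiltonianField sharpExt isOpen_extDomain (contDiffOn_regHam hm h)

theorem IsRegCurve.eqOn {m : Fin 3 → ℝ} (hm : ∀ i, 0 < m i) {h : ℝ} {J : Set ℝ}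
    {γ₁ γ₂ : ℝ → ExtPhase} (hJ : IsOpenInterval J) (h₁ : IsRegCurve m h γ₁ J)
    (h₂ : IsRegCurve m h γ₂ J) {s : ℝ} (hs : s ∈ J) (he : γ₁ s = γ₂ s) : EqOn γ₁ γ₂ J :=
  IsSol.eqOn isOpen_extDomain (contDiffOn_regField hm h) hJ (isRegCurve_iff.1 h₁)
    (isRegCurve_iff.1 h₂) hs he

theorem omegaExt_regField (m : Fin 3 → ℝ) (h : ℝ) (x w : ExtPhase) :
    omegaExt (regField m h x) w = fderiv ℝ (regHam m h) x w :=
  (omegaExt_eq_iff _ _).2 rfl w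

theorem hasFDerivAt_regHam {m : Fin 3 → ℝ} (hm : ∀ i, 0 < m i) (h : ℝ) {x : ExtPhase}
    (hx : x ∈ extDomain) : HasFDerivAt (regHam m h) (fderiv ℝ (regHam m h) x) x :=
  (((contDiffOn_regHam hm h).contDiffAt (isOpen_extDomain.mem_nhds hx)).differentiableAt
    (by simp)).hasFDerivAt

/-- Infinitesimal invariance along a symmetry orbit, the input of Noether's theorem below. -/
theorem fderiv_regHam_eq_zero_of_curve {m : Fin 3 → ℝ} (hm : ∀ i, 0 < m i) (h : ℝ) {x : ExtPhase}
    (hx : x ∈ extDomain) {g : ℝ → ExtPhase} {t : ℝ} {w : ExtPhase} (hg : HasDerivAt g w t)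
    (hgt : g t = x) (hc : ∀ᶠ t' in 𝓝 t, regHam m h (g t') = regHam m h x) :
    fderiv ℝ (regHam m h) x w = 0 := by
  subst hgt
  have h1 := (hasFDerivAt_regHam hm h hx).comp_hasDerivAt t hg
  have h2 : HasDerivAt (regHam m h ∘ g) 0 t :=
    (hasDerivAt_const t (regHam m h (g t))).congr_of_eventuallyEq hc
  exact h1.unique h2

end Symmetry

/-! ### The constraint submanifold and conservation laws -/

section Constraint

theorem hasDerivAt_re {f : ℝ → ℂ} {f' : ℂ} {t : ℝ} (hf : HasDerivAt f f' t) :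
    HasDerivAt (fun s => (f s).re) f'.re t :=
  Complex.reCLM.hasFDerivAt.comp_hasDerivAt t hf

theorem hasDerivAt_conj {f : ℝ → ℂ} {f' : ℂ} {t : ℝ} (hf : HasDerivAt f f' t) :
    HasDerivAt (fun s => conj (f s)) (conj f') t :=
  Complex.conjCLE.hasFDerivAt.comp_hasDerivAt t hf

theorem hasDerivAt_line {E : Type*} [NormedAddCommGroup E] [NormedSpace ℝ E] (x v : E) :
    HasDerivAt (fun t : ℝ => x + t • v) v 0 := by
  simpa using ((hasDerivAt_id (0 : ℝ)).smul_const v).const_add x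

/-- The value of a Fréchet derivative can be computed along the straight line. -/
theorem fderiv_apply_eq_of_line {E F : Type*} [NormedAddCommGroup E] [NormedSpace ℝ E]
    [NormedAddCommGroup F] [NormedSpace ℝ F] {f : E → F} {x v : E} {u : F}
    (hf : DifferentiableAt ℝ f x) (h : HasDerivAt (fun t : ℝ => f (x + t • v)) u 0) :
    fderiv ℝ f x v = u := by
  have h1 : HasFDerivAt f (fderiv ℝ f x) (x + (0 : ℝ) • v) := by simpa using hf.hasFDerivAt
  exact (h1.comp_hasDerivAt 0 (hasDerivAt_line x v)).unique h

theorem hasDerivAt_constraint {g : ℝ → ExtPhase} {t : ℝ} {v : ExtPhase} (hg : HasDerivAt g v t) :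
    HasDerivAt (fun s => constraint (g s))
      ((pairing v.2.2 (g t).2.1).re + (pairing (g t).2.2 v.2.1).re,
        ∑ i, 2 * (g t).2.1 i * v.2.1 i) t := by
  have hz : ∀ i, HasDerivAt (fun s => (g s).2.1 i) (v.2.1 i) t := fun i =>
    hasDerivAt_pi.1 hg.snd.fst i
  have he : ∀ i, HasDerivAt (fun s => (g s).2.2 i) (v.2.2 i) t := fun i =>
    hasDerivAt_pi.1 hg.snd.snd i
  have hec : ∀ i, HasDerivAt (fun s => conj ((g s).2.2 i)) (conj (v.2.2 i)) t := fun i =>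
    hasDerivAt_conj (he i)
  refine HasDerivAt.prodMk ?_ ?_
  · have h1 : HasDerivAt (fun s => pairing (g s).2.2 (g s).2.1)
        (pairing v.2.2 (g t).2.1 + pairing (g t).2.2 v.2.1) t := by
      unfold pairing
      rw [← Finset.sum_add_distrib]
      exact HasDerivAt.fun_sum fun i _ => (hec i).mul (hz i)
    exact hasDerivAt_re h1
  · refine HasDerivAt.fun_sum fun i _ => ?_
    simpa using (hz i).fun_pow 2

theorem contDiff_constraint : ContDiff ℝ ∞ constraint := by
  have h : ContDiff ℝ ∞ fun x : ExtPhase => pairing x.2.2 x.2.1 := ContDiff.sum fun i _ =>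
    (Complex.conjCLE.contDiff.comp (contDiff_eta i)).mul (contDiff_z i)
  exact (Complex.reCLM.contDiff.comp h).prodMk (ContDiff.sum fun i _ => (contDiff_z i).pow 2)

theorem fderiv_constraint (x v : ExtPhase) : fderiv ℝ constraint x v =
    ((pairing v.2.2 x.2.1).re + (pairing x.2.2 v.2.1).re, ∑ i, 2 * x.2.1 i * v.2.1 i) := by
  refine fderiv_apply_eq_of_line (contDiff_constraint.differentiable (by simp) x) ?_
  simpa using hasDerivAt_constraint (hasDerivAt_line x v)

theorem isSubmanifold_constraintSet :
    IsSubmanifoldCutOutBy extDomain constraint constraintSet := by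
  refine ⟨isOpen_extDomain, ?_, contDiff_constraint.contDiffOn, ?_⟩
  · ext x
    simp [constraintSet, constraint, Prod.ext_iff]
  · rintro x hx ⟨a, b⟩
    have hn := normSqZ_pos hx.1.2
    obtain ⟨i, hi⟩ := Function.ne_iff.1 hx.1.2
    have hi' : x.2.1 i ≠ 0 := hi
    -- One non-zero component of z suffices to reach any `b`. A variation of η along z does not
    -- affect the second constraint and then corrects the first, because its real pairing with z is
    -- e‖z‖².
    let dz : Vec3 := Pi.single i (b / (2 * x.2.1 i))
    let e : ℝ := (a - (pairing x.2.2 dz).re) / normSqZ x.2.1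
    refine ⟨(0, (dz, fun j => (e : ℂ) * x.2.1 j)), ?_⟩
    rw [fderiv_constraint]
    refine Prod.ext ?_ ?_
    · have : (pairing (fun j => (e : ℂ) * x.2.1 j) x.2.1).re = e * normSqZ x.2.1 := by
        simp only [pairing, normSqZ, rho, map_mul, Complex.conj_ofReal, Complex.re_sum,
          Finset.mul_sum, mul_assoc, Complex.re_ofReal_mul, Complex.conj_mul']
        exact Finset.sum_congr rfl fun j _ => by rw [← Complex.ofReal_pow, Complex.ofReal_re]
      simp only [this, e]
      field_simp
      ring
    · simp only [dz, Pi.single_apply, mul_ite, mul_zero, Finset.sum_ite_eq', Finset.mem_univ,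
        if_true]
      field_simp

/-- Noether's theorem. Re ⟨η, z⟩ generates the scalings, and the real part of conj c times the sum
of the z_ij² generates the translation by c; invariance of the Hamiltonian under a flow means that
its generator is conserved. This holds on the whole domain, not only on the constraint set. -/
theorem fderiv_constraint_regField {m : Fin 3 → ℝ} (hm : ∀ i, 0 < m i) (h : ℝ) {x : ExtPhase}
    (hx : x ∈ extDomain) : fderiv ℝ constraint x (regField m h x) = 0 := by
  have hΩ := omegaExt_regField m h x
  set v := regField m h x
  rw [fderiv_constraint]
  refine Prod.ext ?_ ?_
  -- The scaling orbit passes through `x` at parameter 1 with velocity (z, -η).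
  · have hg : HasDerivAt (fun t : ℝ => gaugeAct (fun _ => t) 0 x)
        (((0, 0), (x.2.1, fun i => -x.2.2 i)) : ExtPhase) 1 := by
      refine (hasDerivAt_const _ _).prodMk (HasDerivAt.prodMk ?_ ?_)
      · refine hasDerivAt_pi.2 fun i => ?_
        simpa using (Complex.ofRealCLM.hasDerivAt (x := (1 : ℝ))).mul_const (x.2.1 i)
      · refine hasDerivAt_pi.2 fun i => ?_
        have h1 : HasDerivAt (fun t : ℝ => ((t : ℂ))⁻¹) (-1) 1 := by
          simpa using (Complex.ofRealCLM.hasDerivAt (x := (1 : ℝ))).fun_inv (by simp)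
        simpa [div_eq_mul_inv] using h1.const_mul (x.2.2 i)
    have h0 := fderiv_regHam_eq_zero_of_curve hm h hx hg (by simp [gaugeAct]) <| by
      filter_upwards [lt_mem_nhds (zero_lt_one (α := ℝ))] with t ht
      exact regHam_gaugeAct ht (fun _ => abs_of_pos ht) 0 m h hx
    rw [← hΩ] at h0
    have hneg : (pairing (fun i => -x.2.2 i) v.2.1).re = -(pairing x.2.2 v.2.1).re := by
      simp [pairing, Finset.sum_neg_distrib]
    simp only [omegaExt, omegaPhase, hneg, mul_zero] at h0
    simp only [Prod.fst_zero]
    linarith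
  -- All complex directions c are needed: c = 1 gives the real part and c = i the imaginary part of
  -- the second constraint.
  · have hg : ∀ c : ℂ, (pairing (fun i => 2 * c * conj (x.2.1 i)) v.2.1).re = 0 := by
      intro c
      have hg : HasDerivAt (fun t : ℝ => gaugeAct 1 (t * c) x)
          (((0, 0), (0, fun i => 2 * c * conj (x.2.1 i))) : ExtPhase) 0 := by
        refine (hasDerivAt_const _ _).prodMk (HasDerivAt.prodMk ?_ ?_)
        · refine hasDerivAt_pi.2 fun i => ?_
          simpa using hasDerivAt_const (0 : ℝ) (x.2.1 i)
        · refine hasDerivAt_pi.2 fun i => ?_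
          have := ((Complex.ofRealCLM.hasDerivAt (x := (0 : ℝ))).mul_const
            (2 * c * conj (x.2.1 i))).const_add (x.2.2 i)
          simp only [Complex.ofRealCLM_apply, Complex.ofReal_one, one_mul] at this
          refine this.congr_of_eventuallyEq (Eventually.of_forall fun t => ?_)
          simp
          ring
      have h0 := fderiv_regHam_eq_zero_of_curve hm h hx hg (by simp [gaugeAct]) <|
        Eventually.of_forall fun t => regHam_gaugeAct one_pos (fun _ => by simp) _ m h hx
      rw [← hΩ] at h0
      simpa [omegaExt, omegaPhase, pairing] using h0
    have h2 : conj (2 : ℂ) = 2 := map_ofNat _ 2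
    have hs : ∀ c : ℂ, pairing (fun i => 2 * c * conj (x.2.1 i)) v.2.1
        = conj c * ∑ i, 2 * x.2.1 i * v.2.1 i := by
      intro c
      rw [pairing, Finset.mul_sum]
      exact Finset.sum_congr rfl fun i _ => by simp [h2]; ring
    have h3 := hg 1
    have h4 := hg Complex.I
    rw [hs] at h3 h4
    refine Complex.ext ?_ ?_
    · simpa using h3
    · simpa using h4

theorem IsRegCurve.mem_constraintSet {m : Fin 3 → ℝ} (hm : ∀ i, 0 < m i) {h : ℝ} {J : Set ℝ}
    {γ : ℝ → ExtPhase} (hJ : IsOpenInterval J) (hγ : IsRegCurve m h γ J) {s : ℝ} (hs : s ∈ J)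
    (h0 : γ s ∈ constraintSet) {t : ℝ} (ht : t ∈ J) : γ t ∈ constraintSet := by
  have hsol := isRegCurve_iff.1 hγ
  have hd : ∀ u ∈ J, HasDerivAt (fun u => constraint (γ u)) 0 u := fun u hu => by
    have h1 := hasDerivAt_constraint (hsol u hu).2
    rwa [← fderiv_constraint, fderiv_constraint_regField hm h (hsol u hu).1] at h1
  have he := eq_of_hasDerivAt_zero hJ hd ht hs
  rw [isSubmanifold_constraintSet.2.1] at h0 ⊢
  exact ⟨(hsol t ht).1, he.trans h0.2⟩

theorem omegaExt_self (v : ExtPhase) : omegaExt v v = 0 := by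
  simp [omegaExt, omegaPhase]
  ring

theorem IsRegCurve.regHam_eq {m : Fin 3 → ℝ} (hm : ∀ i, 0 < m i) {h : ℝ} {J : Set ℝ}
    {γ : ℝ → ExtPhase} (hJ : IsOpenInterval J) (hγ : IsRegCurve m h γ J) {s t : ℝ} (hs : s ∈ J)
    (ht : t ∈ J) : regHam m h (γ t) = regHam m h (γ s) := by
  have hsol := isRegCurve_iff.1 hγ
  refine eq_of_hasDerivAt_zero hJ (f := fun u => regHam m h (γ u)) (fun u hu => ?_) ht hs
  have h1 := (hasFDerivAt_regHam hm h (hsol u hu).1).comp_hasDerivAt u (hsol u hu).2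
  rwa [← omegaExt_regField, omegaExt_self] at h1

end Constraint

/-! ### Real inner product, relative and absolute coordinates -/

section InnerProduct

/-- The real inner product of `ℂ³`. -/
def ip (v w : Vec3) : ℝ := (pairing v w).re

theorem ip_eq (v w : Vec3) :
    ip v w = ∑ i, ((v i).re * (w i).re + (v i).im * (w i).im) := by
  simp [ip, pairing]

theorem ip_comm (v w : Vec3) : ip v w = ip w v := pairing_re_comm v w

theorem ip_add_left (u v w : Vec3) : ip (u + v) w = ip u w + ip v w := by
  simp [ip_eq, Fin.sum_univ_three]; ring

theorem ip_add_right (u v w : Vec3) : ip u (v + w) = ip u v + ip u w := by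
  simp [ip_eq, Fin.sum_univ_three]; ring

theorem ip_smul_left (c : ℝ) (v w : Vec3) : ip (c • v) w = c * ip v w := by
  simp [ip_eq, Fin.sum_univ_three]; ring

theorem ip_smul_right (c : ℝ) (v w : Vec3) : ip v (c • w) = c * ip v w := by
  simp [ip_eq, Fin.sum_univ_three]; ring

theorem ip_sub_left (u v w : Vec3) : ip (u - v) w = ip u w - ip v w := by
  simp [ip_eq, Fin.sum_univ_three]; ring

theorem hasDerivAt_ip {f g : ℝ → Vec3} {f' g' : Vec3} {t : ℝ} (hf : HasDerivAt f f' t)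
    (hg : HasDerivAt g g' t) :
    HasDerivAt (fun s => ip (f s) (g s)) (ip f' (g t) + ip (f t) g') t := by
  have h1 : HasDerivAt (fun s => pairing (f s) (g s)) (pairing f' (g t) + pairing (f t) g') t := by
    unfold pairing
    rw [← Finset.sum_add_distrib]
    exact HasDerivAt.fun_sum fun i _ =>
      (hasDerivAt_conj (hasDerivAt_pi.1 hf i)).mul (hasDerivAt_pi.1 hg i)
  exact hasDerivAt_re h1

theorem omegaPhase_eq (v w : Phase) : omegaPhase v w = ip w.2 v.1 - ip v.2 w.1 := rfl

theorem massDual_smul (m : Fin 3 → ℝ) (c : ℝ) (v : Vec3) :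
    massDual m (c • v) = c • massDual m v := by
  funext i; simp [massDual, mul_left_comm]

theorem ip_massDual_comm (m : Fin 3 → ℝ) (v w : Vec3) :
    ip (massDual m v) w = ip (massDual m w) v := by
  simp [ip_eq, massDual, Fin.sum_univ_three]; ring

theorem ip_massDual_self {m : Fin 3 → ℝ} (hm : ∀ i, 0 < m i) (X : Vec3) :
    ip (massDual m X) X = massNorm m X ^ 2 := by
  rw [massNorm_sq hm]
  simp [ip_eq, massDual, Fin.sum_univ_three, Complex.sq_norm, Complex.normSq_apply]
  ring

theorem relPos_absPos {m : Fin 3 → ℝ} (hm : ∀ i, 0 < m i) {Q : Vec3} (hQ : ∑ i, Q i = 0) :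
    relPos (absPos m Q) = Q := by
  have hM : (totalMass m : ℂ) ≠ 0 := Complex.ofReal_ne_zero.2 (totalMass_pos hm).ne'
  have hs : (totalMass m : ℂ) = m 0 + m 1 + m 2 := by simp [totalMass, Fin.sum_univ_three]
  rw [Fin.sum_univ_three] at hQ
  funext i
  fin_cases i
  · simp only [relPos, absPos, Fin.zero_eta, Matrix.cons_val_zero, Matrix.cons_val_one]
    rw [← sub_div, div_eq_iff hM, hs]
    linear_combination (-(m 2 : ℂ)) * hQ
  · simp [relPos, absPos]
    rw [← sub_div, div_eq_iff hM, hs]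
    linear_combination (-(m 1 : ℂ)) * hQ
  · simp [relPos, absPos]
    rw [← sub_div, div_eq_iff hM, hs]
    linear_combination (-(m 0 : ℂ)) * hQ

theorem sum_relPos (q : Vec3) : ∑ i, relPos q i = 0 := by
  simp [relPos, Fin.sum_univ_three]

theorem sum_absMom (P : Vec3) : ∑ i, absMom P i = 0 := by
  simp [absMom, Fin.sum_univ_three]

theorem sum_mul_absPos (m : Fin 3 → ℝ) (Q : Vec3) : ∑ i, (m i : ℂ) * absPos m Q i = 0 := by
  simp [absPos, Fin.sum_univ_three]; ring

theorem absPos_relPos {m : Fin 3 → ℝ} (hm : ∀ i, 0 < m i) {q : Vec3}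
    (hq : ∑ i, (m i : ℂ) * q i = 0) : absPos m (relPos q) = q := by
  have hM : (totalMass m : ℂ) ≠ 0 := Complex.ofReal_ne_zero.2 (totalMass_pos hm).ne'
  have hs : (totalMass m : ℂ) = m 0 + m 1 + m 2 := by simp [totalMass, Fin.sum_univ_three]
  rw [Fin.sum_univ_three] at hq
  funext i
  fin_cases i <;> simp [relPos, absPos] <;> rw [div_eq_iff hM, hs] <;> linear_combination (-hq)

/-- Transposition of `relPos`; it makes the passage from pairs to bodies symplectic on relative
positions of sum zero. -/
theorem ip_absMom (P q : Vec3) : ip (absMom P) q = ip P (relPos q) := by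
  simp [ip_eq, absMom, relPos, Fin.sum_univ_three]; ring

theorem exists_absMom_eq {p : Vec3} (hp : ∑ i, p i = 0) : ∃ P, absMom P = p := by
  rw [Fin.sum_univ_three] at hp
  refine ⟨![-p 1, p 2, 0], ?_⟩
  funext i
  fin_cases i <;> simp [absMom]
  linear_combination (-hp)

theorem omegaPhase_absPos_absMom {m : Fin 3 → ℝ} (hm : ∀ i, 0 < m i) {v w : Phase}
    (hv : ∑ i, v.1 i = 0) (hw : ∑ i, w.1 i = 0) :
    omegaPhase (absPos m v.1, absMom v.2) (absPos m w.1, absMom w.2) = omegaPhase v w := by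
  simp only [omegaPhase_eq, ip_absMom, relPos_absPos hm hv, relPos_absPos hm hw]

end InnerProduct

/-! ### Differentials of the Levi-Civita and spherical maps -/

section Derivatives

/-- The state space points whose `z` components do not vanish. -/
def regularDomain : Set ExtPhase := {x | x ∈ extDomain ∧ ∀ i, x.2.1 i ≠ 0}

theorem isOpen_regularDomain : IsOpen regularDomain := by
  refine isOpen_extDomain.inter ?_
  change IsOpen {x : ExtPhase | ∀ i, x.2.1 i ≠ 0}
  rw [Set.ofPred_forall]
  exact isOpen_iInter_of_finite fun i => isOpen_ne_fun (contDiff_z i).continuous continuous_const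

theorem collisionFree_subset : collisionFree ⊆ regularDomain := fun _ hx => ⟨hx.1.1, hx.2⟩

/-- The differential of the Levi-Civita map. -/
def dLeviCivita (x v : ExtPhase) : ExtPhase :=
  (v.1, (fun i => 2 * x.2.1 i * v.2.1 i,
    fun i => v.2.2 i / (2 * conj (x.2.1 i))
      - x.2.2 i * conj (v.2.1 i) / (2 * conj (x.2.1 i) ^ 2)))

theorem hasDerivAt_leviCivita {g : ℝ → ExtPhase} {t : ℝ} {v : ExtPhase} (hg : HasDerivAt g v t)
    (hz : ∀ i, (g t).2.1 i ≠ 0) :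
    HasDerivAt (fun s => leviCivita (g s)) (dLeviCivita (g t) v) t := by
  have hz' : ∀ i, HasDerivAt (fun s => (g s).2.1 i) (v.2.1 i) t := fun i =>
    hasDerivAt_pi.1 hg.snd.fst i
  have he : ∀ i, HasDerivAt (fun s => (g s).2.2 i) (v.2.2 i) t := fun i =>
    hasDerivAt_pi.1 hg.snd.snd i
  have h1 : HasDerivAt (fun s => (g s).1) v.1 t := hg.fst
  refine h1.prodMk (HasDerivAt.prodMk ?_ ?_)
  · refine hasDerivAt_pi.2 fun i => ?_
    simpa using (hz' i).fun_pow 2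
  · refine hasDerivAt_pi.2 fun i => ?_
    have hc : conj ((g t).2.1 i) ≠ 0 := by simpa using hz i
    refine ((he i).fun_div ((hasDerivAt_conj (hz' i)).const_mul (2 : ℂ)) (by simpa using hz i)).congr_deriv
      ?_
    field_simp

theorem sphToRel_eq (m : Fin 3 → ℝ) (x : ExtPhase) : sphToRel m x =
    ((x.1.1 / massNorm m x.2.1) • x.2.1, (x.1.2 / massNorm m x.2.1) • massDual m x.2.1
      + (massNorm m x.2.1 / x.1.1) • x.2.2) := by
  refine Prod.ext ?_ ?_ <;> funext i <;> simp [sphToRel]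

/-- The differential of `sphToRel`. -/
def dSphToRel (m : Fin 3 → ℝ) (x v : ExtPhase) : Phase :=
  let M := massNorm m x.2.1
  let e := ip (massDual m x.2.1) v.2.1
  ((v.1.1 / M - x.1.1 * e / M ^ 3) • x.2.1 + (x.1.1 / M) • v.2.1,
    (v.1.2 / M - x.1.2 * e / M ^ 3) • massDual m x.2.1 + (x.1.2 / M) • massDual m v.2.1
      + ((e / M / x.1.1 - M * v.1.1 / x.1.1 ^ 2) • x.2.2 + (M / x.1.1) • v.2.2))

theorem hasDerivAt_massNorm {m : Fin 3 → ℝ} (hm : ∀ i, 0 < m i) {g : ℝ → Vec3} {t : ℝ} {v : Vec3}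
    (hg : HasDerivAt g v t) (h0 : g t ≠ 0) :
    HasDerivAt (fun s => massNorm m (g s)) (ip (massDual m (g t)) v / massNorm m (g t)) t := by
  have h1 : HasDerivAt (fun s => massDual m (g s)) (massDual m v) t :=
    hasDerivAt_pi.2 fun i => (hasDerivAt_pi.1 hg i).const_mul _
  have h2 := hasDerivAt_ip h1 hg
  have hM := massNorm_pos hm h0
  have h3 := h2.sqrt (by rw [ip_massDual_self hm]; positivity)
  simp only [ip_massDual_self hm, Real.sqrt_sq (Real.sqrt_nonneg _), massNorm] at h3
  refine h3.congr_deriv ?_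
  rw [ip_massDual_comm m v, ← two_mul, mul_div_mul_left _ _ two_ne_zero]
  rfl

theorem hasDerivAt_sphToRel {m : Fin 3 → ℝ} (hm : ∀ i, 0 < m i) {g : ℝ → ExtPhase} {t : ℝ}
    {v : ExtPhase} (hg : HasDerivAt g v t) (hX : (g t).2.1 ≠ 0) (hr : (g t).1.1 ≠ 0) :
    HasDerivAt (fun s => sphToRel m (g s)) (dSphToRel m (g t) v) t := by
  have hM := massNorm_pos hm hX
  have h1 := hasDerivAt_massNorm hm hg.snd.fst hX
  have hD : HasDerivAt (fun s => massDual m (g s).2.1) (massDual m v.2.1) t :=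
    hasDerivAt_pi.2 fun i => (hasDerivAt_pi.1 hg.snd.fst i).const_mul _
  have hr' : HasDerivAt (fun s => (g s).1.1) v.1.1 t := hg.fst.fst
  have hp' : HasDerivAt (fun s => (g s).1.2) v.1.2 t := hg.fst.snd
  have hX' : HasDerivAt (fun s => (g s).2.1) v.2.1 t := hg.snd.fst
  have hY' : HasDerivAt (fun s => (g s).2.2) v.2.2 t := hg.snd.snd
  simp only [sphToRel_eq]
  refine HasDerivAt.prodMk ?_ ?_
  · refine ((hr'.fun_div h1 hM.ne').fun_smul hX').congr_deriv ?_
    rw [add_comm]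
    congr 2
    field_simp
  · refine (((hp'.fun_div h1 hM.ne').fun_smul hD).add
      ((h1.fun_div hr' hr).fun_smul hY')).congr_deriv ?_
    rw [add_comm (_ • massDual m v.2.1), add_comm (_ • v.2.2)]
    congr 3
    · field_simp
    · field_simp

/-- The map is the cotangent lift of squaring. Differentiating the factor in Y produces a term
symmetric in the two vectors, which cancels. -/
theorem omegaExt_dLeviCivita {x : ExtPhase} (hz : ∀ i, x.2.1 i ≠ 0) (v w : ExtPhase) :
    omegaExt (dLeviCivita x v) (dLeviCivita x w) = omegaExt v w := by
  have h2 : conj (2 : ℂ) = 2 := map_ofNat _ 2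
  have key : ∀ v w : ExtPhase, pairing (dLeviCivita x w).2.2 (dLeviCivita x v).2.1
      = pairing w.2.2 v.2.1 - ∑ i, conj (x.2.2 i) / x.2.1 i * (w.2.1 i * v.2.1 i) := by
    intro v w
    rw [pairing, pairing, ← Finset.sum_sub_distrib]
    refine Finset.sum_congr rfl fun i _ => ?_
    have := hz i
    simp [dLeviCivita, h2]
    field_simp
  have hs : ∑ i, conj (x.2.2 i) / x.2.1 i * (w.2.1 i * v.2.1 i)
      = ∑ i, conj (x.2.2 i) / x.2.1 i * (v.2.1 i * w.2.1 i) :=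
    Finset.sum_congr rfl fun i _ => by ring
  simp only [omegaExt, omegaPhase, key, hs, Complex.sub_re]
  simp only [dLeviCivita]
  ring

/-- The scale of X is redundant: the map lowers the dimension by two and cannot be symplectic
everywhere. On vectors tangent to Re ⟨Y, X⟩ = 0 the excess terms cancel by symmetry of the mass
metric and |X|² = ⟨X*, X⟩. -/
theorem omegaPhase_dSphToRel {m : Fin 3 → ℝ} (hm : ∀ i, 0 < m i) {x : ExtPhase} (hX : x.2.1 ≠ 0)
    (hr : x.1.1 ≠ 0) (h0 : ip x.2.2 x.2.1 = 0) {v w : ExtPhase}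
    (hv : ip v.2.2 x.2.1 + ip x.2.2 v.2.1 = 0) (hw : ip w.2.2 x.2.1 + ip x.2.2 w.2.1 = 0) :
    omegaPhase (dSphToRel m x v) (dSphToRel m x w) = omegaExt v w := by
  have hM := (massNorm_pos hm hX).ne'
  have h1 := ip_massDual_comm m v.2.1 x.2.1
  have h2 := ip_massDual_comm m w.2.1 x.2.1
  have h3 := ip_massDual_comm m v.2.1 w.2.1
  have h4 := ip_massDual_self hm x.2.1
  have hv' := eq_neg_of_add_eq_zero_left hv
  have hw' := eq_neg_of_add_eq_zero_left hw
  simp only [omegaExt, omegaPhase_eq, dSphToRel, ip_add_left, ip_add_right, ip_smul_left,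
    ip_smul_right, h0, h1, h2, h3, h4, hv', hw']
  field_simp
  ring

end Derivatives

/-! ### The map Ψ: smoothness, symplecticity, energy -/

section BodyState

/-- The linear map from relative states to states of the three bodies. -/
def absState (m : Fin 3 → ℝ) : Phase →L[ℝ] Phase :=
  LinearMap.toContinuousLinearMap
    { toFun := fun y => (absPos m y.1, absMom y.2)
      map_add' := fun x y => by
        refine Prod.ext ?_ ?_ <;> funext i <;> fin_cases i <;> simp [absPos, absMom] <;> ring
      map_smul' := fun c x => by
        refine Prod.ext ?_ ?_ <;> funext i <;> fin_cases i <;> simp [absPos, absMom] <;> ring }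

theorem absState_apply (m : Fin 3 → ℝ) (y : Phase) :
    absState m y = (absPos m y.1, absMom y.2) := rfl

theorem bodyState_eq (m : Fin 3 → ℝ) (x : ExtPhase) :
    bodyState m x = absState m (sphToRel m (leviCivita x)) := rfl

theorem leviCivita_snd_fst_ne_zero {x : ExtPhase} (hx : x ∈ extDomain) :
    (leviCivita x).2.1 ≠ 0 := sq_ne_zero_vec hx.2

theorem contDiffOn_bodyState {m : Fin 3 → ℝ} (hm : ∀ i, 0 < m i) :
    ContDiffOn ℝ ∞ (bodyState m) regularDomain := by
  have hsub : regularDomain ⊆ extDomain := fun x hx => hx.1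
  have hM := (contDiffOn_massNormZ hm).mono hsub
  have hr : ContDiffOn ℝ ∞ (fun x : ExtPhase => x.1.1) regularDomain :=
    contDiff_fst_r.contDiffOn
  have hp : ContDiffOn ℝ ∞ (fun x : ExtPhase => x.1.2) regularDomain := by fun_prop
  have hM0 : ∀ x ∈ regularDomain, massNormZ m x.2.1 ≠ 0 := fun x hx =>
    (massNormZ_pos hm hx.1.2).ne'
  have hr0 : ∀ x ∈ regularDomain, x.1.1 ≠ 0 := fun x hx => hx.1.1.ne'
  have ofReal : ∀ {f : ExtPhase → ℝ}, ContDiffOn ℝ ∞ f regularDomain →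
      ContDiffOn ℝ ∞ (fun x => (f x : ℂ)) regularDomain := fun hf =>
    Complex.ofRealCLM.contDiff.comp_contDiffOn hf
  have hz : ∀ i, ContDiffOn ℝ ∞ (fun x : ExtPhase => x.2.1 i ^ 2) regularDomain := fun i =>
    ((contDiff_z i).pow 2).contDiffOn
  refine (absState m).contDiff.comp_contDiffOn (ContDiffOn.prodMk ?_ ?_)
  · refine contDiffOn_pi.2 fun i => ?_
    exact (ofReal (hr.div hM hM0)).mul (hz i)
  · refine contDiffOn_pi.2 fun i => ?_
    refine ((ofReal (hp.div hM hM0)).mul (contDiffOn_const.mul (hz i))).add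
      ((ofReal (hM.div hr hr0)).mul ?_)
    simp only [leviCivita, div_eq_mul_inv]
    refine (contDiff_eta i).contDiffOn.mul (ContDiffOn.inv
      (contDiff_const.mul (contDiff_conj_z i)).contDiffOn fun x hx => ?_)
    simpa using hx.2 i

/-- The differential of `bodyState` at regular points. -/
def dBodyState (m : Fin 3 → ℝ) (x v : ExtPhase) : Phase :=
  absState m (dSphToRel m (leviCivita x) (dLeviCivita x v))

theorem hasDerivAt_bodyState {m : Fin 3 → ℝ} (hm : ∀ i, 0 < m i) {g : ℝ → ExtPhase} {t : ℝ}
    {v : ExtPhase} (hg : HasDerivAt g v t) (hx : g t ∈ regularDomain) :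
    HasDerivAt (fun s => bodyState m (g s)) (dBodyState m (g t) v) t :=
  (absState m).hasFDerivAt.comp_hasDerivAt t <| hasDerivAt_sphToRel hm
    (hasDerivAt_leviCivita hg hx.2) (leviCivita_snd_fst_ne_zero hx.1) hx.1.1.ne'

theorem hasFDerivAt_bodyState {m : Fin 3 → ℝ} (hm : ∀ i, 0 < m i) {x : ExtPhase}
    (hx : x ∈ regularDomain) : HasFDerivAt (bodyState m) (fderiv ℝ (bodyState m) x) x :=
  (((contDiffOn_bodyState hm).contDiffAt (isOpen_regularDomain.mem_nhds hx)).differentiableAt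
    (by simp)).hasFDerivAt

theorem fderiv_bodyState {m : Fin 3 → ℝ} (hm : ∀ i, 0 < m i) {x : ExtPhase}
    (hx : x ∈ regularDomain) (v : ExtPhase) :
    fderiv ℝ (bodyState m) x v = dBodyState m x v := by
  refine fderiv_apply_eq_of_line (hasFDerivAt_bodyState hm hx).differentiableAt ?_
  simpa using hasDerivAt_bodyState hm (hasDerivAt_line x v) (by simpa using hx)

theorem ip_leviCivita {x : ExtPhase} (hz : ∀ i, x.2.1 i ≠ 0) :
    ip (leviCivita x).2.2 (leviCivita x).2.1 = (pairing x.2.2 x.2.1).re / 2 := by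
  have h2 : conj (2 : ℂ) = 2 := map_ofNat _ 2
  have : pairing (leviCivita x).2.2 (leviCivita x).2.1
      = ((1 / 2 : ℝ) : ℂ) * pairing x.2.2 x.2.1 := by
    rw [pairing, pairing, Finset.mul_sum]
    refine Finset.sum_congr rfl fun i _ => ?_
    have := hz i
    simp [leviCivita, h2]
    field_simp
  rw [ip, this, Complex.re_ofReal_mul]
  ring

theorem ip_dLeviCivita {x : ExtPhase} (hz : ∀ i, x.2.1 i ≠ 0) (v : ExtPhase) :
    ip (dLeviCivita x v).2.2 (leviCivita x).2.1 + ip (leviCivita x).2.2 (dLeviCivita x v).2.1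
      = ((pairing v.2.2 x.2.1).re + (pairing x.2.2 v.2.1).re) / 2 := by
  have h2 : conj (2 : ℂ) = 2 := map_ofNat _ 2
  have : pairing (dLeviCivita x v).2.2 (leviCivita x).2.1
        + pairing (leviCivita x).2.2 (dLeviCivita x v).2.1
      = ((1 / 2 : ℝ) : ℂ) * (pairing v.2.2 x.2.1 + pairing x.2.2 v.2.1) := by
    simp only [pairing]
    rw [← Finset.sum_add_distrib, ← Finset.sum_add_distrib, Finset.mul_sum]
    refine Finset.sum_congr rfl fun i _ => ?_
    have := hz i
    simp [leviCivita, dLeviCivita, h2]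
    field_simp
    ring
  rw [ip, ip, ← Complex.add_re, this, Complex.re_ofReal_mul, Complex.add_re]
  ring

theorem sum_dSphToRel_fst {m : Fin 3 → ℝ} {x v : ExtPhase} (hx : ∑ i, x.2.1 i = 0)
    (hv : ∑ i, v.2.1 i = 0) : ∑ i, (dSphToRel m x v).1 i = 0 := by
  simp only [dSphToRel, Pi.add_apply, Pi.smul_apply, Finset.sum_add_distrib, ← Finset.smul_sum,
    hx, hv, smul_zero, add_zero]

/-- Squaring is symplectic without condition. The real constraint is what the spherical step needs,
and the complex constraint what the passage to the bodies needs. -/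
theorem omegaPhase_dBodyState {m : Fin 3 → ℝ} (hm : ∀ i, 0 < m i) {x : ExtPhase}
    (hx : x ∈ collisionFree) {v w : ExtPhase} (hv : fderiv ℝ constraint x v = 0)
    (hw : fderiv ℝ constraint x w = 0) :
    omegaPhase (dBodyState m x v) (dBodyState m x w) = omegaExt v w := by
  rw [fderiv_constraint, Prod.ext_iff] at hv hw
  have hX : ∑ i, (leviCivita x).2.1 i = 0 := hx.1.2.2
  rw [dBodyState, dBodyState, absState_apply, absState_apply,
    omegaPhase_absPos_absMom hm (sum_dSphToRel_fst hX hv.2) (sum_dSphToRel_fst hX hw.2),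
    omegaPhase_dSphToRel hm (leviCivita_snd_fst_ne_zero hx.1.1) hx.1.1.1.ne',
    omegaExt_dLeviCivita hx.2]
  · rw [ip_leviCivita hx.2, hx.1.2.1, zero_div]
  · rw [ip_dLeviCivita hx.2, show _ + _ = (0 : ℝ) from hv.1, zero_div]
  · rw [ip_dLeviCivita hx.2, show _ + _ = (0 : ℝ) from hw.1, zero_div]

/-- The covector X* is the momentum of the motion whose velocity is the configuration itself. -/
theorem absMom_massDual {m : Fin 3 → ℝ} (X : Vec3) (i : Fin 3) :
    absMom (massDual m X) i = m i * absPos m X i := by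
  fin_cases i <;> simp [absMom, massDual, absPos, pairMass] <;> ring

/-- Pythagoras for the kinetic metric: radial momentum is mass times position, so its product with
the momentum of Y is the pairing of Y and X, which vanishes. -/
theorem kineticAbs_add_smul {m : Fin 3 → ℝ} (hm : ∀ i, 0 < m i) {X Y : Vec3}
    (hX : ∑ i, X i = 0) (h0 : ip Y X = 0) (a b : ℝ) :
    kineticAbs m (absMom (a • massDual m X + b • Y))
      = a ^ 2 * massNorm m X ^ 2 / 2 + b ^ 2 * kineticRel m Y := by
  have h1 : ip (absMom (massDual m X)) (absPos m X) = massNorm m X ^ 2 := by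
    rw [ip_absMom, relPos_absPos hm hX, ip_massDual_self hm]
  have h2 : ip (absMom Y) (absPos m X) = 0 := by
    rw [ip_absMom, relPos_absPos hm hX, h0]
  have h3 : absMom (a • massDual m X + b • Y) = fun i => (a : ℂ) * (m i * absPos m X i)
      + b * absMom Y i := by
    funext i
    rw [← absMom_massDual]
    fin_cases i <;> simp [absMom] <;> ring
  have m0 := (hm 0).ne'
  have m1 := (hm 1).ne'
  have m2 := (hm 2).ne'
  -- The cross term, which is zero, is added explicitly; after that the identity is purely algebraic
  -- in the components.
  rw [← h1, show a ^ 2 * ip (absMom (massDual m X)) (absPos m X) / 2 =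
    a ^ 2 * ip (absMom (massDual m X)) (absPos m X) / 2 + a * b * ip (absMom Y) (absPos m X) by
      rw [h2]; ring, h3]
  simp only [kineticRel, kineticAbs, ip_eq, Fin.sum_univ_three, absMom_massDual]
  simp only [Complex.sq_norm, Complex.normSq_apply, Complex.add_re, Complex.add_im,
    Complex.re_ofReal_mul, Complex.im_ofReal_mul]
  field_simp
  ring

theorem sphHam_eq_threeBodyHam {m : Fin 3 → ℝ} (hm : ∀ i, 0 < m i) {x : ExtPhase}
    (hr : 0 < x.1.1) (hX : x.2.1 ≠ 0) (hs : ∑ i, x.2.1 i = 0) (h0 : ip x.2.2 x.2.1 = 0) :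
    threeBodyHam m (absState m (sphToRel m x)) = sphHam m x := by
  have hM := massNorm_pos hm hX
  rw [absState_apply, threeBodyHam, sphToRel_eq]
  simp only
  rw [kineticAbs_add_smul hm hs h0, relPos_absPos hm (by simp [← Finset.mul_sum, hs]), sphHam]
  have : newtonU m ((x.1.1 / massNorm m x.2.1) • x.2.1) = shapePotential m x.2.1 / x.1.1 := by
    rw [shapePotential, newtonU, newtonU, Finset.mul_sum, Finset.sum_div]
    refine Finset.sum_congr rfl fun i _ => ?_
    rw [Pi.smul_apply, norm_smul, Real.norm_of_nonneg (by positivity), ← div_div]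
    field_simp
  rw [this]
  field_simp

theorem regHam_eq_threeBodyHam {m : Fin 3 → ℝ} (hm : ∀ i, 0 < m i) (h : ℝ) {x : ExtPhase}
    (hx : x ∈ collisionFree) :
    regHam m h x = tau x.2.1 * (threeBodyHam m (bodyState m x) - h) := by
  rw [regHam_eq_sphHam hm h hx.1.1 hx.2, bodyState_eq, sphHam_eq_threeBodyHam hm (x := leviCivita x)
    hx.1.1.1 (leviCivita_snd_fst_ne_zero hx.1.1) hx.1.2.2]
  rw [ip_leviCivita hx.2, hx.1.2.1, zero_div]

end BodyState

/-! ### The three-body vector field, translations and boosts -/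

section ThreeBodyField

theorem continuous_relPos : Continuous relPos := by
  refine continuous_pi fun i => ?_
  fin_cases i <;> simp only [relPos] <;> simp <;> fun_prop

theorem contDiff_relPos (i : Fin 3) : ContDiff ℝ ∞ fun y : Phase => relPos y.1 i := by
  fin_cases i <;> simp only [relPos] <;> simp <;> fun_prop

theorem isOpen_threeBodyDomain : IsOpen threeBodyDomain := by
  change IsOpen {x : Phase | ∀ i, relPos x.1 i ≠ 0}
  rw [Set.ofPred_forall]
  exact isOpen_iInter_of_finite fun i =>
    isOpen_ne_fun (contDiff_relPos i).continuous continuous_const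

theorem contDiffOn_threeBodyHam (m : Fin 3 → ℝ) :
    ContDiffOn ℝ ∞ (threeBodyHam m) threeBodyDomain := by
  refine ContDiffOn.sub (ContDiff.contDiffOn ?_) ?_
  · refine ContDiff.sum fun i _ => ContDiff.div_const (ContDiff.norm_sq ℝ ?_) _
    fun_prop
  · refine ContDiffOn.sum fun i _ => contDiffOn_const.div ?_ fun y hy => norm_ne_zero_iff.2 (hy i)
    exact (contDiff_relPos i).contDiffOn.norm ℝ fun y hy => hy i

theorem differentiableAt_threeBodyHam (m : Fin 3 → ℝ) {y : Phase} (hy : y ∈ threeBodyDomain) :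
    DifferentiableAt ℝ (threeBodyHam m) y :=
  ((contDiffOn_threeBodyHam m).contDiffAt (isOpen_threeBodyDomain.mem_nhds hy)).differentiableAt
    (by simp)

theorem fderiv_threeBodyHam_of_curve (m : Fin 3 → ℝ) {y : Phase} (hy : y ∈ threeBodyDomain)
    {g : ℝ → Phase} {w : Phase} {u : ℝ} (hg : HasDerivAt g w 0) (hg0 : g 0 = y)
    (hu : HasDerivAt (fun t => threeBodyHam m (g t)) u 0) :
    fderiv ℝ (threeBodyHam m) y w = u := by
  subst hg0
  exact ((differentiableAt_threeBodyHam m hy).hasFDerivAt.comp_hasDerivAt 0 hg).unique hu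

theorem relPos_add_const (q : Vec3) (c : ℂ) : relPos (fun i => q i + c) = relPos q := by
  funext i
  fin_cases i <;> simp [relPos]

theorem threeBodyHam_translate (m : Fin 3 → ℝ) (y : Phase) (c : ℂ) :
    threeBodyHam m (fun i => y.1 i + c, y.2) = threeBodyHam m y := by
  simp [threeBodyHam, relPos_add_const]

theorem fderiv_threeBodyHam_translation (m : Fin 3 → ℝ) {y : Phase} (hy : y ∈ threeBodyDomain)
    (c : ℂ) : fderiv ℝ (threeBodyHam m) y (fun _ => c, 0) = 0 := by
  refine fderiv_threeBodyHam_of_curve m hy (hasDerivAt_line y _) (by simp) ?_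
  refine (hasDerivAt_const (0 : ℝ) (threeBodyHam m y)).congr_of_eventuallyEq
    (Eventually.of_forall fun t => ?_)
  have : (y + t • ((fun _ => c, 0) : Phase)) = (fun i => y.1 i + t • c, y.2) := by
    refine Prod.ext ?_ ?_ <;> funext i <;> simp
  exact (congrArg (threeBodyHam m) this).trans (threeBodyHam_translate m y _)

/-- A boost changes the kinetic energy to first order by the pairing of c with the total momentum,
which is zero. Boosts and translations span the directions that Ψ does not reach. -/
theorem fderiv_threeBodyHam_boost {m : Fin 3 → ℝ} (hm : ∀ i, 0 < m i) {y : Phase}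
    (hy : y ∈ zeroMomentum) (c : ℂ) :
    fderiv ℝ (threeBodyHam m) y (0, fun i => m i * c) = 0 := by
  refine fderiv_threeBodyHam_of_curve m hy.1 (hasDerivAt_line y _) (by simp) ?_
  have h1 : HasDerivAt (fun t : ℝ => threeBodyHam m y + t ^ 2 * (totalMass m * ‖c‖ ^ 2 / 2)) 0 0 := by
    simpa using (((hasDerivAt_id (0 : ℝ)).fun_pow 2).mul_const
      (totalMass m * ‖c‖ ^ 2 / 2)).const_add (threeBodyHam m y)
  refine h1.congr_of_eventuallyEq (Eventually.of_forall fun t => ?_)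
  have h0 := hy.2
  have h0r := congrArg Complex.re h0
  have h0i := congrArg Complex.im h0
  simp only [Fin.sum_univ_three, Complex.add_re, Complex.add_im, Complex.zero_re,
    Complex.zero_im] at h0r h0i
  have m0 := (hm 0).ne'
  have m1 := (hm 1).ne'
  have m2 := (hm 2).ne'
  simp only [threeBodyHam, kineticAbs, Fin.sum_univ_three, totalMass, Prod.fst_add, Prod.snd_add,
    Prod.smul_fst, Prod.smul_snd, smul_zero, add_zero, Pi.add_apply, Pi.smul_apply,
    Complex.sq_norm, Complex.normSq_apply, Complex.add_re, Complex.add_im,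
    Complex.real_smul, Complex.re_ofReal_mul, Complex.im_ofReal_mul]
  field_simp
  linear_combination (2 * m 0 * m 1 * m 2 * t * c.re) * h0r + (2 * m 0 * m 1 * m 2 * t * c.im) * h0i

/-- The Hamiltonian vector field of the three-body problem. -/
def threeBodyField (m : Fin 3 → ℝ) (y : Phase) : Phase := sharpPhase (fderiv ℝ (threeBodyHam m) y)

theorem isHamiltonianCurve_threeBody_iff {m : Fin 3 → ℝ} {ζ : ℝ → Phase} {I : Set ℝ} :
    IsHamiltonianCurve omegaPhase (threeBodyHam m) threeBodyDomain ζ I ↔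
      IsSol (threeBodyField m) threeBodyDomain ζ I :=
  isHamiltonianCurve_iff_isSol omegaPhase_eq_iff

theorem omegaPhase_threeBodyField (m : Fin 3 → ℝ) (y w : Phase) :
    omegaPhase (threeBodyField m y) w = fderiv ℝ (threeBodyHam m) y w :=
  (omegaPhase_eq_iff _ _).2 rfl w

theorem contDiffOn_threeBodyField (m : Fin 3 → ℝ) :
    ContDiffOn ℝ 1 (threeBodyField m) threeBodyDomain :=
  contDiffOn_hamiltonianField sharpPhase isOpen_threeBodyDomain (contDiffOn_threeBodyHam m)

theorem IsSol.translate {m : Fin 3 → ℝ} {ζ : ℝ → Phase} {I : Set ℝ}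
    (hζ : IsSol (threeBodyField m) threeBodyDomain ζ I) (c : ℂ) :
    IsSol (threeBodyField m) threeBodyDomain (fun t => (fun i => (ζ t).1 i + c, (ζ t).2)) I := by
  have hadd : ∀ y : Phase, ((fun i => y.1 i + c, y.2) : Phase) = y + (fun _ => c, 0) := fun y =>
    Prod.ext rfl (by simp)
  intro t ht
  obtain ⟨h1, h2⟩ := hζ t ht
  refine ⟨fun i => by rw [relPos_add_const]; exact h1 i, ?_⟩
  simp only [hadd]
  have : threeBodyField m (ζ t + (fun _ => c, 0)) = threeBodyField m (ζ t) := by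
    rw [threeBodyField, threeBodyField, ← fderiv_comp_add_right]
    congr 2
    funext y
    rw [← hadd, threeBodyHam_translate]
  rw [this]
  exact h2.add_const _

end ThreeBodyField

/-! ### Ψ maps the regularized field to τ times the three-body field -/

section Push

theorem relPos_bodyPositions {m : Fin 3 → ℝ} (hm : ∀ i, 0 < m i) {x : ExtPhase}
    (hx : ∑ i, x.2.1 i ^ 2 = 0) :
    relPos (bodyPositions m x) = (sphToRel m (leviCivita x)).1 := by
  refine relPos_absPos hm ?_
  rw [sphToRel_eq]
  simp only [Pi.smul_apply, ← Finset.smul_sum]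
  rw [show ∑ i, (leviCivita x).2.1 i = 0 from hx, smul_zero]

theorem relPos_bodyPositions_apply {m : Fin 3 → ℝ} (hm : ∀ i, 0 < m i) {x : ExtPhase}
    (hx : ∑ i, x.2.1 i ^ 2 = 0) (i : Fin 3) :
    relPos (bodyPositions m x) i = ((x.1.1 / massNormZ m x.2.1 : ℝ) : ℂ) * x.2.1 i ^ 2 := by
  rw [relPos_bodyPositions hm hx]
  rfl

theorem relPos_bodyPositions_eq_zero_iff {m : Fin 3 → ℝ} (hm : ∀ i, 0 < m i) {x : ExtPhase}
    (hx : x ∈ constraintSet) (i : Fin 3) : relPos (bodyPositions m x) i = 0 ↔ x.2.1 i = 0 := by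
  have h1 := massNormZ_pos hm hx.1.2
  have h2 := hx.1.1
  rw [relPos_bodyPositions_apply hm hx.2.2, mul_eq_zero, Complex.ofReal_eq_zero,
    or_iff_right (by positivity), pow_eq_zero_iff two_ne_zero]

theorem bodyState_mem_zeroMomentum {m : Fin 3 → ℝ} (hm : ∀ i, 0 < m i) {x : ExtPhase}
    (hx : x ∈ collisionFree) : bodyState m x ∈ zeroMomentum :=
  ⟨fun i => fun h => hx.2 i ((relPos_bodyPositions_eq_zero_iff hm hx.1 i).1 h), sum_absMom _⟩

/-- The differential of `bodyState` maps the tangent space of the constraint set onto the reduced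
tangent space. -/
theorem exists_dBodyState_eq {m : Fin 3 → ℝ} (hm : ∀ i, 0 < m i) {x : ExtPhase}
    (hx : x ∈ collisionFree) {y : Phase} (hq : ∑ i, (m i : ℂ) * y.1 i = 0)
    (hp : ∑ i, y.2 i = 0) :
    ∃ w, fderiv ℝ constraint x w = 0 ∧ dBodyState m x w = y := by
  obtain ⟨P, hP⟩ := exists_absMom_eq hp
  have hX := leviCivita_snd_fst_ne_zero hx.1.1
  have hM := massNorm_pos hm hX
  have hr : 0 < x.1.1 := hx.1.1.1
  set X := (leviCivita x).2.1 with hXdef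
  set Y := (leviCivita x).2.2 with hYdef
  set M := massNorm m X with hMdef
  -- The variation of r is chosen to keep r/|X| constant, so that Q varies by r/|X| times `Xw`. The
  -- variation `μw` of p_r/|X| is fixed by tangency to Re ⟨Y, X⟩ = 0, and `Yw` then by the
  -- prescribed variation of P; `zw` and the η-part invert the Levi-Civita differential.
  let Xw : Vec3 := (M / x.1.1) • relPos y.1
  let e : ℝ := ip (massDual m X) Xw
  let μ : ℝ := x.1.2 / M
  let μw : ℝ := (ip P X - μ * e + ip Y Xw * M / x.1.1) / M ^ 2
  let Yw : Vec3 := (x.1.1 / M) • (P - μw • massDual m X - μ • massDual m Xw)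
  let zw : Vec3 := fun i => Xw i / (2 * x.2.1 i)
  let w : ExtPhase := ((x.1.1 * e / M ^ 2, M * μw + x.1.2 * e / M ^ 2), (zw, fun i =>
    2 * conj (x.2.1 i) * (Yw i + x.2.2 i * conj (zw i) / (2 * conj (x.2.1 i) ^ 2))))
  have hw : dLeviCivita x w = (w.1, (Xw, Yw)) := by
    refine Prod.ext rfl (Prod.ext ?_ ?_) <;> funext i <;> have h1 := hx.2 i <;>
      have h2 : conj (x.2.1 i) ≠ 0 := by simpa using h1
    · simp only [dLeviCivita, w, zw]
      field_simp
    · simp only [dLeviCivita, w]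
      field_simp
      ring
  have hXws : ∑ i, Xw i = 0 := by
    simp only [Xw, Pi.smul_apply, ← Finset.smul_sum, sum_relPos, smul_zero]
  refine ⟨w, ?_, ?_⟩
  · rw [fderiv_constraint]
    refine Prod.ext ?_ ?_
    · have h1 := ip_dLeviCivita hx.2 w
      have h2 : ip (dLeviCivita x w).2.2 X + ip Y (dLeviCivita x w).2.1 = 0 := by
        rw [hw]
        simp only [Yw, ip_smul_left, ip_sub_left, ip_massDual_self hm, μw,
          ip_massDual_comm m Xw X, show ip (massDual m X) Xw = e from rfl, ← hMdef]
        field_simp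
        ring
      rw [h2] at h1
      simp only [Prod.fst_zero]
      linarith
    · have : ∑ i, (dLeviCivita x w).2.1 i = 0 := by rw [hw]; exact hXws
      exact this
  · have hd : dSphToRel m (leviCivita x) (dLeviCivita x w) = (relPos y.1, P) := by
      rw [hw]
      refine Prod.ext ?_ ?_
      · simp only [dSphToRel, ← hXdef, ← hMdef, show (leviCivita x).1 = x.1 from rfl, w]
        rw [show ip (massDual m X) Xw = e from rfl,
          show x.1.1 * e / M ^ 2 / M - x.1.1 * e / M ^ 3 = 0 by field_simp; ring]
        simp only [Xw, zero_smul, zero_add, smul_smul]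
        rw [show x.1.1 / M * (M / x.1.1) = 1 by field_simp, one_smul]
      · simp only [dSphToRel, ← hXdef, ← hYdef, ← hMdef, show (leviCivita x).1 = x.1 from rfl, w]
        rw [show ip (massDual m X) Xw = e from rfl,
          show (M * μw + x.1.2 * e / M ^ 2) / M - x.1.2 * e / M ^ 3 = μw by field_simp; ring,
          show e / M / x.1.1 - M * (x.1.1 * e / M ^ 2) / x.1.1 ^ 2 = 0 by field_simp; ring,
          zero_smul, zero_add, smul_smul, show M / x.1.1 * (x.1.1 / M) = 1 by field_simp, one_smul]
        simp only [μ]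
        abel
    rw [dBodyState, hd, absState_apply, absPos_relPos hm hq, hP]

/-- The Hamiltonians agree only on the constraint set, but that determines the differential on
tangent vectors. The term with dτ disappears because H = h. -/
theorem fderiv_regHam_tangent {m : Fin 3 → ℝ} (hm : ∀ i, 0 < m i) {h : ℝ} {x : ExtPhase}
    (hx : x ∈ collisionFree) (h0 : regHam m h x = 0) {w : ExtPhase}
    (hw : fderiv ℝ constraint x w = 0) : fderiv ℝ (regHam m h) x w =
      tau x.2.1 * fderiv ℝ (threeBodyHam m) (bodyState m x) (dBodyState m x w) := by
  have hτ := tau_pos hx.2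
  have hreg := collisionFree_subset hx
  have hdom := (bodyState_mem_zeroMomentum hm hx).1
  have hE : threeBodyHam m (bodyState m x) - h = 0 := by
    have := regHam_eq_threeBodyHam hm h hx
    rw [h0] at this
    exact (mul_eq_zero.1 this.symm).resolve_left hτ.ne'
  let φ : ExtPhase → ℝ := fun x' =>
    regHam m h x' - tau x'.2.1 * (threeBodyHam m (bodyState m x') - h)
  have hsub : regularDomain ∈ 𝓝 x := isOpen_regularDomain.mem_nhds hreg
  have hb := (contDiffOn_bodyState hm).contDiffAt hsub
  have hc1 : ContDiffAt ℝ ∞ (fun x' : ExtPhase => threeBodyHam m (bodyState m x')) x :=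
    ((contDiffOn_threeBodyHam m).contDiffAt (isOpen_threeBodyDomain.mem_nhds hdom)).comp x hb
  have hc2 := contDiffOn_tau.contDiffAt (isOpen_extDomain.mem_nhds hx.1.1)
  have hφ : ContDiffAt ℝ ∞ φ x :=
    ((contDiffOn_regHam hm h).contDiffAt (isOpen_extDomain.mem_nhds hx.1.1)).sub
      (hc2.mul (hc1.sub contDiffAt_const))
  have hcx : constraint x = 0 := by
    have := hx.1
    rw [isSubmanifold_constraintSet.2.1] at this
    exact this.2
  -- The difference `φ` vanishes on the constraint set near `x`, so `x` is trivially a constrained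
  -- extremum; Lagrange multipliers then show that its differential kills tangent vectors. The
  -- multiplier `Λ₀` is non-zero since the constraint differential is onto.
  have hext : IsLocalExtrOn φ {x' | constraint x' = constraint x} x := by
    refine Or.inl ?_
    have hφ0 : ∀ x' ∈ regularDomain, constraint x' = 0 → φ x' = 0 := by
      intro x' h1 h2
      have : x' ∈ collisionFree := by
        refine ⟨?_, h1.2⟩
        rw [isSubmanifold_constraintSet.2.1]
        exact ⟨h1.1, h2⟩
      exact sub_eq_zero.2 (regHam_eq_threeBodyHam hm h this)
    filter_upwards [mem_nhdsWithin_of_mem_nhds hsub, self_mem_nhdsWithin] with x' h1 h2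
    rw [hφ0 x' h1 (h2.trans hcx), hφ0 x hreg hcx]
  obtain ⟨Λ, Λ₀, hne, hΛ⟩ := hext.exists_linear_map_of_hasStrictFDerivAt
    (contDiff_constraint.contDiffAt.hasStrictFDerivAt (by simp))
    (hφ.hasStrictFDerivAt (by simp))
  have hΛ₀ : Λ₀ ≠ 0 := by
    rintro rfl
    refine hne (Prod.ext (LinearMap.ext fun b => ?_) rfl)
    obtain ⟨v, rfl⟩ := isSubmanifold_constraintSet.2.2.2 x hx.1 b
    simpa using hΛ v
  have hφw : fderiv ℝ φ x w = 0 := by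
    have := hΛ w
    rw [hw, map_zero, zero_add, smul_eq_mul] at this
    exact (mul_eq_zero.1 this).resolve_left hΛ₀
  have hd : HasFDerivAt φ (fderiv ℝ (regHam m h) x -
      (tau x.2.1 • ((fderiv ℝ (threeBodyHam m) (bodyState m x)).comp (fderiv ℝ (bodyState m) x)) +
        (threeBodyHam m (bodyState m x) - h) •
          fderiv ℝ (fun x : ExtPhase => tau x.2.1) x)) x :=
    (hasFDerivAt_regHam hm h hx.1.1).sub ((hc2.differentiableAt (by simp)).hasFDerivAt.mul
      (((differentiableAt_threeBodyHam m hdom).hasFDerivAt.comp x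
        (hasFDerivAt_bodyState hm hreg)).sub_const h))
  rw [hd.fderiv, hE] at hφw
  simp only [zero_smul, add_zero, _root_.sub_apply, _root_.smul_apply,
    ContinuousLinearMap.comp_apply, fderiv_bodyState hm hreg, smul_eq_mul] at hφw
  linarith

/-- On the zero level, `bodyState` maps the regularized field to `τ` times the three-body field. -/
theorem dBodyState_regField {m : Fin 3 → ℝ} (hm : ∀ i, 0 < m i) {h : ℝ} {x : ExtPhase}
    (hx : x ∈ collisionFree) (h0 : regHam m h x = 0) :
    dBodyState m x (regField m h x) = tau x.2.1 • threeBodyField m (bodyState m x) := by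
  have hz := bodyState_mem_zeroMomentum hm hx
  have hmass := totalMass_pos hm
  have hmass' : (totalMass m : ℂ) ≠ 0 := Complex.ofReal_ne_zero.2 hmass.ne'
  have hs : (totalMass m : ℂ) = m 0 + m 1 + m 2 := by simp [totalMass, Fin.sum_univ_three]
  set u := dBodyState m x (regField m h x) with hu
  have hu1 : ∑ i, (m i : ℂ) * u.1 i = 0 := by
    rw [hu, dBodyState, absState_apply]
    exact sum_mul_absPos _ _
  have hu2 : ∑ i, u.2 i = 0 := by
    rw [hu, dBodyState, absState_apply]
    exact sum_absMom _
  -- A test vector splits into one with zero total momentum and centre of mass, a translation and a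
  -- boost. The first is the image of a tangent vector, where symplecticity applies; on the other
  -- two both sides vanish.
  have key : ∀ w, omegaPhase u w = (tau x.2.1 • fderiv ℝ (threeBodyHam m) (bodyState m x)) w := by
    intro w
    let σ : ℂ := (∑ i, (m i : ℂ) * w.1 i) / totalMass m
    let π : ℂ := (∑ i, w.2 i) / totalMass m
    let w₀ : Phase := (fun i => w.1 i - σ, fun i => w.2 i - m i * π)
    have hw : w = w₀ + ((fun _ => σ, 0) + (0, fun i => m i * π)) := by
      refine Prod.ext ?_ ?_ <;> funext i <;> simp [w₀]
    have h1 : ∑ i, (m i : ℂ) * w₀.1 i = 0 := by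
      simp only [w₀, mul_sub, Finset.sum_sub_distrib, ← Finset.sum_mul, σ]
      rw [show ∑ i, (m i : ℂ) = totalMass m by simp [totalMass], mul_div_cancel₀ _ hmass', sub_self]
    have h2 : ∑ i, w₀.2 i = 0 := by
      simp only [w₀, Finset.sum_sub_distrib, ← Finset.sum_mul, π]
      rw [show ∑ i, (m i : ℂ) = totalMass m by simp [totalMass], mul_div_cancel₀ _ hmass', sub_self]
    obtain ⟨w', hw'1, hw'2⟩ := exists_dBodyState_eq hm hx h1 h2
    have e1 : omegaPhase u w₀ = tau x.2.1 * fderiv ℝ (threeBodyHam m) (bodyState m x) w₀ := by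
      rw [← hw'2, hu, omegaPhase_dBodyState hm hx (fderiv_constraint_regField hm h hx.1.1) hw'1,
        omegaExt_regField, fderiv_regHam_tangent hm hx h0 hw'1]
    have e2 : omegaPhase u (fun _ => σ, 0) = 0 := by
      have : pairing u.2 (fun _ => σ) = conj (∑ i, u.2 i) * σ := by
        rw [pairing, map_sum, Finset.sum_mul]
      simp only [omegaPhase, this, hu2]
      simp [pairing]
    have e3 : omegaPhase u (0, fun i => m i * π) = 0 := by
      have : pairing (fun i => (m i : ℂ) * π) u.1 = conj π * ∑ i, (m i : ℂ) * u.1 i := by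
        rw [pairing, Finset.mul_sum]
        exact Finset.sum_congr rfl fun i _ => by simp; ring
      simp only [omegaPhase, this, hu1]
      simp [pairing]
    have hadd : ∀ a b, omegaPhase u (a + b) = omegaPhase u a + omegaPhase u b := by
      intro a b
      simp only [omegaPhase_eq, Prod.fst_add, Prod.snd_add, ip_add_left, ip_add_right]
      ring
    conv_lhs => rw [hw]
    conv_rhs => rw [hw]
    rw [hadd, hadd, e1, e2, e3, map_add, map_add]
    simp [fderiv_threeBodyHam_translation m hz.1, fderiv_threeBodyHam_boost hm hz]
  rw [(omegaPhase_eq_iff _ _).1 key, map_smul]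
  rfl

end Push

/-! ### Fibres of Ψ and a section of the symmetry quotient -/

section Fibre

/-- `x` and `y` are related by sign changes, a scaling and a translation of `η`. -/
def GaugeRel (x y : ExtPhase) : Prop :=
  ∃ (a : Fin 3 → ℝ) (k : ℝ) (c : ℂ), 0 < k ∧ (∀ i, |a i| = k) ∧ y = gaugeAct a c x

theorem GaugeRel.trans {x y z : ExtPhase} (h₁ : GaugeRel x y) (h₂ : GaugeRel y z) :
    GaugeRel x z := by
  obtain ⟨a, k, c, hk, ha, rfl⟩ := h₁
  obtain ⟨b, l, d, hl, hb, rfl⟩ := h₂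
  have hb0 : ∀ i, (b i : ℂ) ≠ 0 := fun i =>
    Complex.ofReal_ne_zero.2 (abs_pos.1 ((hb i).symm ▸ hl))
  have ha0 : ∀ i, (a i : ℂ) ≠ 0 := fun i =>
    Complex.ofReal_ne_zero.2 (abs_pos.1 ((ha i).symm ▸ hk))
  have hsq : ∀ i, (b i : ℂ) ^ 2 = (l : ℂ) ^ 2 := fun i => by
    rw [← Complex.ofReal_pow, ← Complex.ofReal_pow, ← sq_abs, hb i]
  refine ⟨fun i => b i * a i, l * k, c / (l : ℂ) ^ 2 + d, mul_pos hl hk,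
    fun i => by rw [abs_mul, hb, ha], ?_⟩
  refine Prod.ext rfl (Prod.ext ?_ ?_) <;> funext i <;> have h1 := hb0 i <;> have h2 := ha0 i
  · simp [gaugeAct]
    ring
  · simp only [gaugeAct, ← hsq i]
    simp
    field_simp
    ring

theorem GaugeRel.symm {x y : ExtPhase} (h : GaugeRel x y) : GaugeRel y x := by
  obtain ⟨a, k, c, hk, ha, rfl⟩ := h
  have ha0 : ∀ i, (a i : ℂ) ≠ 0 := fun i =>
    Complex.ofReal_ne_zero.2 (abs_pos.1 ((ha i).symm ▸ hk))
  have hsq : ∀ i, (a i : ℂ) ^ 2 = (k : ℂ) ^ 2 := fun i => by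
    rw [← Complex.ofReal_pow, ← Complex.ofReal_pow, ← sq_abs, ha i]
  refine ⟨fun i => (a i)⁻¹, k⁻¹, -(c * (k : ℂ) ^ 2), inv_pos.2 hk,
    fun i => by rw [abs_inv, ha], ?_⟩
  refine Prod.ext rfl (Prod.ext ?_ ?_) <;> funext i <;> have h2 := ha0 i
  · simp [gaugeAct]
    field_simp
  · simp only [gaugeAct, ← hsq i]
    simp
    field_simp
    ring

theorem gaugeRel_of_setoid {x y : ExtPhase} (h : symmetrySetoid x y) : GaugeRel x y := by
  obtain ⟨k, hk, c, rfl⟩ := h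
  exact ⟨fun _ => k, k, c, hk, fun _ => abs_of_pos hk, shiftAct_scaleAct k c x⟩

theorem gaugeAct_mem_collisionFree {a : Fin 3 → ℝ} {k : ℝ} (hk : 0 < k) (ha : ∀ i, |a i| = k)
    (c : ℂ) {x : ExtPhase} (hx : x ∈ collisionFree) : gaugeAct a c x ∈ collisionFree :=
  ⟨gaugeAct_mem_constraintSet hk ha c hx.1, fun i => mul_ne_zero
    (Complex.ofReal_ne_zero.2 (abs_pos.1 ((ha i).symm ▸ hk))) (hx.2 i)⟩

theorem absMom_add_const (P : Vec3) (d : ℂ) : absMom (fun i => P i + d) = absMom P := by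
  funext i
  fin_cases i <;> simp [absMom]

theorem exists_eq_add_const {P P' : Vec3} (h : absMom P = absMom P') :
    ∃ d : ℂ, P = fun i => P' i + d := by
  have h0 := congrFun h 0
  have h1 := congrFun h 1
  simp [absMom] at h0 h1
  refine ⟨P 0 - P' 0, ?_⟩
  funext i
  fin_cases i
  · simp
  · simp
    linear_combination -h0
  · simp
    linear_combination h1

/-- Signs disappear in the squares and the scale cancels in X/|X| and |X|Y. The shift adds c to
every component of Y, hence one constant to all P_ij, which their differences ignore. -/
theorem bodyState_gaugeAct {a : Fin 3 → ℝ} {k : ℝ} (hk : 0 < k) (ha : ∀ i, |a i| = k)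
    (c : ℂ) {m : Fin 3 → ℝ} (hm : ∀ i, 0 < m i) {x : ExtPhase} (hx : x ∈ collisionFree) :
    bodyState m (gaugeAct a c x) = bodyState m x := by
  have ha0 : ∀ i, (a i : ℂ) ≠ 0 := fun i =>
    Complex.ofReal_ne_zero.2 (abs_pos.1 ((ha i).symm ▸ hk))
  have hsq : ∀ i, (a i : ℂ) ^ 2 = (k : ℂ) ^ 2 := fun i => by
    rw [← Complex.ofReal_pow, ← Complex.ofReal_pow, ← sq_abs, ha i]
  have hkc : (k : ℂ) ≠ 0 := Complex.ofReal_ne_zero.2 hk.ne'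
  have hM := massNormZ_pos hm hx.1.1.2
  have hr : 0 < x.1.1 := hx.1.1.1
  have hMc : (massNormZ m x.2.1 : ℂ) ≠ 0 := Complex.ofReal_ne_zero.2 hM.ne'
  have hrc : (x.1.1 : ℂ) ≠ 0 := Complex.ofReal_ne_zero.2 hr.ne'
  have h1 : massNorm m (leviCivita (gaugeAct a c x)).2.1 = k ^ 2 * massNormZ m x.2.1 :=
    massNormZ_gaugeAct ha m c x
  have h2 : massNorm m (leviCivita x).2.1 = massNormZ m x.2.1 := rfl
  have hz : ∀ i, (leviCivita (gaugeAct a c x)).2.1 i = (k : ℂ) ^ 2 * x.2.1 i ^ 2 := fun i => by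
    rw [← hsq i]
    simp [leviCivita, gaugeAct, mul_pow]
  have e1 : (sphToRel m (leviCivita (gaugeAct a c x))).1 = (sphToRel m (leviCivita x)).1 := by
    funext i
    simp only [sphToRel, h1, h2, hz, show (leviCivita (gaugeAct a c x)).1 = x.1 from rfl,
      show (leviCivita x).1 = x.1 from rfl]
    push_cast
    simp only [leviCivita]
    field_simp
  have e2 : (sphToRel m (leviCivita (gaugeAct a c x))).2 = fun i =>
      (sphToRel m (leviCivita x)).2 i + c * k ^ 2 * massNormZ m x.2.1 / x.1.1 := by
    funext i
    have hi : conj (x.2.1 i) ≠ 0 := by simpa using hx.2 i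
    have hai := ha0 i
    have hY : (leviCivita (gaugeAct a c x)).2.2 i = (leviCivita x).2.2 i / (k : ℂ) ^ 2 + c := by
      rw [← hsq i]
      simp [leviCivita, gaugeAct]
      field_simp
    simp only [sphToRel, h1, h2, hz, hY, massDual,
      show (leviCivita (gaugeAct a c x)).1 = x.1 from rfl,
      show (leviCivita x).1 = x.1 from rfl]
    push_cast
    simp only [leviCivita]
    field_simp
    ring
  rw [bodyState_eq, bodyState_eq, absState_apply, absState_apply, e1, e2, absMom_add_const]

/-- The point over the relative state `(z², P)`, up to a constant in `P`, with `r = |z²|`. -/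
def liftPoint (m : Fin 3 → ℝ) (y : Phase) : ExtPhase :=
  let X : Vec3 := fun i => y.1 i ^ 2
  let M := massNorm m X
  ((M, ip y.2 X / M), (y.1, fun i =>
    2 * conj (y.1 i) * (y.2 i - ((ip y.2 X / M / M : ℝ) : ℂ) * massDual m X i)))

theorem liftPoint_mem {m : Fin 3 → ℝ} (hm : ∀ i, 0 < m i) {z P : Vec3} (hz : ∀ i, z i ≠ 0)
    (hs : ∑ i, z i ^ 2 = 0) : liftPoint m (z, P) ∈ collisionFree ∧
      sphToRel m (leviCivita (liftPoint m (z, P))) = (fun i => z i ^ 2, P) := by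
  have hz0 : z ≠ 0 := Function.ne_iff.2 ⟨0, hz 0⟩
  set X : Vec3 := fun i => z i ^ 2 with hX
  have hM : 0 < massNorm m X := massNormZ_pos hm hz0
  set M := massNorm m X with hMd
  have hMc : (M : ℂ) ≠ 0 := Complex.ofReal_ne_zero.2 hM.ne'
  have hlc : leviCivita (liftPoint m (z, P)) =
      ((M, ip P X / M), (X, P - (ip P X / M / M) • massDual m X)) := by
    refine Prod.ext rfl (Prod.ext rfl ?_)
    funext i
    have hi : conj (z i) ≠ 0 := by simpa using hz i
    simp only [leviCivita, liftPoint, Pi.sub_apply, Pi.smul_apply, Complex.real_smul]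
    field_simp
    rfl
  refine ⟨⟨⟨⟨hM, hz0⟩, ?_, hs⟩, hz⟩, ?_⟩
  · have h1 := ip_leviCivita (x := liftPoint m (z, P)) hz
    rw [hlc] at h1
    simp only [ip_sub_left, ip_smul_left, ip_massDual_self hm, ← hMd] at h1
    have : ip P X - ip P X / M / M * M ^ 2 = 0 := by field_simp; ring
    linarith
  · rw [hlc, sphToRel_eq]
    simp only [← hMd, div_self hM.ne', one_smul]
    simp

theorem bodyState_liftPoint {m : Fin 3 → ℝ} (hm : ∀ i, 0 < m i) {z P : Vec3} (hz : ∀ i, z i ≠ 0)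
    (hs : ∑ i, z i ^ 2 = 0) :
    bodyState m (liftPoint m (z, P)) = (absPos m (fun i => z i ^ 2), absMom P) := by
  rw [bodyState_eq, (liftPoint_mem hm hz hs).2, absState_apply]

/-- The scaled representative of `z` with `z² = Q`. -/
def normalizedZ (m : Fin 3 → ℝ) (x : ExtPhase) : Vec3 :=
  fun i => ((Real.sqrt (x.1.1 / massNormZ m x.2.1) : ℝ) : ℂ) * x.2.1 i

theorem normalizedZ_sq {m : Fin 3 → ℝ} (hm : ∀ i, 0 < m i) {x : ExtPhase} (hx : x ∈ extDomain)
    (i : Fin 3) : normalizedZ m x i ^ 2 = (sphToRel m (leviCivita x)).1 i := by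
  have hM := massNormZ_pos hm hx.2
  have hr : 0 < x.1.1 := hx.1
  rw [normalizedZ, mul_pow, ← Complex.ofReal_pow, Real.sq_sqrt (by positivity)]
  rfl

theorem normalizedZ_ne_zero {m : Fin 3 → ℝ} (hm : ∀ i, 0 < m i) {x : ExtPhase}
    (hx : x ∈ collisionFree) (i : Fin 3) : normalizedZ m x i ≠ 0 := by
  have hM := massNormZ_pos hm hx.1.1.2
  have hr : 0 < x.1.1 := hx.1.1.1
  exact mul_ne_zero (Complex.ofReal_ne_zero.2 (Real.sqrt_pos.2 (by positivity)).ne') (hx.2 i)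

theorem sum_normalizedZ_sq {m : Fin 3 → ℝ} {x : ExtPhase}
    (hx : x ∈ constraintSet) : ∑ i, normalizedZ m x i ^ 2 = 0 := by
  simp only [normalizedZ, mul_pow, ← Finset.mul_sum, hx.2.2, mul_zero]

/-- Each orbit meets the normal form |X| = r after one scaling, and the constant by which two
choices of P differ is absorbed by a shift. Orbits are thus determined by the normalized z and the
momenta. -/
theorem symmetrySetoid_liftPoint {m : Fin 3 → ℝ} (hm : ∀ i, 0 < m i) {x : ExtPhase}
    (hx : x ∈ collisionFree) {P : Vec3} (hP : absMom P = (bodyState m x).2) :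
    symmetrySetoid x (liftPoint m (normalizedZ m x, P)) := by
  have hM := massNormZ_pos hm hx.1.1.2
  have hr : 0 < x.1.1 := hx.1.1.1
  obtain ⟨d, hd⟩ := exists_eq_add_const hP
  set k := Real.sqrt (x.1.1 / massNormZ m x.2.1) with hk
  set M := massNormZ m x.2.1 with hMd
  have hk0 : 0 < k := Real.sqrt_pos.2 (by positivity)
  have hk2 : k ^ 2 = x.1.1 / M := Real.sq_sqrt (by positivity)
  have hX : (fun i => normalizedZ m x i ^ 2) = (k ^ 2) • (leviCivita x).2.1 := by
    funext i
    simp [normalizedZ, leviCivita, mul_pow, ← hk, ← hMd]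
  have hMX : massNorm m (leviCivita x).2.1 = M := rfl
  have hMr : massNorm m (fun i => normalizedZ m x i ^ 2) = x.1.1 := by
    have : massNormZ m (gaugeAct (fun _ => k) 0 x).2.1 = k ^ 2 * M :=
      massNormZ_gaugeAct (fun _ => abs_of_pos hk0) m 0 x
    rw [hk2, div_mul_cancel₀ _ hM.ne'] at this
    exact this
  have hP' : P = (x.1.2 / M) • massDual m (leviCivita x).2.1 + (M / x.1.1) • (leviCivita x).2.2
      + fun _ => d := by
    rw [hd, sphToRel_eq]
    rfl
  -- Constants are orthogonal to X because its components sum to zero, so the choice of P does not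
  -- affect p_r.
  have hone : ip (fun _ => d) (leviCivita x).2.1 = 0 := by
    have : pairing (fun _ => d) (leviCivita x).2.1 = conj d * ∑ i, (leviCivita x).2.1 i := by
      rw [pairing, Finset.mul_sum]
    rw [ip, this, show ∑ i, (leviCivita x).2.1 i = 0 from hx.1.2.2]
    simp
  have hpr : ip P (fun i => normalizedZ m x i ^ 2) = x.1.2 * x.1.1 := by
    rw [hX, hP', ip_smul_right, ip_add_left, ip_add_left, ip_smul_left, ip_smul_left,
      ip_massDual_self hm, hone, ip_leviCivita hx.2, hx.1.2.1, hMX, hk2]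
    field_simp
    ring
  refine ⟨k, hk0, d, ?_⟩
  rw [shiftAct_scaleAct]
  refine Prod.ext (Prod.ext ?_ ?_) (Prod.ext ?_ ?_)
  · simp [liftPoint, gaugeAct, hMr]
  · simp only [liftPoint, gaugeAct, hMr, hpr]
    field_simp
  · rfl
  · funext i
    have hi : conj (x.2.1 i) ≠ 0 := by simpa using hx.2 i
    have hMc : (M : ℂ) ≠ 0 := Complex.ofReal_ne_zero.2 hM.ne'
    have hrc : (x.1.1 : ℂ) ≠ 0 := Complex.ofReal_ne_zero.2 hr.ne'
    have hkc : (k : ℂ) ≠ 0 := Complex.ofReal_ne_zero.2 hk0.ne'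
    have hkc2 : (k : ℂ) ^ 2 = x.1.1 / M := by
      rw [← Complex.ofReal_pow, hk2, Complex.ofReal_div]
    simp only [liftPoint, hMr, hpr]
    rw [hX, massDual_smul, hP', show x.1.2 * x.1.1 / x.1.1 / x.1.1 = x.1.2 / x.1.1 by field_simp]
    simp only [Pi.add_apply, Pi.smul_apply, Complex.real_smul, gaugeAct, normalizedZ, ← hk, ← hMd,
      map_mul, Complex.conj_ofReal]
    push_cast
    rw [hkc2]
    have : (leviCivita x).2.2 i = x.2.2 i / (2 * conj (x.2.1 i)) := rfl
    rw [this]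
    field_simp
    have hkc3 : (k : ℂ) ^ 2 * M = x.1.1 := by rw [hkc2, div_mul_cancel₀ _ hMc]
    linear_combination ((M : ℂ) * x.2.2 i) * hkc3

/-- Equal relative positions leave only the sign of each square root free, and equal momenta allow
the same P to be used in both normal forms. -/
theorem gaugeRel_of_bodyState {m : Fin 3 → ℝ} (hm : ∀ i, 0 < m i) {x y : ExtPhase}
    (hx : x ∈ collisionFree) (hy : y ∈ collisionFree)
    (h : translationSetoid (bodyState m x) (bodyState m y)) : GaugeRel x y := by
  obtain ⟨c, hc⟩ := h
  set P := (sphToRel m (leviCivita x)).2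
  have h1 := gaugeRel_of_setoid (symmetrySetoid_liftPoint hm hx (P := P) rfl)
  have h2 := gaugeRel_of_setoid (symmetrySetoid_liftPoint hm hy (P := P) (by rw [hc]; rfl))
  refine h1.trans (GaugeRel.trans ?_ h2.symm)
  have hQ : ∀ i, normalizedZ m y i ^ 2 = normalizedZ m x i ^ 2 := by
    intro i
    rw [normalizedZ_sq hm hx.1.1, normalizedZ_sq hm hy.1.1, ← relPos_bodyPositions hm hx.1.2.2,
      ← relPos_bodyPositions hm hy.1.2.2, show bodyPositions m y = (bodyState m y).1 from rfl, hc,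
      relPos_add_const]
    rfl
  have hε : ∀ i, ∃ e : ℝ, |e| = 1 ∧ normalizedZ m y i = e * normalizedZ m x i := by
    intro i
    rcases sq_eq_sq_iff_eq_or_eq_neg.1 (hQ i) with h | h
    · exact ⟨1, by simp, by simp [h]⟩
    · exact ⟨-1, by simp, by simp [h]⟩
  choose e he1 he2 using hε
  refine ⟨e, 1, 0, one_pos, he1, ?_⟩
  have hX : (fun i => normalizedZ m y i ^ 2) = fun i => normalizedZ m x i ^ 2 := funext hQ
  refine Prod.ext ?_ (Prod.ext ?_ ?_)
  · simp only [liftPoint, hX]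
    rfl
  · exact funext he2
  · funext i
    have hei : (e i : ℂ) ^ 2 = 1 := by
      rw [← Complex.ofReal_pow, ← sq_abs, he1 i]
      simp
    have hei0 : (e i : ℂ) ≠ 0 := fun h => by simp [h] at hei
    simp only [liftPoint, hX, gaugeAct]
    simp only [he2, map_mul, Complex.conj_ofReal]
    field_simp
    rw [hei]
    ring

end Fibre

/-! ### The eight-sheeted covering -/

section Covering

/-- Componentwise squaring of `z`. -/
def squareHom : (Fin 3 → ℂˣ) × Multiplicative Vec3 →* (Fin 3 → ℂˣ) × Multiplicative Vec3 :=
  (powMonoidHom 2).prodMap (MonoidHom.id _)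

theorem squareHom_apply (y : (Fin 3 → ℂˣ) × Multiplicative Vec3) :
    squareHom y = (y.1 ^ 2, y.2) := rfl

/-- Sign changes of the components of `z`. -/
def flipSigns (b : Fin 3 → Bool) (z : Fin 3 → ℂˣ) : Fin 3 → ℂˣ :=
  fun i => if b i then z i else -z i

theorem units_ne_neg (z : ℂˣ) : z ≠ -z := by
  intro h
  have : (z : ℂ) = -z := by simpa using congrArg Units.val h
  exact z.ne_zero (self_eq_neg.1 this)

theorem flipSigns_injective (z : Fin 3 → ℂˣ) : Function.Injective fun b => flipSigns b z := by
  intro b c h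
  funext i
  have hi : flipSigns b z i = flipSigns c z i := congrFun h i
  simp only [flipSigns] at hi
  have hne := units_ne_neg (z i)
  cases hb : b i <;> cases hc : c i <;> simp_all

theorem sq_eq_sq_iff_flipSigns (z w : Fin 3 → ℂˣ) :
    z ^ 2 = w ^ 2 ↔ ∃ b, z = flipSigns b w := by
  constructor
  · intro h
    have : ∀ i, ∃ b : Bool, z i = if b then w i else -w i := by
      intro i
      have hi : (z i : ℂ) ^ 2 = (w i : ℂ) ^ 2 := by
        simpa using congrArg Units.val (congrFun h i)
      rcases sq_eq_sq_iff_eq_or_eq_neg.1 hi with h | h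
      · exact ⟨true, by simpa using Units.ext h⟩
      · exact ⟨false, by simpa using Units.ext (by simpa using h)⟩
    choose b hb using this
    exact ⟨b, funext hb⟩
  · rintro ⟨b, rfl⟩
    funext i
    by_cases h : b i <;> simp [flipSigns, h]

/-- An open surjective homomorphism with finite, hence discrete, kernel is a covering. The momentum
factor is written multiplicatively so that the whole map is a homomorphism. -/
theorem isCoveringMap_squareHom : IsCoveringMap squareHom := by
  have h2 : IsOpenQuotientMap fun z : ℂˣ => z ^ 2 :=
    (Complex.isQuotientCoveringMap_npow 2).isOpenQuotientMap
  have hq : IsOpenQuotientMap squareHom :=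
    (IsOpenQuotientMap.piMap fun _ : Fin 3 => h2).prodMap IsOpenQuotientMap.id
  refine (hq.isQuotientMap.isQuotientCoveringMap_of_isDiscrete_ker_monoidHom
    (Set.Finite.isDiscrete ?_)).isCoveringMap
  refine (Set.finite_range fun b : Fin 3 → Bool => (flipSigns b 1, (1 : Multiplicative Vec3))).subset
    ?_
  rintro ⟨z, p⟩ hz
  have hz' : squareHom (z, p) = 1 := hz
  rw [squareHom_apply, Prod.ext_iff] at hz'
  obtain ⟨b, rfl⟩ := (sq_eq_sq_iff_flipSigns z 1).1 (by simpa using hz'.1)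
  exact ⟨b, Prod.ext rfl hz'.2.symm⟩

/-- Relative positions without collisions together with momenta of sum zero. -/
def relStates : Set ((Fin 3 → ℂˣ) × Multiplicative Vec3) :=
  {y | ∑ i, (y.1 i : ℂ) = 0 ∧ ∑ i, Multiplicative.toAdd y.2 i = 0}

theorem continuous_units_mk0 {α : Type*} [TopologicalSpace α] {f : α → ℂ} (hf : Continuous f)
    (h0 : ∀ a, f a ≠ 0) : Continuous fun a => Units.mk0 (f a) (h0 a) :=
  Units.isEmbedding_val₀.continuous_iff.2 hf

theorem continuous_massNorm (m : Fin 3 → ℝ) : Continuous (massNorm m) := by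
  unfold massNorm
  fun_prop

theorem continuous_absPos (m : Fin 3 → ℝ) : Continuous (absPos m) :=
  (continuous_fst.comp (absState m).continuous).comp (Continuous.prodMk_left (0 : Vec3))

theorem absPos_relPos_eq_add_const {m : Fin 3 → ℝ} (hm : ∀ i, 0 < m i) (q : Vec3) :
    absPos m (relPos q) = fun i => q i + -((∑ j, (m j : ℂ) * q j) / totalMass m) := by
  have hM : (totalMass m : ℂ) ≠ 0 := Complex.ofReal_ne_zero.2 (totalMass_pos hm).ne'
  have hs : (totalMass m : ℂ) = m 0 + m 1 + m 2 := by simp [totalMass, Fin.sum_univ_three]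
  rw [← absPos_relPos hm (q := fun i => q i + -((∑ j, (m j : ℂ) * q j) / totalMass m)),
    relPos_add_const]
  simp only [mul_add, Finset.sum_add_distrib, ← Finset.sum_mul]
  rw [show ∑ i, (m i : ℂ) = totalMass m by simp [totalMass]]
  field_simp
  ring

/-- The reduced three-body phase space in relative coordinates. -/
def reducedHomeo {m : Fin 3 → ℝ} (hm : ∀ i, 0 < m i) : ReducedThreeBody ≃ₜ relStates where
  toFun := Quotient.lift (fun y : zeroMomentum =>
    (⟨(fun i => Units.mk0 (relPos y.1.1 i) (y.2.1 i), Multiplicative.ofAdd y.1.2),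
      sum_relPos _, y.2.2⟩ : relStates)) <| by
    rintro ⟨y, hy⟩ ⟨y', hy'⟩ ⟨c, hc⟩
    obtain rfl : y' = _ := hc
    refine Subtype.ext (Prod.ext ?_ rfl)
    funext i
    exact Units.ext (congrFun (relPos_add_const y.1 c) i).symm
  invFun := fun y => Quotient.mk _ ⟨(absPos m fun i => (y.1.1 i : ℂ), Multiplicative.toAdd y.1.2),
    fun i => by
      change relPos (absPos m _) i ≠ 0
      rw [relPos_absPos hm y.2.1]
      exact (y.1.1 i).ne_zero, y.2.2⟩
  left_inv := by
    rintro ⟨y, hy⟩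
    refine Quotient.sound ?_
    refine Setoid.symm' _ ?_
    refine ⟨-((∑ j, (m j : ℂ) * y.1 j) / totalMass m), ?_⟩
    exact Prod.ext (absPos_relPos_eq_add_const hm y.1) rfl
  right_inv := by
    rintro ⟨y, hy⟩
    refine Subtype.ext (Prod.ext ?_ rfl)
    funext i
    exact Units.ext (congrFun (relPos_absPos hm hy.1) i)
  continuous_toFun := by
    refine Continuous.quotient_lift ?_ _
    refine Continuous.subtype_mk (Continuous.prodMk ?_ ?_) _
    · refine continuous_pi fun i => continuous_units_mk0 ?_ _
      exact (contDiff_relPos i).continuous.comp continuous_subtype_val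
    · exact continuous_ofAdd.comp (continuous_snd.comp continuous_subtype_val)
  continuous_invFun := by
    refine continuous_quotient_mk'.comp (Continuous.subtype_mk (Continuous.prodMk ?_ ?_) _)
    · refine (continuous_absPos m).comp (continuous_pi fun i => ?_)
      exact Units.continuous_val.comp ((continuous_apply i).comp
        (continuous_fst.comp continuous_subtype_val))
    · exact continuous_toAdd.comp (continuous_snd.comp continuous_subtype_val)

theorem normalizedZ_gauge {m : Fin 3 → ℝ} (hm : ∀ i, 0 < m i) {x : ExtPhase}
    (hx : x ∈ extDomain) {k : ℝ} (hk : 0 < k) (c : ℂ) :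
    normalizedZ m (gaugeAct (fun _ => k) c x) = normalizedZ m x := by
  have hM := massNormZ_pos hm hx.2
  have h1 : massNormZ m (gaugeAct (fun _ => k) c x).2.1 = k ^ 2 * massNormZ m x.2.1 :=
    massNormZ_gaugeAct (fun _ => abs_of_pos hk) m c x
  funext i
  rw [normalizedZ, normalizedZ, h1, show (gaugeAct (fun _ => k) c x).1 = x.1 from rfl,
    show (gaugeAct (fun _ => k) c x).2.1 i = (k : ℂ) * x.2.1 i from rfl, ← mul_assoc,
    ← Complex.ofReal_mul]
  congr 2
  rw [mul_comm (k ^ 2), ← div_div, Real.sqrt_div' _ (sq_nonneg k), Real.sqrt_sq hk.le,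
    div_mul_cancel₀ _ hk.ne']

/-- The relative momentum vector with vanishing last component. -/
def relMom (p : Vec3) : Vec3 := ![-p 1, p 2, 0]

theorem absMom_relMom {p : Vec3} (hp : ∑ i, p i = 0) : absMom (relMom p) = p := by
  rw [Fin.sum_univ_three] at hp
  funext i
  fin_cases i <;> simp [absMom, relMom]
  linear_combination (-hp)

theorem continuousOn_liftPoint {m : Fin 3 → ℝ} (hm : ∀ i, 0 < m i) :
    ContinuousOn (liftPoint m) {y | y.1 ≠ 0} := by
  have hX : Continuous fun y : Phase => (fun i => y.1 i ^ 2 : Vec3) := by fun_prop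
  have hM : ContinuousOn (fun y : Phase => massNorm m fun i => y.1 i ^ 2) {y | y.1 ≠ 0} :=
    ((continuous_massNorm m).comp hX).continuousOn
  have hM0 : ∀ y ∈ {y : Phase | y.1 ≠ 0}, massNorm m (fun i => y.1 i ^ 2) ≠ 0 := fun y hy =>
    (massNormZ_pos hm hy).ne'
  have hip : ContinuousOn (fun y : Phase => ip y.2 fun i => y.1 i ^ 2) {y | y.1 ≠ 0} := by
    simp only [ip_eq]
    fun_prop
  refine ContinuousOn.prodMk (hM.prodMk (hip.div hM hM0)) (ContinuousOn.prodMk ?_ ?_)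
  · exact continuous_fst.continuousOn
  · refine continuousOn_pi.2 fun i => ContinuousOn.mul ?_ (ContinuousOn.sub ?_ (ContinuousOn.mul
      (Complex.continuous_ofReal.comp_continuousOn ((hip.div hM hM0).div hM hM0)) ?_))
    · exact (continuous_const.mul (Complex.continuous_conj.comp
        ((continuous_apply i).comp continuous_fst))).continuousOn
    · fun_prop
    · unfold massDual
      fun_prop

/-- The reduced Levi-Civita phase space in coordinates `(z, p)`. -/
def liftHomeo {m : Fin 3 → ℝ} (hm : ∀ i, 0 < m i) :
    ReducedCollisionFree ≃ₜ squareHom ⁻¹' relStates where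
  toFun := Quotient.lift (fun x : collisionFree =>
    (⟨(fun i => Units.mk0 (normalizedZ m x.1 i) (normalizedZ_ne_zero hm x.2 i),
      Multiplicative.ofAdd (bodyState m x.1).2), by
        refine ⟨?_, sum_absMom _⟩
        simpa [squareHom_apply] using sum_normalizedZ_sq (m := m) x.2.1⟩ :
      squareHom ⁻¹' relStates)) <| by
    rintro ⟨x, hx⟩ ⟨x', hx'⟩ ⟨k, hk, c, hc⟩
    obtain rfl : x' = _ := hc
    refine Subtype.ext (Prod.ext ?_ ?_)
    · funext i
      refine Units.ext ?_
      have := normalizedZ_gauge hm hx.1.1 hk c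
      rw [← shiftAct_scaleAct] at this
      exact (congrFun this i).symm
    · change Multiplicative.ofAdd (bodyState m x).2
        = Multiplicative.ofAdd (bodyState m (shiftAct c (scaleAct k x))).2
      rw [shiftAct_scaleAct, bodyState_gaugeAct hk (fun _ => abs_of_pos hk) c hm hx]
  invFun := fun y => Quotient.mk _
    ⟨liftPoint m (fun i => (y.1.1 i : ℂ), relMom (Multiplicative.toAdd y.1.2)),
      (liftPoint_mem hm (fun i => (y.1.1 i).ne_zero) (by simpa [squareHom_apply] using y.2.1)).1⟩
  left_inv := by
    rintro ⟨x, hx⟩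
    refine Quotient.sound ?_
    exact Setoid.symm' _ (symmetrySetoid_liftPoint hm hx (absMom_relMom (sum_absMom _)))
  right_inv := by
    rintro ⟨⟨z, p⟩, hy⟩
    have hs : ∑ i, (z i : ℂ) ^ 2 = 0 := by simpa [squareHom_apply] using hy.1
    have hz : ∀ i, (z i : ℂ) ≠ 0 := fun i => (z i).ne_zero
    have hb := bodyState_liftPoint hm (P := relMom (Multiplicative.toAdd p)) hz hs
    refine Subtype.ext (Prod.ext ?_ ?_)
    · funext i
      refine Units.ext ?_
      have hM : massNormZ m (fun i => (z i : ℂ)) ≠ 0 :=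
        (massNormZ_pos hm (Function.ne_iff.2 ⟨0, hz 0⟩)).ne'
      change ((Real.sqrt (massNormZ m (fun i => (z i : ℂ)) / massNormZ m (fun i => (z i : ℂ))) : ℝ)
        : ℂ) * (z i : ℂ) = z i
      rw [div_self hM]
      simp
    · change Multiplicative.ofAdd (bodyState m (liftPoint m (fun i => (z i : ℂ),
        relMom (Multiplicative.toAdd p)))).2 = p
      rw [hb]
      exact absMom_relMom hy.2
  continuous_toFun := by
    refine Continuous.quotient_lift ?_ _
    refine Continuous.subtype_mk (Continuous.prodMk ?_ ?_) _
    · refine continuous_pi fun i => continuous_units_mk0 ?_ _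
      have hM : Continuous fun x : collisionFree => massNormZ m x.1.2.1 := by
        unfold massNormZ
        exact (continuous_massNorm m).comp (by fun_prop)
      refine (Complex.continuous_ofReal.comp (Real.continuous_sqrt.comp ?_)).mul (by fun_prop)
      exact Continuous.div (by fun_prop) hM fun x => (massNormZ_pos hm x.2.1.1.2).ne'
    · refine continuous_ofAdd.comp (continuous_snd.comp ?_)
      exact (continuousOn_iff_continuous_domRestrict.1
        ((contDiffOn_bodyState hm).continuousOn.mono collisionFree_subset))
  continuous_invFun := by
    refine continuous_quotient_mk'.comp (Continuous.subtype_mk ?_ _)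
    refine (continuousOn_liftPoint hm).comp_continuous (Continuous.prodMk ?_ ?_) fun y =>
      Function.ne_iff.2 ⟨0, (y.1.1 0).ne_zero⟩
    · refine continuous_pi fun i => ?_
      exact Units.continuous_val.comp ((continuous_apply i).comp
        (continuous_fst.comp continuous_subtype_val))
    · have h1 : Continuous fun y : squareHom ⁻¹' relStates => Multiplicative.toAdd y.1.2 :=
        continuous_toAdd.comp (continuous_snd.comp continuous_subtype_val)
      refine continuous_pi fun i => ?_
      fin_cases i
      · exact ((continuous_apply 1).comp h1).neg
      · exact (continuous_apply 2).comp h1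
      · exact continuous_const

/-- Componentwise squaring between the reduced phase spaces in coordinates. -/
def squareMap : squareHom ⁻¹' relStates → relStates := relStates.restrictPreimage squareHom

theorem isCoveringMap_squareMap : IsCoveringMap squareMap :=
  isCoveringMap_squareHom.restrictPreimage relStates

theorem ncard_squareMap_fiber (y : relStates) : (squareMap ⁻¹' {y}).ncard = 8 := by
  obtain ⟨⟨Q, p⟩, hQ⟩ := y
  obtain ⟨w, rfl⟩ : ∃ w : Fin 3 → ℂˣ, w ^ 2 = Q := by
    have : ∀ i, ∃ w : ℂˣ, w ^ 2 = Q i := fun i =>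
      (Complex.isQuotientCoveringMap_npow 2).surjective (Q i)
    choose w hw using this
    exact ⟨w, funext hw⟩
  have hmem : ∀ b, (flipSigns b w, p) ∈ squareHom ⁻¹' relStates := fun b => by
    change squareHom (flipSigns b w, p) ∈ relStates
    rwa [squareHom_apply, (sq_eq_sq_iff_flipSigns (flipSigns b w) w).2 ⟨b, rfl⟩]
  have hrange : squareMap ⁻¹' {⟨(w ^ 2, p), hQ⟩}
      = range fun b => (⟨(flipSigns b w, p), hmem b⟩ : squareHom ⁻¹' relStates) := by
    ext ⟨⟨z, p'⟩, hz⟩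
    simp only [mem_preimage, squareMap, mem_singleton_iff, mem_range, Subtype.ext_iff,
      restrictPreimage_coe, squareHom_apply, Prod.mk.injEq, sq_eq_sq_iff_flipSigns]
    constructor
    · rintro ⟨⟨b, rfl⟩, rfl⟩
      exact ⟨b, rfl, rfl⟩
    · rintro ⟨b, rfl, rfl⟩
      exact ⟨⟨b, rfl⟩, rfl⟩
  rw [hrange, ncard_range_of_injective]
  · simp
  · intro b c hbc
    exact flipSigns_injective w (congrArg (fun y => y.1.1) hbc)

theorem ncard_fiber_of_equiv {A B C D : Type*} (f : B → C) (e : A ≃ B) (e' : D ≃ C) {n : ℕ}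
    (h : ∀ y, (f ⁻¹' {y}).ncard = n) (y : D) : ((e'.symm ∘ (f ∘ e)) ⁻¹' {y}).ncard = n := by
  have : (e'.symm ∘ (f ∘ e)) ⁻¹' {y} = e.symm '' (f ⁻¹' {e' y}) := by
    ext x
    rw [e.symm.image_eq_preimage_symm]
    simp [Equiv.symm_apply_eq]
  rw [this, ncard_image_of_injective _ e.symm.injective, h]

theorem reducedHomeo_mk {m : Fin 3 → ℝ} (hm : ∀ i, 0 < m i) (y : zeroMomentum) :
    (reducedHomeo hm (Quotient.mk _ y)).1 = (fun i => Units.mk0 (relPos y.1.1 i) (y.2.1 i),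
      Multiplicative.ofAdd y.1.2) := rfl

theorem liftHomeo_mk {m : Fin 3 → ℝ} (hm : ∀ i, 0 < m i) (x : collisionFree) :
    (liftHomeo hm (Quotient.mk _ x)).1 =
      (fun i => Units.mk0 (normalizedZ m x.1 i) (normalizedZ_ne_zero hm x.2 i),
        Multiplicative.ofAdd (bodyState m x.1).2) := rfl

theorem squareMap_coe (y : squareHom ⁻¹' relStates) : (squareMap y).1 = squareHom y.1 := rfl

/-- In the coordinates of `liftHomeo` and `reducedHomeo` the map induced by Ψ is squaring,
restricted to the preimage of `relStates`. -/
theorem exists_covering {m : Fin 3 → ℝ} (hm : ∀ i, 0 < m i) :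
    ∃ Φ : ReducedCollisionFree → ReducedThreeBody,
      (∀ x : collisionFree, ∃ hx : bodyState m x.1 ∈ zeroMomentum,
        Φ (Quotient.mk _ x) = Quotient.mk _ ⟨bodyState m x.1, hx⟩) ∧
      IsCoveringMap Φ ∧ ∀ y, (Φ ⁻¹' {y}).ncard = 8 := by
  refine ⟨(reducedHomeo hm).symm ∘ (squareMap ∘ liftHomeo hm), fun x => ?_,
    (isCoveringMap_squareMap.comp_homeomorph (liftHomeo hm)).homeomorph_comp
      (reducedHomeo hm).symm,
    ncard_fiber_of_equiv squareMap (liftHomeo hm).toEquiv (reducedHomeo hm).toEquiv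
      ncard_squareMap_fiber⟩
  refine ⟨bodyState_mem_zeroMomentum hm x.2, ?_⟩
  rw [Function.comp_apply, Function.comp_apply]
  refine (reducedHomeo hm).symm_apply_eq.2 (Subtype.ext ?_)
  rw [squareMap_coe, liftHomeo_mk, reducedHomeo_mk, squareHom_apply]
  refine Prod.ext (funext fun i => Units.ext ?_) rfl
  simp only [Pi.pow_apply, Units.val_pow_eq_pow_val, Units.val_mk0]
  rw [normalizedZ_sq hm x.2.1.1, ← relPos_bodyPositions hm x.2.1.2.2]
  rfl

end Covering

/-! ### Transversality at binary collisions and the time change -/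

section Collisions

theorem other_ne_zero {z : Vec3} (hz : z ≠ 0) (hs : ∑ i, z i ^ 2 = 0) {i : Fin 3} (hi : z i = 0)
    {j : Fin 3} (hj : j ≠ i) : z j ≠ 0 := by
  intro hj0
  rw [Fin.sum_univ_three] at hs
  fin_cases i <;> fin_cases j <;> simp_all <;>
    exact hz (funext fun k => by fin_cases k <;> assumption)

theorem regPotential_pos {m : Fin 3 → ℝ} (hm : ∀ i, 0 < m i) {z : Vec3} (hz : z ≠ 0) {i : Fin 3}
    (hz' : ∀ j, j ≠ i → z j ≠ 0) : 0 < regPotential m z := by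
  have hM := massNormZ_pos hm hz
  have hn := normSqZ_pos hz
  have hp := pairMass_pos hm
  have hρ := rho_nonneg z
  have h0 := hρ 0
  have h1 := hρ 1
  have h2 := hρ 2
  have p0 := hp 0
  have p1 := hp 1
  have p2 := hp 2
  refine mul_pos (by positivity) ?_
  fin_cases i
  · have e1 := rho_pos (hz' 1 (by decide))
    have e2 := rho_pos (hz' 2 (by decide))
    positivity
  · have e1 := rho_pos (hz' 0 (by decide))
    have e2 := rho_pos (hz' 2 (by decide))
    positivity
  · have e1 := rho_pos (hz' 0 (by decide))
    have e2 := rho_pos (hz' 1 (by decide))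
    positivity

/-- At a binary collision, scaling the conjugate `η` component scales the kinetic term. -/
theorem regHam_scale_eta (m : Fin 3 → ℝ) (h : ℝ) {x : ExtPhase} {i : Fin 3} (hi : x.2.1 i = 0)
    (t : ℝ) : regHam m h (x + t • ((0, (0, Pi.single i (x.2.2 i))) : ExtPhase)) =
      (1 + t) ^ 2 * (regHam m h x + regPotential m x.2.1 / x.1.1)
        - regPotential m x.2.1 / x.1.1 := by
  have h1 : (x + t • ((0, (0, Pi.single i (x.2.2 i))) : ExtPhase)).1 = x.1 := by simp
  have h2 : (x + t • ((0, (0, Pi.single i (x.2.2 i))) : ExtPhase)).2.1 = x.2.1 := by simp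
  have h3 : (x + t • ((0, (0, Pi.single i (x.2.2 i))) : ExtPhase)).2.2
      = x.2.2 + t • (Pi.single i (x.2.2 i) : Vec3) := by simp
  have hs : ∀ a : ℂ, a + (t : ℂ) * a = ((1 + t : ℝ) : ℂ) * a := fun a => by push_cast; ring
  have hρ : rho x.2.1 i = 0 := by simp [rho, hi]
  have hτ : tau x.2.1 = 0 := by
    fin_cases i <;> simp only [Fin.zero_eta, Fin.mk_one, Fin.reduceFinMk] at hρ <;> simp [tau, hρ]
  rw [regHam, regHam, h1, h2, h3, hτ]
  fin_cases i <;> simp only [Fin.zero_eta, Fin.mk_one, Fin.reduceFinMk] at hi hρ ⊢ <;>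
    simp [piVec, hi, hρ, hs, -Complex.ofReal_add, mul_pow] <;>
    ring

/-- Euler's identity: the kinetic term is quadratic in η_i and equals W/r on the zero level, so the
derivative in direction η_i is 2W/r > 0. It is also the real pairing of η_i with the velocity of
z_i. -/
theorem regField_z_ne_zero {m : Fin 3 → ℝ} (hm : ∀ i, 0 < m i) {h : ℝ} {x : ExtPhase}
    (hx : x ∈ constraintSet) (h0 : regHam m h x = 0) {i : Fin 3} (hi : x.2.1 i = 0) :
    (regField m h x).2.1 i ≠ 0 := by
  have hW := regPotential_pos hm hx.1.2 fun j hj => other_ne_zero hx.1.2 hx.2.2 hi hj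
  have hr : 0 < x.1.1 := hx.1.1
  have hd : HasDerivAt (fun t : ℝ => (1 + t) ^ 2 * (regPotential m x.2.1 / x.1.1)
      - regPotential m x.2.1 / x.1.1) (2 * (regPotential m x.2.1 / x.1.1)) 0 := by
    simpa using ((((hasDerivAt_id (0 : ℝ)).const_add 1).fun_pow 2).mul_const
      (regPotential m x.2.1 / x.1.1)).sub_const (regPotential m x.2.1 / x.1.1)
  have h1 : fderiv ℝ (regHam m h) x (0, (0, Pi.single i (x.2.2 i)))
      = 2 * (regPotential m x.2.1 / x.1.1) := by
    refine fderiv_apply_eq_of_line (hasFDerivAt_regHam hm h hx.1).differentiableAt ?_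
    simpa only [regHam_scale_eta m h hi, h0, zero_add] using hd
  rw [← omegaExt_regField] at h1
  intro hv
  have h2 : omegaExt (regField m h x) (0, (0, Pi.single i (x.2.2 i))) = 0 := by
    simp [omegaExt, omegaPhase, pairing, Pi.single_apply, apply_ite conj, ite_mul, hv]
  rw [h2] at h1
  have : 0 < 2 * (regPotential m x.2.1 / x.1.1) := by positivity
  exact this.ne h1

theorem IsZeroLevelCurve.hasDerivAt {m : Fin 3 → ℝ} {h : ℝ} {J : Set ℝ} {γ : ℝ → ExtPhase}
    (hγ : IsZeroLevelCurve m h γ J) {s : ℝ} (hs : s ∈ J) :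
    HasDerivAt γ (regField m h (γ s)) s := (isRegCurve_iff.1 hγ.1 s hs).2

theorem IsZeroLevelCurve.deriv_z_ne_zero {m : Fin 3 → ℝ} (hm : ∀ i, 0 < m i) {h : ℝ} {J : Set ℝ}
    {γ : ℝ → ExtPhase} (hγ : IsZeroLevelCurve m h γ J) {s : ℝ} (hs : s ∈ J) {i : Fin 3}
    (hi : (γ s).2.1 i = 0) : deriv (fun s' => (γ s').2.1 i) s ≠ 0 := by
  have h1 : HasDerivAt (fun s' => (γ s').2.1 i) ((regField m h (γ s)).2.1 i) s :=
    hasDerivAt_pi.1 (hγ.hasDerivAt hs).snd.fst i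
  rw [h1.deriv]
  exact regField_z_ne_zero hm (hγ.2 s hs).1 (hγ.2 s hs).2 hi

theorem IsZeroLevelCurve.eventually_collisionFree {m : Fin 3 → ℝ} (hm : ∀ i, 0 < m i) {h : ℝ}
    {J : Set ℝ} (hJ : IsOpenInterval J) {γ : ℝ → ExtPhase} (hγ : IsZeroLevelCurve m h γ J) {s : ℝ}
    (hs : s ∈ J) : ∀ᶠ s' in 𝓝[≠] s, γ s' ∈ collisionFree := by
  have h1 : ∀ i, HasDerivAt (fun s' => (γ s').2.1 i) ((regField m h (γ s)).2.1 i) s := fun i =>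
    hasDerivAt_pi.1 (hγ.hasDerivAt hs).snd.fst i
  have h2 : ∀ i, ∀ᶠ s' in 𝓝[≠] s, (γ s').2.1 i ≠ 0 := by
    intro i
    by_cases hi : (γ s).2.1 i = 0
    · exact (h1 i).eventually_ne (regField_z_ne_zero hm (hγ.2 s hs).1 (hγ.2 s hs).2 hi)
    · exact ((h1 i).continuousAt.eventually_ne hi).filter_mono nhdsWithin_le_nhds
  filter_upwards [eventually_all.2 h2, mem_nhdsWithin_of_mem_nhds (hJ.1.mem_nhds hs)] with s' h3 h4
  exact ⟨(hγ.2 s' h4).1, h3⟩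

/-- Equal values at two points would make the monotone function constant between them, contradicting
positivity of the derivative just to the right of the first. -/
theorem strictMonoOn_of_deriv_eventually_pos {θ θ' : ℝ → ℝ} {J : Set ℝ} (hJ : IsOpenInterval J)
    (hθ : ∀ s ∈ J, HasDerivAt θ (θ' s) s) (h0 : ∀ s ∈ J, 0 ≤ θ' s)
    (hpos : ∀ s ∈ J, ∀ᶠ s' in 𝓝[≠] s, 0 < θ' s') : StrictMonoOn θ J := by
  have hmono : MonotoneOn θ J := by
    refine monotoneOn_of_deriv_nonneg hJ.2.convex
      (fun s hs => (hθ s hs).continuousAt.continuousWithinAt)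
      (fun s hs => (hθ s (interior_subset hs)).differentiableAt.differentiableWithinAt) ?_
    intro s hs
    rw [(hθ s (interior_subset hs)).deriv]
    exact h0 s (interior_subset hs)
  intro a ha b hb hab
  refine lt_of_le_of_ne (hmono ha hb hab.le) fun he => ?_
  have h1 : ∀ᶠ s' in 𝓝[>] a, 0 < θ' s' :=
    (hpos a ha).filter_mono (nhdsWithin_mono a fun s hs => (ne_of_gt hs : s ≠ a))
  obtain ⟨s, hs, hsab⟩ := (h1.and (Ioo_mem_nhdsGT hab)).exists
  have hIoo : ∀ u ∈ Ioo a b, u ∈ J := fun u hu => hJ.2.out ha hb ⟨hu.1.le, hu.2.le⟩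
  have hconst : θ =ᶠ[𝓝 s] fun _ => θ a := by
    filter_upwards [isOpen_Ioo.mem_nhds hsab] with u hu
    exact le_antisymm ((hmono (hIoo u hu) hb hu.2.le).trans he.ge) (hmono ha (hIoo u hu) hu.1.le)
  have := (hθ s (hIoo s hsab)).unique ((hasDerivAt_const s (θ a)).congr_of_eventuallyEq hconst)
  exact hs.ne' this

theorem hasDerivAt_bodyState_of_zeroLevel {m : Fin 3 → ℝ} (hm : ∀ i, 0 < m i) {h : ℝ}
    {x : ℝ → ExtPhase} {t : ℝ} (hx : x t ∈ collisionFree) (h0 : regHam m h (x t) = 0)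
    (hd : HasDerivAt x ((tau (x t).2.1)⁻¹ • regField m h (x t)) t) :
    HasDerivAt (fun t => bodyState m (x t)) (threeBodyField m (bodyState m (x t))) t := by
  have hreg := collisionFree_subset hx
  refine ((hasFDerivAt_bodyState hm hreg).comp_hasDerivAt t hd).congr_deriv ?_
  rw [map_smul, fderiv_bodyState hm hreg, dBodyState_regField hm hx h0, smul_smul,
    inv_mul_cancel₀ (tau_pos hx.2).ne', one_smul]

theorem threeBodyHam_bodyState {m : Fin 3 → ℝ} (hm : ∀ i, 0 < m i) {h : ℝ} {x : ExtPhase}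
    (hx : x ∈ collisionFree) : regHam m h x = 0 ↔ threeBodyHam m (bodyState m x) = h := by
  rw [regHam_eq_threeBodyHam hm h hx, mul_eq_zero, or_iff_right (tau_pos hx.2).ne', sub_eq_zero]

theorem continuousOn_tau : ContinuousOn (fun x : ExtPhase => tau x.2.1) extDomain :=
  contDiffOn_tau.continuousOn

theorem continuousOn_bodyPositions {m : Fin 3 → ℝ} (hm : ∀ i, 0 < m i) :
    ContinuousOn (bodyPositions m) extDomain := by
  refine (continuous_absPos m).comp_continuousOn (continuousOn_pi.2 fun i => ContinuousOn.mul
    (Complex.continuous_ofReal.comp_continuousOn (ContinuousOn.div ?_ ?_ ?_)) ?_)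
  · exact contDiff_fst_r.continuous.continuousOn
  · exact (contDiffOn_massNormZ hm).continuousOn
  · exact fun x hx => (massNormZ_pos hm hx.2).ne'
  · exact ((contDiff_z i).continuous.pow 2).continuousOn

/-- Regularized curves on the zero level, after the time change, are three-body trajectories. -/
theorem IsZeroLevelCurve.exists_threeBodyCurve {m : Fin 3 → ℝ} (hm : ∀ i, 0 < m i) {h : ℝ}
    {J : Set ℝ} (hJ : IsOpenInterval J) {γ : ℝ → ExtPhase} (hγ : IsZeroLevelCurve m h γ J) :
    ∃ (θ : ℝ → ℝ) (ζ : ℝ → Phase),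
      (∀ s ∈ J, HasDerivAt θ (tau (γ s).2.1) s) ∧ StrictMonoOn θ J ∧
      IsThreeBodyCurve m h ζ (θ '' {s ∈ J | γ s ∈ collisionFree}) ∧
      (∀ s ∈ J, γ s ∈ collisionFree → ζ (θ s) = bodyState m (γ s)) ∧
      (∀ s ∈ J, (ζ (θ s)).1 = bodyPositions m (γ s)) ∧
      ContinuousOn (fun t => (ζ t).1) (θ '' J) := by
  rcases J.eq_empty_or_nonempty with rfl | ⟨s₀, hs₀⟩
  · exact ⟨id, fun _ => 0, by simp, by simp [StrictMonoOn], by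
      simp [IsThreeBodyCurve, IsHamiltonianCurve], by simp, by simp, by simp⟩
  have hγc : ContinuousOn γ J := fun s hs => (hγ.hasDerivAt hs).continuousAt.continuousWithinAt
  have hdom : ∀ s ∈ J, γ s ∈ extDomain := fun s hs => (hγ.2 s hs).1.1
  obtain ⟨θ, -, hθ⟩ := exists_primitive hJ (continuousOn_tau.comp hγc hdom) hs₀ 0
  have hmono : StrictMonoOn θ J := strictMonoOn_of_deriv_eventually_pos hJ hθ
    (fun s _ => tau_nonneg _) fun s hs => by
      filter_upwards [hγ.eventually_collisionFree hm hJ hs] with s' hs' using tau_pos hs'.2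
  obtain ⟨-, φ, hφ, hφc, hφd⟩ := exists_inverse_of_strictMonoOn hJ hθ hmono
  refine ⟨θ, fun t => bodyState m (γ (φ t)), hθ, hmono, ⟨?_, ?_⟩, ?_, ?_, ?_⟩
  · rw [isHamiltonianCurve_threeBody_iff]
    rintro _ ⟨s, ⟨hs, hcf⟩, rfl⟩
    refine ⟨by simp only [hφ s hs]; exact (bodyState_mem_zeroMomentum hm hcf).1, ?_⟩
    have hτ := (tau_pos hcf.2).ne'
    have h1 : HasDerivAt γ (regField m h (γ s)) (φ (θ s)) := by
      rw [hφ s hs]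
      exact hγ.hasDerivAt hs
    have h2 := h1.scomp (θ s) (hφd s hs hτ)
    refine hasDerivAt_bodyState_of_zeroLevel hm (h := h) (x := fun t => γ (φ t)) ?_ ?_ ?_
    · rwa [hφ s hs]
    · rw [hφ s hs]
      exact (hγ.2 s hs).2
    · simp only [hφ s hs]
      exact h2
  · rintro _ ⟨s, ⟨hs, hcf⟩, rfl⟩
    simp only [hφ s hs]
    exact ⟨bodyState_mem_zeroMomentum hm hcf, (threeBodyHam_bodyState hm hcf).1 (hγ.2 s hs).2⟩
  · intro s hs _
    simp only [hφ s hs]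
  · intro s hs
    simp only [hφ s hs]
    rfl
  -- Positions depend continuously on the regularized state even at collisions, and the inverse time
  -- change is continuous there too.
  · refine (continuousOn_bodyPositions hm).comp (hγc.comp hφc ?_) ?_
    · rintro _ ⟨s, hs, rfl⟩
      rwa [hφ s hs]
    · rintro _ ⟨s, hs, rfl⟩
      simp only [hφ s hs]
      exact hdom s hs

end Collisions

/-! ### Lifting three-body trajectories -/

section Lifting

theorem exists_isRegCurve {m : Fin 3 → ℝ} (hm : ∀ i, 0 < m i) (h : ℝ) {x : ExtPhase}
    (hx : x ∈ extDomain) : ∃ ε > 0, ∃ γ : ℝ → ExtPhase, γ 0 = x ∧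
      IsRegCurve m h γ (Ioo (-ε) ε) := by
  obtain ⟨ε, hε, H⟩ := exists_uniform_isSol isOpen_extDomain (contDiffOn_regField hm h)
    (isCompact_singleton (x := x)) (singleton_subset_iff.2 hx)
  obtain ⟨γ, h0, hγ⟩ := H x rfl 0
  exact ⟨ε, hε, γ, h0, isRegCurve_iff.2 (by simpa using hγ)⟩

/-- Symmetries map solutions to solutions; differentiating the image of a solution at its starting
time gives equivariance of the field. -/
theorem regField_gaugeAct {a : Fin 3 → ℝ} {k : ℝ} (hk : 0 < k) (ha : ∀ i, |a i| = k) (c : ℂ)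
    {m : Fin 3 → ℝ} (hm : ∀ i, 0 < m i) {h : ℝ} {x : ExtPhase} (hx : x ∈ extDomain) :
    regField m h (gaugeAct a c x) = gaugeAct a c (regField m h x) := by
  obtain ⟨ε, hε, γ, rfl, hγ⟩ := exists_isRegCurve hm h hx
  have h0 : ∀ i, a i ≠ 0 := fun i => abs_pos.1 ((ha i).symm ▸ hk)
  have hmem : (0 : ℝ) ∈ Ioo (-ε) ε := ⟨by linarith, hε⟩
  have h1 := (isRegCurve_iff.1 (hγ.gaugeAct hk ha c hm) 0 hmem).2
  have h2 := (gaugeEquiv a h0 c).hasFDerivAt.comp_hasDerivAt 0 (isRegCurve_iff.1 hγ 0 hmem).2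
  exact h1.unique h2

/-- The regularized field in physical time. -/
def timeField (m : Fin 3 → ℝ) (h : ℝ) (x : ExtPhase) : ExtPhase :=
  (tau x.2.1)⁻¹ • regField m h x

theorem contDiffOn_timeField {m : Fin 3 → ℝ} (hm : ∀ i, 0 < m i) (h : ℝ) :
    ContDiffOn ℝ 1 (timeField m h) regularDomain := by
  have hsub : regularDomain ⊆ extDomain := fun x hx => hx.1
  exact (((contDiffOn_tau.of_le (by simp)).mono hsub).inv fun x hx => (tau_pos hx.2).ne').smul
    ((contDiffOn_regField hm h).mono hsub)

/-- The zero level points over a three-body state, modulo translations. -/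
def fibre (m : Fin 3 → ℝ) (h : ℝ) (y : Phase) : Set ExtPhase :=
  {x | x ∈ collisionFree ∧ regHam m h x = 0 ∧ translationSetoid (bodyState m x) y}

theorem fibre_nonempty {m : Fin 3 → ℝ} (hm : ∀ i, 0 < m i) {h : ℝ} {y : Phase}
    (hy : y ∈ zeroMomentum) (hE : threeBodyHam m y = h) : (fibre m h y).Nonempty := by
  have : ∀ i, ∃ z : ℂ, z ^ 2 = relPos y.1 i := fun i =>
    IsAlgClosed.exists_pow_nat_eq (relPos y.1 i) two_pos
  choose z hz using this
  have hz0 : ∀ i, z i ≠ 0 := fun i h0 => hy.1 i (by rw [← hz i, h0]; ring)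
  have hs : ∑ i, z i ^ 2 = 0 := by
    simp only [hz]
    exact sum_relPos _
  have hb := bodyState_liftPoint hm (P := relMom y.2) hz0 hs
  rw [absMom_relMom hy.2, show (fun i => z i ^ 2) = relPos y.1 from funext hz,
    absPos_relPos_eq_add_const hm] at hb
  have hcf := (liftPoint_mem hm (P := relMom y.2) hz0 hs).1
  refine ⟨liftPoint m (z, relMom y.2), hcf, ?_, ?_⟩
  · rw [threeBodyHam_bodyState hm hcf, hb, threeBodyHam_translate, hE]
  · refine Setoid.symm' _ ?_
    rw [hb]
    exact ⟨_, rfl⟩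

theorem gaugeAct_mem_fibre {a : Fin 3 → ℝ} {k : ℝ} (hk : 0 < k) (ha : ∀ i, |a i| = k) (c : ℂ)
    {m : Fin 3 → ℝ} (hm : ∀ i, 0 < m i) {h : ℝ} {x : ExtPhase} {y : Phase}
    (hx : x ∈ fibre m h y) : gaugeAct a c x ∈ fibre m h y := by
  refine ⟨gaugeAct_mem_collisionFree hk ha c hx.1, ?_, ?_⟩
  · rw [regHam_gaugeAct hk ha c m h hx.1.1.1]
    exact hx.2.1
  · rw [bodyState_gaugeAct hk ha c hm hx.1]
    exact hx.2.2

theorem gaugeRel_of_mem_fibre {m : Fin 3 → ℝ} (hm : ∀ i, 0 < m i) {h : ℝ} {x x' : ExtPhase}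
    {y : Phase} (hx : x ∈ fibre m h y) (hx' : x' ∈ fibre m h y) : GaugeRel x x' :=
  gaugeRel_of_bodyState hm hx.1 hx'.1 (Setoid.trans' _ hx.2.2 (Setoid.symm' _ hx'.2.2))

/-- A solution of the regularized equation in physical time that starts over a three-body
trajectory stays over it. -/
theorem IsSol.mem_fibre {m : Fin 3 → ℝ} (hm : ∀ i, 0 < m i) {h : ℝ} {B : Set ℝ}
    (hB : IsOpenInterval B) {α : ℝ → ExtPhase} (hα : IsSol (timeField m h) regularDomain α B)
    {ζ : ℝ → Phase} (hζ : IsThreeBodyCurve m h ζ B) {t₁ : ℝ} (ht₁ : t₁ ∈ B)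
    (h1 : α t₁ ∈ fibre m h (ζ t₁)) {t : ℝ} (ht : t ∈ B) : α t ∈ fibre m h (ζ t) := by
  have hcf : ∀ u ∈ B, α u ∈ collisionFree := by
    intro u hu
    have hd : ∀ u ∈ B, HasDerivAt (fun u => constraint (α u)) 0 u := fun u hu => by
      have h1 := ((contDiff_constraint.differentiable (by simp)) (α u)).hasFDerivAt.comp_hasDerivAt
        u (hα u hu).2
      rwa [timeField, map_smul, fderiv_constraint_regField hm h (hα u hu).1.1, smul_zero] at h1
    have he := eq_of_hasDerivAt_zero hB hd hu ht₁
    have h0 := h1.1.1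
    refine ⟨?_, (hα u hu).1.2⟩
    rw [isSubmanifold_constraintSet.2.1] at h0 ⊢
    exact ⟨(hα u hu).1.1, he.trans h0.2⟩
  have hH : ∀ u ∈ B, regHam m h (α u) = 0 := by
    intro u hu
    have hd : ∀ u ∈ B, HasDerivAt (fun u => regHam m h (α u)) 0 u := fun u hu => by
      have h1 := (hasFDerivAt_regHam hm h (hα u hu).1.1).comp_hasDerivAt u (hα u hu).2
      rwa [timeField, map_smul, ← omegaExt_regField, omegaExt_self, smul_zero] at h1
    exact (eq_of_hasDerivAt_zero hB hd hu ht₁).trans h1.2.1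
  obtain ⟨c, hc⟩ := h1.2.2
  -- The translation that matches the states at `t₁` is kept fixed; the translated image is a
  -- three-body solution, so uniqueness identifies it with `ζ`.
  have hsol : IsSol (threeBodyField m) threeBodyDomain
      (fun u => ((fun i => (bodyState m (α u)).1 i + c, (bodyState m (α u)).2) : Phase)) B := by
    refine IsSol.translate (ζ := fun u => bodyState m (α u)) (fun u hu => ?_) c
    exact ⟨(bodyState_mem_zeroMomentum hm (hcf u hu)).1,
      hasDerivAt_bodyState_of_zeroLevel hm (hcf u hu) (hH u hu) (hα u hu).2⟩
  have he := IsSol.eqOn isOpen_threeBodyDomain (contDiffOn_threeBodyField m) hB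
    (isHamiltonianCurve_threeBody_iff.1 hζ.1) hsol ht₁ hc
  exact ⟨hcf t ht, hH t ht, c, he ht⟩

theorem IsThreeBodyCurve.mono {m : Fin 3 → ℝ} {h : ℝ} {ζ : ℝ → Phase} {I B : Set ℝ}
    (hζ : IsThreeBodyCurve m h ζ I) (hB : B ⊆ I) : IsThreeBodyCurve m h ζ B :=
  ⟨fun t ht => hζ.1 t (hB ht), fun t ht => hζ.2 t (hB ht)⟩

theorem mem_fibre_of_setoid {m : Fin 3 → ℝ} (hm : ∀ i, 0 < m i) {h : ℝ} {x : ExtPhase} {y : Phase}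
    (hx : x ∈ collisionFree) (hE : threeBodyHam m y = h)
    (hxy : translationSetoid (bodyState m x) y) : x ∈ fibre m h y := by
  refine ⟨hx, ?_, hxy⟩
  obtain ⟨c, rfl⟩ := hxy
  rw [threeBodyHam_translate] at hE
  exact (threeBodyHam_bodyState hm hx).2 hE

/-- Every three-body trajectory lifts to a regularized curve. -/
theorem IsThreeBodyCurve.exists_lift {m : Fin 3 → ℝ} (hm : ∀ i, 0 < m i) {h : ℝ} {I : Set ℝ}
    (hI : IsOpenInterval I) {ζ : ℝ → Phase} (hζ : IsThreeBodyCurve m h ζ I) {t₀ : ℝ} (ht₀ : t₀ ∈ I)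
    {x₀ : ExtPhase} (hx₀ : x₀ ∈ collisionFree)
    (h₀ : translationSetoid (bodyState m x₀) (ζ t₀)) :
    ∃ (J : Set ℝ) (γ : ℝ → ExtPhase) (θ : ℝ → ℝ),
      IsOpenInterval J ∧ IsZeroLevelCurve m h γ J ∧ (∃ s₀ ∈ J, γ s₀ = x₀ ∧ θ s₀ = t₀) ∧
      (∀ s ∈ J, HasDerivAt θ (tau (γ s).2.1) s) ∧ θ '' J = I ∧
      ∀ s ∈ J, γ s ∈ collisionFree ∧ translationSetoid (bodyState m (γ s)) (ζ (θ s)) := by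
  obtain ⟨x, hx0, hx⟩ : ∃ x : ℝ → ExtPhase, x t₀ = x₀ ∧
      ∀ t ∈ I, x t ∈ fibre m h (ζ t) ∧ HasDerivAt x (timeField m h (x t)) t := by
    refine exists_isSol_of_uniform_local isOpen_regularDomain (contDiffOn_timeField hm h) hI
      (fun t => fibre m h (ζ t)) (fun t x hx => collisionFree_subset hx.1) ?_ ht₀
      (mem_fibre_of_setoid hm hx₀ (hζ.2 t₀ ht₀).2 h₀)
    -- The fibres are not compact, but the symmetries and sign changes act transitively on each. One
    -- solution near `t₁` therefore yields, by transport, solutions through all points of nearby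
    -- fibres on the same interval.
    intro t₁ ht₁
    obtain ⟨y₁, hy₁⟩ := fibre_nonempty hm (hζ.2 t₁ ht₁).1 (hζ.2 t₁ ht₁).2
    obtain ⟨ε, hε, H⟩ := exists_uniform_isSol isOpen_regularDomain (contDiffOn_timeField hm h)
      (isCompact_singleton (x := y₁)) (singleton_subset_iff.2 (collisionFree_subset hy₁.1))
    obtain ⟨α, hα1, hα⟩ := H y₁ rfl t₁
    have hB := (isOpenInterval_Ioo (t₁ - ε) (t₁ + ε)).inter hI
    have htB : t₁ ∈ Ioo (t₁ - ε) (t₁ + ε) ∩ I := ⟨⟨by linarith, by linarith⟩, ht₁⟩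
    have hαB := hα.mono (inter_subset_left (t := I))
    have hmem := fun t => hαB.mem_fibre hm hB (hζ.mono inter_subset_right) htB (hα1 ▸ hy₁) (t := t)
    refine ⟨_, hB, htB, inter_subset_right, fun t₂ ht₂ y hy => ?_⟩
    obtain ⟨a, k, c, hk, ha, rfl⟩ := gaugeRel_of_mem_fibre hm (hmem t₂ ht₂) hy
    have h0 : ∀ i, a i ≠ 0 := fun i => abs_pos.1 ((ha i).symm ▸ hk)
    refine ⟨fun t => gaugeAct a c (α t), rfl, fun t ht =>
      ⟨gaugeAct_mem_fibre hk ha c hm (hmem t ht), ?_⟩⟩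
    refine ((gaugeEquiv a h0 c).hasFDerivAt.comp_hasDerivAt t (hαB t ht).2).congr_deriv ?_
    rw [timeField, timeField, tau_gaugeAct hk ha, regField_gaugeAct hk ha c hm (hαB t ht).1.1,
      ← gaugeEquiv_apply a h0]
    exact map_smul (gaugeEquiv a h0 c) _ _
  have hxc : ContinuousOn x I := fun t ht => (hx t ht).2.continuousAt.continuousWithinAt
  have hτ : ∀ t ∈ I, 0 < tau (x t).2.1 := fun t ht => tau_pos (hx t ht).1.1.2
  -- The lift was found in physical time; `σ` is the regularized parameter, ds = dt/τ, and its
  -- inverse is the required time change.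
  obtain ⟨σ, hσ0, hσ⟩ := exists_primitive hI (f := fun t => (tau (x t).2.1)⁻¹)
    ((continuousOn_tau.comp hxc fun t ht => (hx t ht).1.1.1.1).inv₀ fun t ht => (hτ t ht).ne')
    ht₀ 0
  have hpos : ∀ t ∈ I, 0 < (tau (x t).2.1)⁻¹ := fun t ht => inv_pos.2 (hτ t ht)
  have hmono : StrictMonoOn σ I := strictMonoOn_of_deriv_eventually_pos hI hσ
    (fun t ht => (hpos t ht).le) fun t ht => by
      filter_upwards [mem_nhdsWithin_of_mem_nhds (hI.1.mem_nhds ht)] with t' ht' using hpos t' ht'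
  obtain ⟨hJ, φ, hφ, -, hφd⟩ := exists_inverse_of_strictMonoOn hI hσ hmono
  have hφd' : ∀ t ∈ I, HasDerivAt φ (tau (x t).2.1) (σ t) := fun t ht => by
    simpa using hφd t ht (hpos t ht).ne'
  refine ⟨σ '' I, fun s => x (φ s), φ, hJ, ⟨isRegCurve_iff.2 ?_, ?_⟩,
    ⟨σ t₀, mem_image_of_mem σ ht₀, by simp only [hφ t₀ ht₀, hx0], hφ t₀ ht₀⟩, ?_, ?_, ?_⟩
  · rintro _ ⟨t, ht, rfl⟩
    simp only [hφ t ht]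
    refine ⟨(hx t ht).1.1.1.1, ?_⟩
    have h1 : HasDerivAt x (timeField m h (x t)) (φ (σ t)) := by
      rw [hφ t ht]
      exact (hx t ht).2
    refine (h1.scomp (σ t) (hφd' t ht)).congr_deriv ?_
    rw [timeField, smul_smul, mul_inv_cancel₀ (hτ t ht).ne', one_smul]
  · rintro _ ⟨t, ht, rfl⟩
    simp only [hφ t ht]
    exact ⟨(hx t ht).1.1.1, (hx t ht).1.2.1⟩
  · rintro _ ⟨t, ht, rfl⟩
    simp only [hφ t ht]
    exact hφd' t ht
  · rw [image_image]
    exact (image_congr hφ).trans (image_id I)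
  · rintro _ ⟨t, ht, rfl⟩
    simp only [hφ t ht]
    exact ⟨(hx t ht).1.1, (hx t ht).1.2.2⟩

end Lifting

/-! ### Momentum bounds near a binary collision -/

section BinaryCollision

/-- The body that does not belong to the pair `i`. -/
def thirdBody : Fin 3 → Fin 3 := ![2, 1, 0]

/-- P is determined up to a constant, chosen here to cancel one component other than `i`. The
remaining ones are, up to sign, the momenta of the third body and of a body of the pair. -/
theorem exists_absMom_eq_thirdBody {p : Vec3} (hp : ∑ i, p i = 0) (i : Fin 3) :
    ∃ P, absMom P = p ∧ (∀ j, j ≠ i → ‖P j‖ ≤ ‖p (thirdBody i)‖) ∧ ∃ a, ‖P i‖ = ‖p a‖ := by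
  rw [Fin.sum_univ_three] at hp
  fin_cases i
  · refine ⟨![-p 1, p 2, 0], ?_, fun j hj => ?_, 1, by simp⟩
    · funext i
      fin_cases i <;> simp [absMom]
      linear_combination (-hp)
    · fin_cases j <;> simp [thirdBody] at hj ⊢
  · refine ⟨![0, -p 0, p 1], ?_, fun j hj => ?_, 0, by simp⟩
    · funext i
      fin_cases i <;> simp [absMom]
      linear_combination (-hp)
    · fin_cases j <;> simp [thirdBody] at hj ⊢
  · refine ⟨![p 0, 0, -p 2], ?_, fun j hj => ?_, 2, by simp⟩
    · funext i
      fin_cases i <;> simp [absMom]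
      linear_combination (-hp)
    · fin_cases j <;> simp [thirdBody] at hj ⊢

theorem relPos_ne_zero_of_ne {q : Vec3} {i : Fin 3} (hi : relPos q i = 0) (hq : relPos q ≠ 0)
    {j : Fin 3} (hj : j ≠ i) : relPos q j ≠ 0 := by
  intro hj0
  have hs := sum_relPos q
  rw [Fin.sum_univ_three] at hs
  refine hq (funext fun k => ?_)
  fin_cases i <;> fin_cases j <;> fin_cases k <;> simp_all

theorem relPos_thirdBody (i : Fin 3) (q : Vec3) (c : ℂ) :
    relPos (q + Pi.single (thirdBody i) c) i = relPos q i := by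
  fin_cases i <;> simp [relPos, thirdBody]

/-- Near a collision of the pair `i`, the force on the third body is bounded. -/
theorem eventually_force_le (m : Fin 3 → ℝ) {q : Vec3} {i : Fin 3}
    (hq : ∀ j, j ≠ i → relPos q j ≠ 0) :
    ∃ C, ∀ᶠ q' in 𝓝 q, ∀ p, (q', p) ∈ threeBodyDomain →
      ‖(threeBodyField m (q', p)).2 (thirdBody i)‖ ≤ C := by
  -- The force function without the colliding pair is smooth near `q`. Moving the third body does
  -- not change the omitted term, so the gradient of `f` gives the force on that body.
  let f : Vec3 → ℝ := fun q' => ∑ j ∈ Finset.univ.erase i, pairMass m j / ‖relPos q' j‖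
  have hrel : ∀ j, ContDiff ℝ 2 fun q' : Vec3 => relPos q' j := fun j =>
    (contDiff_infty.1 (contDiff_relPos j) 2).comp (contDiff_id.prodMk (contDiff_const (c := (0 : Vec3))))
  have hf : ContDiffAt ℝ 2 f q := ContDiffAt.sum fun j hj =>
    contDiffAt_const.div ((hrel j).contDiffAt.norm ℝ (hq j (Finset.ne_of_mem_erase hj)))
      (norm_ne_zero_iff.2 (hq j (Finset.ne_of_mem_erase hj)))
  have hc : ContinuousAt (fderiv ℝ f) q :=
    (hf.fderiv_right (m := 1) (by norm_num)).continuousAt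
  refine ⟨‖fderiv ℝ f q‖ + 1, ?_⟩
  filter_upwards [hc.norm.eventually (gt_mem_nhds (lt_add_one _)), hf.eventually (by simp)]
    with q' h1 h2 p hp
  set v := (threeBodyField m (q', p)).2 with hv
  have key : ∀ c : ℂ, ip v (Pi.single (thirdBody i) c) =
      fderiv ℝ f q' (Pi.single (thirdBody i) c) := by
    intro c
    have e1 := omegaPhase_threeBodyField m (q', p) (Pi.single (thirdBody i) c, 0)
    rw [fderiv_threeBodyHam_of_curve m hp (hasDerivAt_line (q', p) _) (by simp)
      (u := -fderiv ℝ f q' (Pi.single (thirdBody i) c))] at e1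
    · rw [omegaPhase_eq, show ip ((Pi.single (thirdBody i) c, 0) : Phase).2
        (threeBodyField m (q', p)).1 = 0 by simp [ip, pairing]] at e1
      linarith
    · have hl : HasDerivAt (fun t : ℝ => q' + t • (Pi.single (thirdBody i) c : Vec3))
          (Pi.single (thirdBody i) c) 0 := hasDerivAt_line q' _
      have hd : HasFDerivAt f (fderiv ℝ f q')
          (q' + (0 : ℝ) • (Pi.single (thirdBody i) c : Vec3)) := by
        simpa using (h2.differentiableAt (by simp)).hasFDerivAt
      have hd' : HasDerivAt (fun t : ℝ => f (q' + t • (Pi.single (thirdBody i) c : Vec3)))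
          (fderiv ℝ f q' (Pi.single (thirdBody i) c)) 0 := by
        have := hd.comp_hasDerivAt (0 : ℝ) hl
        exact this
      refine (hd'.const_sub (kineticAbs m p - pairMass m i / ‖relPos q' i‖)).congr_of_eventuallyEq
        (Eventually.of_forall fun t => ?_)
      have hsm : t • (Pi.single (thirdBody i) c : Vec3) = Pi.single (thirdBody i) (t • c) :=
        (Pi.single_smul _ _ _).symm
      simp only [threeBodyHam, newtonU, f, Prod.smul_mk, Prod.mk_add_mk, smul_zero, add_zero]
      rw [← Finset.add_sum_erase _ _ (Finset.mem_univ i), hsm, relPos_thirdBody]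
      ring
  have h3 : ip v (Pi.single (thirdBody i) (v (thirdBody i))) = ‖v (thirdBody i)‖ ^ 2 := by
    have : pairing v (Pi.single (thirdBody i) (v (thirdBody i))) =
        conj (v (thirdBody i)) * v (thirdBody i) := by
      rw [pairing, Finset.sum_eq_single (thirdBody i)]
      · simp
      · intro j _ hj
        simp [hj]
      · simp
    rw [ip, this, ← Complex.normSq_eq_conj_mul_self, Complex.ofReal_re, Complex.sq_norm]
  have h4 := (le_abs_self _).trans ((fderiv ℝ f q').le_opNorm
    (Pi.single (thirdBody i) (v (thirdBody i))))
  rw [← key, h3, Pi.norm_single] at h4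
  have h5 := norm_nonneg (v (thirdBody i))
  by_contra! h6
  have h7 : 0 < ‖v (thirdBody i)‖ := by linarith [norm_nonneg (fderiv ℝ f q)]
  nlinarith [mul_pos (sub_pos.2 (h1.trans h6)) h7]

theorem IsThreeBodyCurve.hasDerivAt {m : Fin 3 → ℝ} {h : ℝ} {ζ : ℝ → Phase} {I : Set ℝ}
    (hζ : IsThreeBodyCurve m h ζ I) {t : ℝ} (ht : t ∈ I) :
    HasDerivAt ζ (threeBodyField m (ζ t)) t :=
  (isHamiltonianCurve_threeBody_iff.1 hζ.1 t ht).2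

/-- A function with eventually bounded derivative is eventually bounded. -/
theorem eventually_norm_le_of_hasDerivAt {f f' : ℝ → ℂ} {b C : ℝ}
    (hf : ∀ᶠ t in 𝓝[<] b, HasDerivAt f (f' t) t ∧ ‖f' t‖ ≤ C) :
    ∃ B, ∀ᶠ t in 𝓝[<] b, ‖f t‖ ≤ B := by
  obtain ⟨l, hl, hsub⟩ := (mem_nhdsLT_iff_exists_Ioo_subset).1 hf
  have hl' : l < b := hl
  have hmid : (l + b) / 2 ∈ Ioo l b := ⟨by linarith, by linarith⟩
  have hC : 0 ≤ C := (norm_nonneg _).trans (hsub hmid).2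
  refine ⟨‖f ((l + b) / 2)‖ + C * (b - l), ?_⟩
  filter_upwards [Ioo_mem_nhdsLT hl'] with t ht
  have h1 := (convex_Ioo l b).norm_image_sub_le_of_norm_hasDerivWithin_le
    (fun x hx => (hsub hx).1.hasDerivWithinAt) (fun x hx => (hsub hx).2) hmid ht
  have h2 : ‖t - (l + b) / 2‖ ≤ b - l := by
    rw [Real.norm_eq_abs, abs_le]
    constructor <;> linarith [ht.1, ht.2]
  have h3 := norm_sub_norm_le (f t) (f ((l + b) / 2))
  nlinarith [mul_le_mul_of_nonneg_left h2 hC]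

theorem norm_mul_newtonU (m : Fin 3 → ℝ) {Q : Vec3} (hQ : ∀ j, Q j ≠ 0) (i : Fin 3) :
    ‖Q i‖ * newtonU m Q =
      pairMass m i + ∑ j ∈ Finset.univ.erase i, pairMass m j * ‖Q i‖ / ‖Q j‖ := by
  have h := norm_ne_zero_iff.2 (hQ i)
  rw [newtonU, ← Finset.add_sum_erase _ _ (Finset.mem_univ i), mul_add, Finset.mul_sum]
  congr 1
  · field_simp
  · exact Finset.sum_congr rfl fun j _ => by ring

/-- Near a collision of one pair, relative momenta may be chosen which are `O(|Q|^(-1/2))`. -/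
theorem IsThreeBodyCurve.exists_absMom_bound {m : Fin 3 → ℝ} (hm : ∀ i, 0 < m i) {h a b : ℝ}
    (hab : a < b) {ζ : ℝ → Phase} (hζ : IsThreeBodyCurve m h ζ (Ioo a b)) {q : Vec3}
    (hlim : Tendsto (fun t => (ζ t).1) (𝓝[<] b) (𝓝 q)) {i : Fin 3} (hi : relPos q i = 0)
    (hq : relPos q ≠ 0) :
    ∃ C, ∀ᶠ t in 𝓝[<] b, ∃ P, absMom P = (ζ t).2 ∧ ∀ j, ‖P j‖ ^ 2 * ‖relPos (ζ t).1 j‖ ≤ C := by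
  have hIoo := Ioo_mem_nhdsLT hab
  have hQ : ∀ j, Tendsto (fun t => ‖relPos (ζ t).1 j‖) (𝓝[<] b) (𝓝 ‖relPos q j‖) := fun j =>
    (((continuous_apply j).comp continuous_relPos).norm.tendsto q).comp hlim
  have hne := fun j (hj : j ≠ i) => relPos_ne_zero_of_ne hi hq hj
  obtain ⟨C₁, hC₁⟩ := eventually_force_le m hne
  obtain ⟨B, hB⟩ := eventually_norm_le_of_hasDerivAt (f := fun t => (ζ t).2 (thirdBody i))
    (f' := fun t => (threeBodyField m (ζ t)).2 (thirdBody i)) (b := b) (C := C₁) (by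
      filter_upwards [hlim.eventually hC₁, hIoo] with t h1 h2
      exact ⟨hasDerivAt_pi.1 (hζ.hasDerivAt h2).snd _, h1 _ (hζ.2 t h2).1.1⟩)
  -- This is |Q_i|(h + U): the singular term of U becomes a constant and the others converge. Since
  -- each |p_c|² is at most 2m_c(h + U), it bounds |p_c|²|Q_i|.
  have hU : Tendsto (fun t => h * ‖relPos (ζ t).1 i‖ + (pairMass m i + ∑ j ∈ Finset.univ.erase i,
      pairMass m j * ‖relPos (ζ t).1 i‖ / ‖relPos (ζ t).1 j‖)) (𝓝[<] b)
      (𝓝 (h * ‖relPos q i‖ + (pairMass m i + ∑ j ∈ Finset.univ.erase i,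
        pairMass m j * ‖relPos q i‖ / ‖relPos q j‖))) :=
    ((hQ i).const_mul h).add (tendsto_const_nhds.add (tendsto_finsetSum _ fun j hj =>
      ((hQ i).const_mul _).div (hQ j) (norm_ne_zero_iff.2 (hne j (Finset.ne_of_mem_erase hj)))))
  obtain ⟨D, hD⟩ := hU.isBoundedUnder_le
  replace hD := eventually_map.1 hD
  have hR : ∃ R, ∀ᶠ t in 𝓝[<] b, ∀ j, ‖relPos (ζ t).1 j‖ ≤ R := by
    refine ⟨‖relPos q‖ + 1, ?_⟩
    have := ((continuous_relPos.norm.tendsto q).comp hlim).eventually (gt_mem_nhds (lt_add_one _))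
    filter_upwards [this] with t ht j
    exact (norm_le_pi_norm _ j).trans ht.le
  obtain ⟨R, hR⟩ := hR
  have hM : ∃ M, ∀ a, 2 * m a ≤ M := ⟨2 * totalMass m, fun a => by
    have := Finset.single_le_sum (f := m) (fun j _ => (hm j).le) (Finset.mem_univ a)
    simp only [totalMass]
    linarith⟩
  obtain ⟨M, hM⟩ := hM
  refine ⟨max (B ^ 2 * R) (M * D), ?_⟩
  filter_upwards [hB, hD, hR, hIoo] with t hB hD hR ht
  obtain ⟨P, hP, hPj, c, hPi⟩ := exists_absMom_eq_thirdBody (hζ.2 t ht).1.2 i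
  refine ⟨P, hP, fun j => ?_⟩
  by_cases hj : j = i
  · subst hj
    refine le_max_of_le_right ?_
    rw [hPi]
    have h1 := (hζ.2 t ht).2
    have h2 := norm_mul_newtonU m (hζ.2 t ht).1.1 j
    rw [← h2] at hD
    have h3 : ‖(ζ t).2 c‖ ^ 2 / (2 * m c) ≤ kineticAbs m (ζ t).2 :=
      Finset.single_le_sum (f := fun k => ‖(ζ t).2 k‖ ^ 2 / (2 * m k))
        (fun k _ => div_nonneg (sq_nonneg _) (by linarith [hm k])) (Finset.mem_univ c)
    have hmc := hm c
    have h4 : ‖(ζ t).2 c‖ ^ 2 ≤ (2 * m c) * (h + newtonU m (relPos (ζ t).1)) := by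
      rw [div_le_iff₀ (by linarith)] at h3
      rw [threeBodyHam] at h1
      rw [← h1]
      linarith
    have hn := norm_nonneg (relPos (ζ t).1 j)
    have hD0 : 0 ≤ (h + newtonU m (relPos (ζ t).1)) * ‖relPos (ζ t).1 j‖ := by
      refine mul_nonneg ?_ hn
      by_contra! h5
      nlinarith [sq_nonneg ‖(ζ t).2 c‖]
    calc ‖(ζ t).2 c‖ ^ 2 * ‖relPos (ζ t).1 j‖
        ≤ (2 * m c) * (h + newtonU m (relPos (ζ t).1)) * ‖relPos (ζ t).1 j‖ :=
          mul_le_mul_of_nonneg_right h4 hn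
      _ = (2 * m c) * ((h + newtonU m (relPos (ζ t).1)) * ‖relPos (ζ t).1 j‖) := by ring
      _ ≤ M * ((h + newtonU m (relPos (ζ t).1)) * ‖relPos (ζ t).1 j‖) :=
          mul_le_mul_of_nonneg_right (hM c) hD0
      _ ≤ M * D := mul_le_mul_of_nonneg_left (by linarith) (by linarith [hM c])
  · refine le_max_of_le_left ?_
    have h1 : ‖P j‖ ≤ B := (hPj j hj).trans hB
    exact mul_le_mul (pow_le_pow_left₀ (norm_nonneg _) h1 2) (hR j) (norm_nonneg _) (sq_nonneg _)

end BinaryCollision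

/-! ### Lagrange-Jacobi identity and its growth rate in regularized time -/

section Virial

theorem relPos_smul (c : ℝ) (q : Vec3) : relPos (c • q) = c • relPos q := by
  funext i
  fin_cases i <;> simp [relPos, mul_sub]

theorem newtonU_smul (m : Fin 3 → ℝ) {c : ℝ} (hc : 0 < c) (Q : Vec3) :
    newtonU m (c • Q) = newtonU m Q / c := by
  rw [newtonU, newtonU, Finset.sum_div]
  refine Finset.sum_congr rfl fun i _ => ?_
  rw [Pi.smul_apply, norm_smul, Real.norm_eq_abs, abs_of_pos hc, div_div, mul_comm]

theorem kineticAbs_smul (m : Fin 3 → ℝ) (c : ℝ) (p : Vec3) :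
    kineticAbs m (c • p) = c ^ 2 * kineticAbs m p := by
  rw [kineticAbs, kineticAbs, Finset.mul_sum]
  refine Finset.sum_congr rfl fun i _ => ?_
  rw [Pi.smul_apply, norm_smul, mul_pow, Real.norm_eq_abs, sq_abs, mul_div_assoc]

/-- Kinetic energy has degree 2 in the momenta and U has degree -1 in the positions. -/
theorem fderiv_threeBodyHam_dilation (m : Fin 3 → ℝ) {y : Phase} (hy : y ∈ threeBodyDomain) :
    fderiv ℝ (threeBodyHam m) y (-y.1, y.2) =
      2 * kineticAbs m y.2 - newtonU m (relPos y.1) := by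
  refine fderiv_threeBodyHam_of_curve m hy (hasDerivAt_line y _) (by simp) ?_
  have h1 : HasDerivAt (fun u : ℝ => (1 + u) ^ 2 * kineticAbs m y.2
      - newtonU m (relPos y.1) / (1 - u))
      (2 * kineticAbs m y.2 - newtonU m (relPos y.1)) 0 := by
    refine (((((hasDerivAt_id (0 : ℝ)).const_add 1).fun_pow 2).mul_const (kineticAbs m y.2)).sub
      ((hasDerivAt_const (0 : ℝ) (newtonU m (relPos y.1))).fun_div
        ((hasDerivAt_id (0 : ℝ)).const_sub 1) (by simp))).congr_deriv ?_
    simp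
  refine h1.congr_of_eventuallyEq ?_
  filter_upwards [Iio_mem_nhds (zero_lt_one' ℝ)] with u hu
  have e1 : (y + u • ((-y.1, y.2) : Phase)).1 = (1 - u) • y.1 := by
    change y.1 + u • -y.1 = _
    module
  have e2 : (y + u • ((-y.1, y.2) : Phase)).2 = (1 + u) • y.2 := by
    simp [add_smul]
  rw [threeBodyHam, e1, e2, relPos_smul, newtonU_smul m (sub_pos.2 hu), kineticAbs_smul]

/-- The Lagrange-Jacobi identity. -/
theorem IsThreeBodyCurve.hasDerivAt_virial {m : Fin 3 → ℝ} {h : ℝ} {ζ : ℝ → Phase} {I : Set ℝ}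
    (hζ : IsThreeBodyCurve m h ζ I) {t : ℝ} (ht : t ∈ I) :
    HasDerivAt (fun t => ip (ζ t).1 (ζ t).2) (newtonU m (relPos (ζ t).1) + 2 * h) t := by
  have h1 := hζ.hasDerivAt ht
  refine (hasDerivAt_ip h1.fst h1.snd).congr_deriv ?_
  have h2 := omegaPhase_threeBodyField m (ζ t) (-(ζ t).1, (ζ t).2)
  rw [fderiv_threeBodyHam_dilation m (hζ.2 t ht).1.1, omegaPhase_eq] at h2
  have h3 := (hζ.2 t ht).2
  rw [threeBodyHam] at h3
  have h4 : ∀ v w : Vec3, ip v (-w) = -ip v w := fun v w => by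
    simpa using ip_smul_right (-1) v w
  rw [h4, sub_neg_eq_add] at h2
  rw [ip_comm _ (ζ t).2, ip_comm (ζ t).1]
  linarith

theorem abs_ip_le (v w : Vec3) : |ip v w| ≤ ∑ i, ‖v i‖ * ‖w i‖ := by
  refine (Complex.abs_re_le_norm _).trans ((norm_sum_le _ _).trans (Finset.sum_le_sum fun i _ => ?_))
  rw [norm_mul, Complex.norm_conj]

/-- The time rescaling factor as a function of the relative positions. -/
def relTau (Q : Vec3) : ℝ := ‖Q 0‖ * ‖Q 1‖ * ‖Q 2‖ / (∑ i, ‖Q i‖) ^ 3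

theorem norm_relPos_bodyPositions {m : Fin 3 → ℝ} (hm : ∀ i, 0 < m i) {x : ExtPhase}
    (hx : x ∈ constraintSet) (i : Fin 3) :
    ‖relPos (bodyPositions m x) i‖ = x.1.1 / massNormZ m x.2.1 * rho x.2.1 i := by
  have hM := massNormZ_pos hm hx.1.2
  have hr : 0 < x.1.1 := hx.1.1
  rw [relPos_bodyPositions_apply hm hx.2.2, norm_mul, Complex.norm_real, Real.norm_eq_abs,
    abs_of_pos (by positivity), norm_pow, rho]

theorem tau_eq_relTau {m : Fin 3 → ℝ} (hm : ∀ i, 0 < m i) {x : ExtPhase}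
    (hx : x ∈ constraintSet) : tau x.2.1 = relTau (relPos (bodyPositions m x)) := by
  have hM := massNormZ_pos hm hx.1.2
  have hr : 0 < x.1.1 := hx.1.1
  have hn := normSqZ_pos hx.1.2
  simp only [relTau, norm_relPos_bodyPositions hm hx, ← Finset.mul_sum, tau]
  rw [show ∑ i, rho x.2.1 i = normSqZ x.2.1 from rfl]
  field_simp

theorem sum_norm_pos {Q : Vec3} (hQ : Q ≠ 0) : 0 < ∑ i, ‖Q i‖ := by
  obtain ⟨i, hi⟩ := Function.ne_iff.1 hQ
  exact Finset.sum_pos' (fun i _ => norm_nonneg _) ⟨i, Finset.mem_univ i, norm_pos_iff.2 hi⟩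

/-- The product τU extends continuously to a collision of one pair, with a positive limit there,
whereas 2hτ tends to zero. -/
theorem IsThreeBodyCurve.eventually_virial {m : Fin 3 → ℝ} (hm : ∀ i, 0 < m i) {h a b : ℝ}
    (hab : a < b) {ζ : ℝ → Phase} (hζ : IsThreeBodyCurve m h ζ (Ioo a b)) {q : Vec3}
    (hlim : Tendsto (fun t => (ζ t).1) (𝓝[<] b) (𝓝 q)) {i : Fin 3} (hi : relPos q i = 0)
    (hq : relPos q ≠ 0) :
    ∃ δ > 0, ∀ᶠ t in 𝓝[<] b,
      δ ≤ relTau (relPos (ζ t).1) * (newtonU m (relPos (ζ t).1) + 2 * h) := by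
  -- The expression τ(U + 2h) with the denominators of U cancelled.
  let W : Vec3 → ℝ := fun Q => (pairMass m 0 * ‖Q 1‖ * ‖Q 2‖ + pairMass m 1 * ‖Q 0‖ * ‖Q 2‖
    + pairMass m 2 * ‖Q 0‖ * ‖Q 1‖ + 2 * h * (‖Q 0‖ * ‖Q 1‖ * ‖Q 2‖)) / (∑ i, ‖Q i‖) ^ 3
  have hW : ContinuousAt W (relPos q) := by
    refine ContinuousAt.div (by fun_prop) ?_ (pow_pos (sum_norm_pos hq) 3).ne'
    simp only [Fin.sum_univ_three]
    fun_prop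
  have hpos : 0 < W (relPos q) := by
    refine div_pos ?_ (pow_pos (sum_norm_pos hq) 3)
    have hn := fun j (hj : j ≠ i) => norm_pos_iff.2 (relPos_ne_zero_of_ne hi hq hj)
    have p0 := pairMass_pos hm 0
    have p1 := pairMass_pos hm 1
    have p2 := pairMass_pos hm 2
    fin_cases i
    · have e1 := hn 1 (by decide)
      have e2 := hn 2 (by decide)
      simp only [Fin.zero_eta] at hi
      simp only [hi, norm_zero, zero_mul, mul_zero, add_zero]
      positivity
    · have e1 := hn 0 (by decide)
      have e2 := hn 2 (by decide)
      simp only [Fin.mk_one] at hi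
      simp only [hi, norm_zero, zero_mul, mul_zero, add_zero, zero_add]
      positivity
    · have e1 := hn 0 (by decide)
      have e2 := hn 1 (by decide)
      simp only [Fin.reduceFinMk] at hi
      simp only [hi, norm_zero, mul_zero, add_zero, zero_add]
      positivity
  refine ⟨W (relPos q) / 2, half_pos hpos, ?_⟩
  have hlim' := (hW.tendsto.comp ((continuous_relPos.tendsto q).comp hlim)).eventually
    (lt_mem_nhds (half_lt_self hpos))
  filter_upwards [hlim', Ioo_mem_nhdsLT hab] with t h1 ht
  refine h1.le.trans_eq ?_
  have hQ := fun j => norm_ne_zero_iff.2 ((hζ.2 t ht).1.1 j)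
  have h0 := hQ 0
  have h1 := hQ 1
  have h2 := hQ 2
  simp only [Function.comp_apply, W, relTau, newtonU]
  rw [div_mul_eq_mul_div]
  congr 1
  rw [Fin.sum_univ_three]
  field_simp

end Virial

/-! ### Compactness of lifts modulo symmetries -/

section Compactness

/-- The lifts of states near a collision of one pair stay in a compact set. -/
theorem exists_isCompact_liftPoint {m : Fin 3 → ℝ} (hm : ∀ i, 0 < m i) {δ : ℝ} (hδ : 0 < δ)
    (R C : ℝ) : ∃ K ⊆ extDomain, IsCompact K ∧ ∀ z P : Vec3, δ ≤ ‖z‖ → ‖z‖ ≤ R →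
      (∀ j, ‖P j‖ * ‖z j‖ ≤ C) → liftPoint m (z, P) ∈ K := by
  -- `liftPoint` rewritten in the variables z and P_j conj z_j. The latter stay bounded at a
  -- collision although P does not, and the formula extends continuously to points where a component
  -- of z vanishes.
  let L : Phase → ExtPhase := fun y =>
    ((massNormZ m y.1, ip y.2 y.1 / massNormZ m y.1), (y.1, fun i => 2 * (y.2 i - conj (y.1 i) *
      (((ip y.2 y.1 / massNormZ m y.1 / massNormZ m y.1 : ℝ) : ℂ) *
        (((pairMass m i / totalMass m : ℝ) : ℂ) * y.1 i ^ 2)))))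
  let S : Set Phase := {y | δ ≤ ‖y.1‖ ∧ ‖y.1‖ ≤ R ∧ ‖y.2‖ ≤ max C 0}
  have hS0 : ∀ y ∈ S, y.1 ≠ 0 := fun y hy => norm_pos_iff.1 (hδ.trans_le hy.1)
  have hS : IsCompact S := by
    refine Metric.isCompact_of_isClosed_isBounded ?_ ?_
    · exact (isClosed_le continuous_const continuous_fst.norm).inter
        ((isClosed_le continuous_fst.norm continuous_const).inter
          (isClosed_le continuous_snd.norm continuous_const))
    · refine isBounded_iff_forall_norm_le.2 ⟨max R (max C 0), fun y hy => ?_⟩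
      exact max_le_max hy.2.1 hy.2.2
  have hM : ContinuousOn (fun y : Phase => massNormZ m y.1) S := by
    have : Continuous fun y : Phase => fun i => y.1 i ^ 2 := by fun_prop
    exact ((continuous_massNorm m).comp this).continuousOn
  have hip : Continuous fun y : Phase => ip y.2 y.1 := by
    simp only [ip_eq]
    fun_prop
  have hM0 : ∀ y ∈ S, massNormZ m y.1 ≠ 0 := fun y hy => (massNormZ_pos hm (hS0 y hy)).ne'
  have hq := hip.continuousOn.div hM hM0
  have hL : ContinuousOn L S := by
    refine (hM.prodMk hq).prodMk (continuousOn_fst.prodMk (continuousOn_pi.2 fun i => ?_))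
    refine continuousOn_const.mul (ContinuousOn.sub (by fun_prop) (ContinuousOn.mul (by fun_prop)
      (ContinuousOn.mul ?_ (by fun_prop))))
    exact Complex.continuous_ofReal.comp_continuousOn (hq.div hM hM0)
  refine ⟨L '' S, ?_, hS.image_of_continuousOn hL, fun z P h1 h2 h3 =>
    ⟨(z, fun j => P j * conj (z j)), ⟨h1, h2, ?_⟩, ?_⟩⟩
  · rintro _ ⟨y, hy, rfl⟩
    exact ⟨massNormZ_pos hm (hS0 y hy), hS0 y hy⟩
  · refine (pi_norm_le_iff_of_nonneg (le_max_right _ _)).2 fun j => ?_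
    rw [norm_mul, Complex.norm_conj]
    exact (h3 j).trans (le_max_left _ _)
  · have hi : ip (fun j => P j * conj (z j)) z = ip P fun i => z i ^ 2 := by
      rw [ip, ip, pairing, pairing]
      congr 1
      refine Finset.sum_congr rfl fun j _ => ?_
      simp
      ring
    refine Prod.ext ?_ (Prod.ext rfl ?_)
    · simp only [L, liftPoint, hi]
      rfl
    · funext j
      simp only [L, liftPoint, hi, massDual]
      rw [show massNorm m (fun i => z i ^ 2) = massNormZ m z from rfl]
      ring

/-- For the normalized z, |z_j|² = |Q_j|, so the bound on |P_j|²|Q_j| is a bound on |P_j||z_j|. As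
|Q_j| is bounded too, so is |P_j||Q_j|, hence the virial. -/
theorem IsThreeBodyCurve.exists_isCompact_lift {m : Fin 3 → ℝ} (hm : ∀ i, 0 < m i) {h a b : ℝ}
    (hab : a < b) {ζ : ℝ → Phase} (hζ : IsThreeBodyCurve m h ζ (Ioo a b)) {q : Vec3}
    (hlim : Tendsto (fun t => (ζ t).1) (𝓝[<] b) (𝓝 q)) {i : Fin 3} (hi : relPos q i = 0)
    (hq : relPos q ≠ 0) :
    (∃ K ⊆ extDomain, IsCompact K ∧ ∀ᶠ t in 𝓝[<] b, ∀ x ∈ collisionFree,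
      translationSetoid (bodyState m x) (ζ t) → ∃ y ∈ K, symmetrySetoid x y) ∧
    ∃ B, ∀ᶠ t in 𝓝[<] b, |ip (ζ t).1 (ζ t).2| ≤ B := by
  obtain ⟨C, hC⟩ := hζ.exists_absMom_bound hm hab hlim hi hq
  have hn := (continuous_relPos.norm.tendsto q).comp hlim
  have hq0 := norm_pos_iff.2 hq
  have hlow := hn.eventually (lt_mem_nhds (half_lt_self hq0))
  have hup := hn.eventually (gt_mem_nhds (lt_add_one ‖relPos q‖))
  constructor
  · obtain ⟨K, hK, hKc, H⟩ := exists_isCompact_liftPoint hm (δ := √(‖relPos q‖ / 2))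
      (Real.sqrt_pos.2 (half_pos hq0)) √(‖relPos q‖ + 1) √C
    refine ⟨K, hK, hKc, ?_⟩
    filter_upwards [hC, hlow, hup] with t ⟨P, hP, hPC⟩ h1 h2 x hx hxt
    obtain ⟨c, hc⟩ := hxt
    have hQ : relPos (bodyPositions m x) = relPos (ζ t).1 := by
      rw [hc, relPos_add_const]
      rfl
    have hz : ∀ j, ‖normalizedZ m x j‖ ^ 2 = ‖relPos (ζ t).1 j‖ := fun j => by
      rw [← norm_pow, normalizedZ_sq hm hx.1.1, ← hQ, relPos_bodyPositions hm hx.1.2.2]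
    refine ⟨_, H (normalizedZ m x) P ?_ ?_ fun j => ?_,
      symmetrySetoid_liftPoint hm hx (by rw [hP, hc])⟩
    · obtain ⟨j, hj⟩ : ∃ j, ‖relPos q‖ / 2 < ‖relPos (ζ t).1 j‖ := by
        by_contra! hcon
        exact absurd h1 ((pi_norm_le_iff_of_nonneg (half_pos hq0).le).2 hcon).not_gt
      refine le_trans ?_ (norm_le_pi_norm _ j)
      rw [Real.sqrt_le_left (norm_nonneg _), hz]
      exact hj.le
    · refine (pi_norm_le_iff_of_nonneg (Real.sqrt_nonneg _)).2 fun j => Real.le_sqrt_of_sq_le ?_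
      rw [hz]
      exact (norm_le_pi_norm _ j).trans (le_of_lt h2)
    · refine Real.le_sqrt_of_sq_le ?_
      rw [mul_pow, hz]
      exact hPC j
  · refine ⟨3 * (C + (‖relPos q‖ + 1)), ?_⟩
    filter_upwards [hC, hup] with t ⟨P, hP, hPC⟩ h2
    rw [ip_comm, ← hP, ip_absMom]
    refine (abs_ip_le _ _).trans ?_
    have hj : ∀ j, ‖P j‖ * ‖relPos (ζ t).1 j‖ ≤ C + (‖relPos q‖ + 1) := fun j => by
      have h3 := hPC j
      have h4 : ‖relPos (ζ t).1 j‖ ≤ ‖relPos q‖ + 1 := (norm_le_pi_norm _ j).trans (le_of_lt h2)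
      have h5 := norm_nonneg (relPos (ζ t).1 j)
      nlinarith [mul_nonneg (sq_nonneg (‖P j‖ - 1)) h5, mul_nonneg (sq_nonneg ‖P j‖) h5]
    refine (Finset.sum_le_sum fun j _ => hj j).trans_eq ?_
    simp
    ring

end Compactness

/-! ### Extension of lifts through a binary collision -/

section Extension

/-- A lifted trajectory that ends in a binary collision extends beyond the collision. -/
theorem IsThreeBodyCurve.exists_lift_through_collision {m : Fin 3 → ℝ} (hm : ∀ i, 0 < m i)
    {h a b : ℝ} {ζ : ℝ → Phase} (hζ : IsThreeBodyCurve m h ζ (Ioo a b)) {q : Vec3}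
    (hlim : Tendsto (fun t => (ζ t).1) (𝓝[<] b) (𝓝 q)) {i : Fin 3} (hi : relPos q i = 0)
    (hq : relPos q ≠ 0) {t₀ : ℝ} (ht₀ : t₀ ∈ Ioo a b) {x₀ : ExtPhase} (hx₀ : x₀ ∈ collisionFree)
    (h₀ : translationSetoid (bodyState m x₀) (ζ t₀)) :
    ∃ (J : Set ℝ) (γ : ℝ → ExtPhase) (θ : ℝ → ℝ), ∃ s₁ ∈ J,
      IsOpenInterval J ∧ IsZeroLevelCurve m h γ J ∧ (∃ s₀ ∈ J, γ s₀ = x₀ ∧ θ s₀ = t₀) ∧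
      (∀ s ∈ J, HasDerivAt θ (tau (γ s).2.1) s) ∧
      θ '' {s ∈ J | s < s₁} = Ioo a b ∧ θ s₁ = b ∧ (γ s₁).2.1 i = 0 ∧
      ∀ s ∈ J, s < s₁ → γ s ∈ collisionFree ∧
        translationSetoid (bodyState m (γ s)) (ζ (θ s)) := by
  have hab : a < b := ht₀.1.trans ht₀.2
  obtain ⟨J₀, γ₀, θ₀, hJ₀, hγ₀, ⟨s₀, hs₀, hγs₀, hθs₀⟩, hθ₀, himg, hcf⟩ :=
    hζ.exists_lift hm (isOpenInterval_Ioo a b) ht₀ hx₀ h₀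
  have hmono₀ : StrictMonoOn θ₀ J₀ := strictMonoOn_of_deriv_eventually_pos hJ₀ hθ₀
    (fun s _ => tau_nonneg _) fun s hs => by
      filter_upwards [hγ₀.eventually_collisionFree hm hJ₀ hs] with s' hs' using tau_pos hs'.2
  have hmem₀ : ∀ s ∈ J₀, θ₀ s ∈ Ioo a b := fun s hs => himg ▸ mem_image_of_mem θ₀ hs
  have hrel : ∀ s ∈ J₀, relPos (bodyPositions m (γ₀ s)) = relPos (ζ (θ₀ s)).1 := fun s hs => by
    obtain ⟨c, hc⟩ := (hcf s hs).2
    rw [hc, relPos_add_const]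
    rfl
  obtain ⟨⟨K, hK, hKc, hcomp⟩, B, hB⟩ := hζ.exists_isCompact_lift hm hab hlim hi hq
  obtain ⟨δ, hδ, hvir⟩ := hζ.eventually_virial hm hab hlim hi hq
  obtain ⟨l, hl, hgood⟩ := mem_nhdsLT_iff_exists_Ioo_subset.1
    ((hcomp.and (hB.and hvir)).and (Ioo_mem_nhdsLT hab))
  have hl' : l < b := hl
  -- A parameter after which all estimates near the collision hold.
  obtain ⟨s₂, hs₂, hθs₂⟩ : (max l a + b) / 2 ∈ θ₀ '' J₀ := by
    rw [himg]
    constructor <;> rcases max_cases l a with h | h <;> linarith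
  have hlate : ∀ s ∈ J₀, s₂ ≤ s → θ₀ s ∈ Ioo l b := fun s hs hle => by
    refine ⟨lt_of_lt_of_le ?_ (hmono₀.monotoneOn hs₂ hs hle), (hmem₀ s hs).2⟩
    rw [hθs₂]
    have := le_max_left l a
    have := max_lt hl' hab
    linarith
  -- In the parameter s the virial grows at rate at least `δ` while staying within ±`B`, so at most
  -- 2B/δ of parameter is left after `s₂`.
  have hbdd : BddAbove J₀ := by
    refine ⟨s₂ + 2 * B / δ, fun s hs => ?_⟩
    rcases le_total s s₂ with hle | hle
    · have h1 := (hgood (hlate s₂ hs₂ le_rfl)).1.2.1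
      have h2 := (abs_nonneg _).trans h1
      have : 0 ≤ 2 * B / δ := by positivity
      linarith
    · have hsub : Icc s₂ s ⊆ J₀ := hJ₀.2.out hs₂ hs
      have hd : ∀ u ∈ Icc s₂ s, HasDerivAt (fun u => ip (ζ (θ₀ u)).1 (ζ (θ₀ u)).2)
          ((newtonU m (relPos (ζ (θ₀ u)).1) + 2 * h) * tau (γ₀ u).2.1) u := fun u hu =>
        (hζ.hasDerivAt_virial (hmem₀ u (hsub hu))).comp u (hθ₀ u (hsub hu))
      have h1 := (convex_Icc s₂ s).mul_sub_le_image_sub_of_le_deriv (C := δ)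
        (fun u hu => (hd u hu).continuousAt.continuousWithinAt)
        (fun u hu => (hd u (interior_subset hu)).differentiableAt.differentiableWithinAt)
        (fun u hu => by
          have hu' := interior_subset hu
          have h2 := (hgood (hlate u (hsub hu') hu'.1)).1.2.2
          rwa [(hd u hu').deriv, tau_eq_relTau hm (hγ₀.2 u (hsub hu')).1, hrel u (hsub hu'),
            mul_comm])
        s₂ (left_mem_Icc.2 hle) s (right_mem_Icc.2 hle) hle
      have h2 := abs_le.1 (hgood (hlate s₂ hs₂ le_rfl)).1.2.1
      have h3 := abs_le.1 (hgood (hlate s hs hle)).1.2.1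
      rw [← sub_le_iff_le_add', le_div_iff₀ hδ]
      linarith [h2.1, h3.2]
  set e := sSup J₀ with he
  have hnext : ∀ s ∈ J₀, ∃ s' ∈ J₀, s < s' := fun s hs => by
    obtain ⟨t, ht1, ht2⟩ := exists_between (hmem₀ s hs).2
    obtain ⟨s', hs', rfl⟩ : t ∈ θ₀ '' J₀ := himg ▸ ⟨(hmem₀ s hs).1.trans ht1, ht2⟩
    exact ⟨s', hs', (hmono₀.lt_iff_lt hs hs').1 ht1⟩
  have hlt : ∀ s ∈ J₀, s < e := fun s hs => by
    obtain ⟨s', hs', h1⟩ := hnext s hs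
    exact h1.trans_le (le_csSup hbdd hs')
  -- `s₁` is chosen within `ε` of the end `e`. The state there is equivalent to a point of `K`, and
  -- a symmetry moves the solution through that point, which lasts beyond `e`, onto the lift.
  obtain ⟨ε, hε, hsol⟩ := exists_uniform_isSol isOpen_extDomain (contDiffOn_regField hm h) hKc hK
  obtain ⟨s₁, hs₁, hs₁'⟩ := exists_lt_of_lt_csSup ⟨s₀, hs₀⟩
    (max_lt (hlt s₂ hs₂) (sub_lt_self e hε))
  obtain ⟨hs₁₂, hs₁e⟩ := max_lt_iff.1 hs₁'
  obtain ⟨y, hy, hxy⟩ := (hgood (hlate s₁ hs₁ hs₁₂.le)).1.1 _ (hcf s₁ hs₁).1 (hcf s₁ hs₁).2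
  obtain ⟨g, k, c, hk, hg, hgy⟩ := gaugeRel_of_setoid (Setoid.symm' _ hxy)
  obtain ⟨α, hα1, hα⟩ := hsol y hy s₁
  have hα' := (isRegCurve_iff.2 hα).gaugeAct hk hg c hm
  set B₁ := Ioo (s₁ - ε) (s₁ + ε)
  have hs₁B : s₁ ∈ B₁ := ⟨by linarith, by linarith⟩
  have hover : EqOn γ₀ (fun s => gaugeAct g c (α s)) (J₀ ∩ B₁) := by
    refine IsRegCurve.eqOn hm (hJ₀.inter (isOpenInterval_Ioo _ _))
      (fun s hs => hγ₀.1 s hs.1) (fun s hs => hα' s hs.2) ⟨hs₁, hs₁B⟩ ?_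
    simp only [hα1]
    exact hgy
  -- Only the part after `s₁` is glued: the other half might reach below `J₀`, and then the
  -- parameters before `e` would no longer correspond exactly to (a, b).
  have hsubB : Ioo s₁ (s₁ + ε) ⊆ B₁ := Ioo_subset_Ioo_left (by linarith)
  obtain ⟨γ, hγJ, hγB⟩ := exists_eqOn_eqOn (hover.mono (inter_subset_inter_right J₀ hsubB))
  have heB : e ∈ Ioo s₁ (s₁ + ε) := ⟨hlt s₁ hs₁, by linarith⟩
  have hJ : IsOpenInterval (J₀ ∪ Ioo s₁ (s₁ + ε)) := by
    obtain ⟨s', hs', h1⟩ := hnext s₁ hs₁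
    exact hJ₀.union (isOpenInterval_Ioo _ _) hs' ⟨h1, (hlt s' hs').trans heB.2⟩
  set J := J₀ ∪ Ioo s₁ (s₁ + ε) with hJdef
  have hγ : IsRegCurve m h γ J := by
    rw [isRegCurve_iff]
    rintro s (hs | hs)
    · exact (isRegCurve_iff.1 hγ₀.1).congr hJ₀.1 hγJ s hs
    · exact ((isRegCurve_iff.1 hα').mono hsubB).congr isOpen_Ioo hγB s hs
  have hγ0 : IsZeroLevelCurve m h γ J := by
    have h1 : γ s₁ ∈ constraintSet ∧ regHam m h (γ s₁) = 0 := by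
      rw [hγJ hs₁]
      exact hγ₀.2 s₁ hs₁
    exact ⟨hγ, fun s hs => ⟨hγ.mem_constraintSet hm hJ (Or.inl hs₁) h1.1 hs,
      (hγ.regHam_eq hm hJ (Or.inl hs₁) hs).trans h1.2⟩⟩
  have hγc : ContinuousOn γ J := (isRegCurve_iff.1 hγ).continuousOn
  have hdom : ∀ s ∈ J, γ s ∈ extDomain := fun s hs => (hγ s hs).1
  obtain ⟨θ, hθs, hθ⟩ := exists_primitive hJ (continuousOn_tau.comp hγc hdom) (Or.inl hs₀) t₀
  have hθJ : EqOn θ θ₀ J₀ := fun s hs => by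
    have h1 := eq_of_hasDerivAt_zero hJ₀ (f := fun s => θ s - θ₀ s) (fun u hu => by
      refine ((hθ u (Or.inl hu)).sub (hθ₀ u hu)).congr_deriv ?_
      simp only [Function.comp_apply, hγJ hu, sub_self]) hs hs₀
    simp only [hθs, hθs₀, sub_self] at h1
    linarith
  have hmono : StrictMonoOn θ J := strictMonoOn_of_deriv_eventually_pos hJ hθ
    (fun s _ => tau_nonneg _) fun s hs => by
      filter_upwards [hγ0.eventually_collisionFree hm hJ hs] with s' hs' using tau_pos hs'.2
  have hbefore : {s ∈ J | s < e} = J₀ := by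
    ext s
    refine ⟨?_, fun hs => ⟨Or.inl hs, hlt s hs⟩⟩
    rintro ⟨hs | hs, hse⟩
    · exact hs
    · obtain ⟨s', hs', h1⟩ := exists_lt_of_lt_csSup ⟨s₀, hs₀⟩ hse
      exact hJ₀.2.out hs₁ hs' ⟨hs.1.le, h1.le⟩
  have heJ : e ∈ J := Or.inr heB
  have hnhds : ∀ᶠ s in 𝓝[<] e, s ∈ J₀ := by
    filter_upwards [self_mem_nhdsWithin, mem_nhdsWithin_of_mem_nhds (hJ.1.mem_nhds heJ)]
      with s h1 h2
    rw [← hbefore]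
    exact ⟨h2, h1⟩
  have hθtend : Tendsto θ (𝓝[<] e) (𝓝 (θ e)) :=
    (hθ e heJ).continuousAt.tendsto.mono_left nhdsWithin_le_nhds
  have hθe : θ e = b := by
    refine le_antisymm (le_of_tendsto hθtend ?_) (le_of_forall_lt fun t ht => ?_)
    · filter_upwards [hnhds] with s hs
      rw [hθJ hs]
      exact (hmem₀ s hs).2.le
    · obtain ⟨t', ht1, ht2⟩ := exists_between (max_lt ht hab)
      obtain ⟨s, hs, rfl⟩ : t' ∈ θ₀ '' J₀ := himg ▸ ⟨(le_max_right _ _).trans_lt ht1, ht2⟩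
      rw [← hθJ hs] at ht1
      exact ((le_max_left _ _).trans_lt ht1).trans (hmono (Or.inl hs) heJ (hlt s hs))
  refine ⟨J, γ, θ, e, heJ, hJ, hγ0, ⟨s₀, Or.inl hs₀, (hγJ hs₀).trans hγs₀, hθs⟩, hθ, ?_, hθe,
    ?_, fun s hs hse => ?_⟩
  · rw [hbefore, hθJ.image_eq, himg]
  -- The positions are continuous along `γ` and agree with those of `ζ` up to translation before
  -- `e`, so their limit identifies the colliding pair.
  · rw [← relPos_bodyPositions_eq_zero_iff hm (hγ0.2 e heJ).1]
    have hcont := continuous_relPos.comp_continuousOn ((continuousOn_bodyPositions hm).comp hγc hdom)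
    have h1 : Tendsto (fun s => relPos (bodyPositions m (γ s)) i) (𝓝[<] e)
        (𝓝 (relPos (bodyPositions m (γ e)) i)) :=
      (((continuous_apply i).comp_continuousOn hcont).continuousAt
        (hJ.1.mem_nhds heJ)).tendsto.mono_left nhdsWithin_le_nhds
    have h2 : Tendsto θ (𝓝[<] e) (𝓝[<] b) := by
      refine tendsto_nhdsWithin_iff.2 ⟨hθe ▸ hθtend, ?_⟩
      filter_upwards [hnhds] with s hs
      rw [hθJ hs]
      exact (hmem₀ s hs).2
    have h3 := (((continuous_apply i).comp continuous_relPos).tendsto q).comp (hlim.comp h2)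
    refine (tendsto_nhds_unique (h1.congr' ?_) h3).trans hi
    filter_upwards [hnhds] with s hs
    simp only [Function.comp_apply, hγJ hs, hθJ hs, hrel s hs]
  · have hs' : s ∈ J₀ := hbefore ▸ (⟨hs, hse⟩ : s ∈ {s ∈ J | s < e})
    rw [hγJ hs', hθJ hs']
    exact hcf s hs'

end Extension

/-! ### Freeness of the symmetries and descent of the flow -/

section SymmetryGroup

theorem omegaExt_fderiv_gaugeAct {a : Fin 3 → ℝ} (ha : ∀ i, a i ≠ 0) (c : ℂ) (x v w : ExtPhase) :
    omegaExt (fderiv ℝ (gaugeAct a c) x v) (fderiv ℝ (gaugeAct a c) x w) = omegaExt v w := by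
  rw [show fderiv ℝ (gaugeAct a c) x = (gaugeEquiv a ha c : ExtPhase →L[ℝ] ExtPhase) from
    (gaugeEquiv a ha c).hasFDerivAt.fderiv]
  exact omegaExt_gaugeAct ha c v w

theorem eq_one_and_eq_zero_of_gaugeAct_eq {k : ℝ} (hk : 0 < k) {c : ℂ} {x : ExtPhase}
    (hx : x ∈ extDomain) (he : gaugeAct (fun _ => k) c x = x) : k = 1 ∧ c = 0 := by
  obtain ⟨i, hi⟩ := Function.ne_iff.1 hx.2
  have hi' : x.2.1 i ≠ 0 := hi
  have h1 : (k : ℂ) * x.2.1 i = x.2.1 i := congrFun (congrArg (fun y : ExtPhase => y.2.1) he) i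
  have hk1 : k = 1 := by
    have := mul_right_cancel₀ hi' (h1.trans (one_mul _).symm)
    exact_mod_cast this
  subst hk1
  have h2 := congrFun (congrArg (fun y : ExtPhase => y.2.2) he) i
  refine ⟨rfl, ?_⟩
  simpa [gaugeAct, hi'] using h2

/-- The regularized flow descends to the quotient by the symmetries. -/
theorem IsRegCurve.symmetrySetoid {m : Fin 3 → ℝ} (hm : ∀ i, 0 < m i) {h : ℝ} {J : Set ℝ}
    {γ₁ γ₂ : ℝ → ExtPhase} (hJ : IsOpenInterval J) (h₁ : IsRegCurve m h γ₁ J)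
    (h₂ : IsRegCurve m h γ₂ J) {s : ℝ} (hs : s ∈ J) (he : symmetrySetoid (γ₁ s) (γ₂ s)) {t : ℝ}
    (ht : t ∈ J) : ThreeBody.symmetrySetoid (γ₁ t) (γ₂ t) := by
  obtain ⟨k, hk, c, hc⟩ := he
  rw [shiftAct_scaleAct] at hc
  refine ⟨k, hk, c, ?_⟩
  rw [shiftAct_scaleAct]
  exact h₂.eqOn hm hJ (h₁.gaugeAct hk (fun _ => abs_of_pos hk) c hm) hs hc ht

end SymmetryGroup

end ThreeBody

end

/-! ### Regularization of the binary collisions: the combined statement -/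

theorem mainTheorem3 (m : Fin 3 → ℝ) (hm : ∀ i, 0 < m i) (h : ℝ) :
    -- The regularized Hamiltonian is smooth, also where some `z_ij` vanishes; elsewhere it is
    -- the pulled back spherical Hamiltonian, shifted by `h` and rescaled by `τ`.
    (ContDiffOn ℝ ∞ (ThreeBody.regHam m h) ThreeBody.extDomain ∧
      ∀ x ∈ ThreeBody.extDomain, (∀ i, x.2.1 i ≠ 0) →
        ThreeBody.regHam m h x =
          ThreeBody.tau x.2.1 * (ThreeBody.sphHam m (ThreeBody.leviCivita x) - h)) ∧
    -- Its Hamiltonian flow exists locally and is unique.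
    ((∀ x ∈ ThreeBody.extDomain, ∃ ε > 0, ∃ γ : ℝ → ThreeBody.ExtPhase,
        γ 0 = x ∧ ThreeBody.IsRegCurve m h γ (Ioo (-ε) ε)) ∧
      ∀ (J : Set ℝ) (γ₁ γ₂ : ℝ → ThreeBody.ExtPhase), ThreeBody.IsOpenInterval J →
        ThreeBody.IsRegCurve m h γ₁ J → ThreeBody.IsRegCurve m h γ₂ J →
        (∃ s ∈ J, γ₁ s = γ₂ s) → EqOn γ₁ γ₂ J) ∧
    -- The constraints define a submanifold, and it is invariant under the flow.
    (ThreeBody.IsSubmanifoldCutOutBy ThreeBody.extDomain ThreeBody.constraint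
        ThreeBody.constraintSet ∧
      ∀ (J : Set ℝ) (γ : ℝ → ThreeBody.ExtPhase), ThreeBody.IsOpenInterval J →
        ThreeBody.IsRegCurve m h γ J → (∃ s ∈ J, γ s ∈ ThreeBody.constraintSet) →
        ∀ s ∈ J, γ s ∈ ThreeBody.constraintSet) ∧
    -- Scalings and translations of `η` are free symplectic symmetries of the Hamiltonian and of
    -- the submanifold, and the flow descends to the quotient.
    ((∀ k : ℝ, 0 < k → ∀ x ∈ ThreeBody.extDomain,
        ThreeBody.scaleAct k x ∈ ThreeBody.extDomain ∧
        ThreeBody.regHam m h (ThreeBody.scaleAct k x) = ThreeBody.regHam m h x ∧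
        (x ∈ ThreeBody.constraintSet → ThreeBody.scaleAct k x ∈ ThreeBody.constraintSet) ∧
        ∀ v w, ThreeBody.omegaExt (fderiv ℝ (ThreeBody.scaleAct k) x v)
          (fderiv ℝ (ThreeBody.scaleAct k) x w) = ThreeBody.omegaExt v w) ∧
      (∀ c : ℂ, ∀ x ∈ ThreeBody.extDomain,
        ThreeBody.shiftAct c x ∈ ThreeBody.extDomain ∧
        ThreeBody.regHam m h (ThreeBody.shiftAct c x) = ThreeBody.regHam m h x ∧
        (x ∈ ThreeBody.constraintSet → ThreeBody.shiftAct c x ∈ ThreeBody.constraintSet) ∧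
        ∀ v w, ThreeBody.omegaExt (fderiv ℝ (ThreeBody.shiftAct c) x v)
          (fderiv ℝ (ThreeBody.shiftAct c) x w) = ThreeBody.omegaExt v w) ∧
      (∀ k : ℝ, 0 < k → ∀ c : ℂ, ∀ x ∈ ThreeBody.extDomain,
        ThreeBody.shiftAct c (ThreeBody.scaleAct k x) = x → k = 1 ∧ c = 0) ∧
      ∀ (J : Set ℝ) (γ₁ γ₂ : ℝ → ThreeBody.ExtPhase), ThreeBody.IsOpenInterval J →
        ThreeBody.IsRegCurve m h γ₁ J → ThreeBody.IsRegCurve m h γ₂ J →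
        (∃ s ∈ J, ThreeBody.symmetrySetoid (γ₁ s) (γ₂ s)) →
        ∀ s ∈ J, ThreeBody.symmetrySetoid (γ₁ s) (γ₂ s)) ∧
    -- Away from binary collisions, the quotient is an eight-sheeted covering of the zero total
    -- momentum phase space reduced by translations, compatible with the symplectic forms and
    -- with the Hamiltonians.
    ((∃ Φ : ThreeBody.ReducedCollisionFree → ThreeBody.ReducedThreeBody,
        (∀ x : ThreeBody.collisionFree,
          ∃ hx : ThreeBody.bodyState m x.1 ∈ ThreeBody.zeroMomentum,
            Φ (Quotient.mk _ x) = Quotient.mk _ ⟨ThreeBody.bodyState m x.1, hx⟩) ∧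
        IsCoveringMap Φ ∧ ∀ y, (Φ ⁻¹' {y}).ncard = 8) ∧
      ContDiffOn ℝ ∞ (ThreeBody.bodyState m)
        {x | x ∈ ThreeBody.extDomain ∧ ∀ i, x.2.1 i ≠ 0} ∧
      ∀ x ∈ ThreeBody.collisionFree,
        (ThreeBody.regHam m h x =
          ThreeBody.tau x.2.1 * (ThreeBody.threeBodyHam m (ThreeBody.bodyState m x) - h)) ∧
        ∀ v w, fderiv ℝ ThreeBody.constraint x v = 0 → fderiv ℝ ThreeBody.constraint x w = 0 →
          ThreeBody.omegaPhase (fderiv ℝ (ThreeBody.bodyState m) x v)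
            (fderiv ℝ (ThreeBody.bodyState m) x w) = ThreeBody.omegaExt v w) ∧
    -- The states with `z_ij = 0` are the binary collisions of the bodies `i` and `j`.
    (ContinuousOn (ThreeBody.bodyPositions m) ThreeBody.extDomain ∧
      ∀ x ∈ ThreeBody.constraintSet,
        ThreeBody.relPos (ThreeBody.bodyPositions m x) ≠ 0 ∧
        ∀ i, ThreeBody.relPos (ThreeBody.bodyPositions m x) i = 0 ↔ x.2.1 i = 0) ∧
    -- Every regularized curve on the zero level, after the time change `dt = τ ds`, is a
    -- three-body trajectory of energy `h`, except for isolated binary collisions, which it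
    -- crosses transversally and where the positions stay continuous.
    (∀ (J : Set ℝ) (γ : ℝ → ThreeBody.ExtPhase), ThreeBody.IsOpenInterval J →
      ThreeBody.IsZeroLevelCurve m h γ J →
      (∀ s ∈ J, ∀ i, (γ s).2.1 i = 0 →
        (∀ j, j ≠ i → (γ s).2.1 j ≠ 0) ∧ deriv (fun s' => (γ s').2.1 i) s ≠ 0) ∧
      (∀ s ∈ J, ∀ᶠ s' in 𝓝[≠] s, γ s' ∈ ThreeBody.collisionFree) ∧
      ∃ (θ : ℝ → ℝ) (ζ : ℝ → ThreeBody.Phase),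
        (∀ s ∈ J, HasDerivAt θ (ThreeBody.tau (γ s).2.1) s) ∧ StrictMonoOn θ J ∧
        ThreeBody.IsThreeBodyCurve m h ζ (θ '' {s ∈ J | γ s ∈ ThreeBody.collisionFree}) ∧
        (∀ s ∈ J, γ s ∈ ThreeBody.collisionFree → ζ (θ s) = ThreeBody.bodyState m (γ s)) ∧
        (∀ s ∈ J, (ζ (θ s)).1 = ThreeBody.bodyPositions m (γ s)) ∧
        ContinuousOn (fun t => (ζ t).1) (θ '' J)) ∧
    -- Conversely, every three-body trajectory with zero total momentum and energy `h` lifts,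
    -- modulo translations, to a regularized curve, from any given lift of an initial state.
    (∀ (I : Set ℝ) (ζ : ℝ → ThreeBody.Phase), ThreeBody.IsOpenInterval I →
      ThreeBody.IsThreeBodyCurve m h ζ I →
      ∀ t₀ ∈ I, ∀ x₀ ∈ ThreeBody.collisionFree,
        ThreeBody.translationSetoid (ThreeBody.bodyState m x₀) (ζ t₀) →
        ∃ (J : Set ℝ) (γ : ℝ → ThreeBody.ExtPhase) (θ : ℝ → ℝ),
          ThreeBody.IsOpenInterval J ∧ ThreeBody.IsZeroLevelCurve m h γ J ∧
          (∃ s₀ ∈ J, γ s₀ = x₀ ∧ θ s₀ = t₀) ∧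
          (∀ s ∈ J, HasDerivAt θ (ThreeBody.tau (γ s).2.1) s) ∧ θ '' J = I ∧
          ∀ s ∈ J, γ s ∈ ThreeBody.collisionFree ∧
            ThreeBody.translationSetoid (ThreeBody.bodyState m (γ s)) (ζ (θ s))) ∧
    -- If moreover the trajectory ends in a binary collision, then the lift extends beyond it.
    (∀ (a b : ℝ) (ζ : ℝ → ThreeBody.Phase) (q : ThreeBody.Vec3) (i : Fin 3),
      ThreeBody.IsThreeBodyCurve m h ζ (Ioo a b) →
      Tendsto (fun t => (ζ t).1) (𝓝[<] b) (𝓝 q) →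
      ThreeBody.relPos q i = 0 → ThreeBody.relPos q ≠ 0 →
      ∀ t₀ ∈ Ioo a b, ∀ x₀ ∈ ThreeBody.collisionFree,
        ThreeBody.translationSetoid (ThreeBody.bodyState m x₀) (ζ t₀) →
        ∃ (J : Set ℝ) (γ : ℝ → ThreeBody.ExtPhase) (θ : ℝ → ℝ), ∃ s₁ ∈ J,
          ThreeBody.IsOpenInterval J ∧ ThreeBody.IsZeroLevelCurve m h γ J ∧
          (∃ s₀ ∈ J, γ s₀ = x₀ ∧ θ s₀ = t₀) ∧
          (∀ s ∈ J, HasDerivAt θ (ThreeBody.tau (γ s).2.1) s) ∧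
          θ '' {s ∈ J | s < s₁} = Ioo a b ∧ θ s₁ = b ∧ (γ s₁).2.1 i = 0 ∧
          ∀ s ∈ J, s < s₁ → γ s ∈ ThreeBody.collisionFree ∧
            ThreeBody.translationSetoid (ThreeBody.bodyState m (γ s)) (ζ (θ s))) := by
  open ThreeBody in
  refine ⟨⟨contDiffOn_regHam hm h, fun x hx hz => regHam_eq_sphHam hm h hx hz⟩,
    ⟨fun x hx => exists_isRegCurve hm h hx, fun J γ₁ γ₂ hJ h₁ h₂ ⟨s, hs, he⟩ =>
      h₁.eqOn hm hJ h₂ hs he⟩,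
    ⟨isSubmanifold_constraintSet, fun J γ hJ hγ ⟨s, hs, h0⟩ t ht =>
      hγ.mem_constraintSet hm hJ hs h0 ht⟩,
    ⟨fun k hk x hx => ?_, fun c x hx => ?_, fun k hk c x hx he => ?_,
      fun J γ₁ γ₂ hJ h₁ h₂ ⟨s, hs, he⟩ t ht => h₁.symmetrySetoid hm hJ h₂ hs he ht⟩,
    ⟨exists_covering hm, contDiffOn_bodyState hm, fun x hx =>
      ⟨regHam_eq_threeBodyHam hm h hx, fun v w hv hw => ?_⟩⟩,
    ⟨continuousOn_bodyPositions hm, fun x hx => ⟨fun h0 => ?_, fun i =>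
      relPos_bodyPositions_eq_zero_iff hm hx i⟩⟩,
    fun J γ hJ hγ => ⟨fun s hs i hi => ⟨fun j hj =>
      other_ne_zero (hγ.2 s hs).1.1.2 (hγ.2 s hs).1.2.2 hi hj, hγ.deriv_z_ne_zero hm hs hi⟩,
      fun s hs => hγ.eventually_collisionFree hm hJ hs, hγ.exists_threeBodyCurve hm hJ⟩,
    fun I ζ hI hζ t₀ ht₀ x₀ hx₀ h₀ => hζ.exists_lift hm hI ht₀ hx₀ h₀,
    fun a b ζ q i hζ hlim hi hq t₀ ht₀ x₀ hx₀ h₀ =>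
      hζ.exists_lift_through_collision hm hlim hi hq ht₀ hx₀ h₀⟩
  · have hk' : ∀ _ : Fin 3, |k| = k := fun _ => abs_of_pos hk
    rw [scaleAct_eq_gaugeAct]
    exact ⟨gaugeAct_mem_extDomain hk hk' 0 hx, regHam_gaugeAct hk hk' 0 m h hx,
      gaugeAct_mem_constraintSet hk hk' 0, omegaExt_fderiv_gaugeAct (fun _ => hk.ne') 0 x⟩
  · have h1 : ∀ i : Fin 3, |(1 : Fin 3 → ℝ) i| = 1 := fun _ => abs_one
    rw [shiftAct_eq_gaugeAct]
    exact ⟨gaugeAct_mem_extDomain one_pos h1 c hx, regHam_gaugeAct one_pos h1 c m h hx,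
      gaugeAct_mem_constraintSet one_pos h1 c, omegaExt_fderiv_gaugeAct (fun _ => one_ne_zero) c x⟩
  · rw [shiftAct_scaleAct] at he
    exact eq_one_and_eq_zero_of_gaugeAct_eq hk hx he
  · rw [fderiv_bodyState hm (collisionFree_subset hx), fderiv_bodyState hm (collisionFree_subset hx)]
    exact omegaPhase_dBodyState hm hx hv hw
  · exact hx.1.2 (funext fun i => (relPos_bodyPositions_eq_zero_iff hm hx i).1 (congrFun h0 i))
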